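/- Let $K$ be a field, $n\ge 2$, and let $A=K\langle x_1,\dots,x_n\rangle$ be the free unital associative $K$-algebra of rank $n$. A ring homomorphism $\varphi:A\to Q$ is called a flat bimorphism if it is injective, an epimorphism of rings, and makes $Q$ a flat left $A$-module. For a set $\Lambda$ of maximal two-sided ideals of $A$ of finite $K$-codimension, let $\mathfrak T_\Lambda$ be the set of right ideals of $A$ which contain a finite product of ideals from $\Lambda$ (repetitions are allowed, and the empty product is $A$); these are the open right ideals of a topology on $A$, also denoted $\mathfrak T_\Lambda$. (1) Each $\mathfrak T_\Lambda$ is a Gabriel topology, and a ring homomorphism $\varphi:A\to Q$ is a flat bimorphism if and only if there is such a set $\Lambda$ for which $\varphi$ is the canonical map from $A$ to its ring of right quotients with respect to $\mathfrak T_\Lambda$. (2) For each maximal two-sided ideal $I$ of finite codimension, $A/I\cong M_m(D)$ as $K$-algebras for some $m\ge 1$ and some division $K$-algebra $D$ of finite dimension over $K$. (3) Let $\Lambda=\{I_\lambda\}$ be non-empty, and let $Q$ be the ring of right quotients of $A$ with respect to $\mathfrak T_\Lambda$. If $A/I_\lambda\cong M_{m_\lambda}(D_\lambda)$ with division $K$-algebras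 $D_\lambda$, $l_\lambda=\dim_K D_\lambda$, and $d$ is the greatest common divisor of all the numbers $l_\lambda m_\lambda$, then $Q$ has module type $(1,d(n-1)+1)$: $Q\cong Q^{d(n-1)+1}$ as right $Q$-modules, and $1<d(n-1)+1$ are the smallest integers $1\le p<q$ for which the free right $Q$-modules $Q^p$ and $Q^q$ are isomorphic. (4) If the ideals in $\Lambda$ commute, i.e. $IJ=JI$ for all $I,J\in\Lambda$, then there is an isomorphism of topological rings, compatible with the canonical maps from $A$, between the (Hausdorff) completion of $A$ with respect to $\mathfrak T_\Lambda$ and $\prod_{I\in\Lambda}\varprojlim_l A/I^l$, where the $A/I^l$ are discrete and the inverse limits and the product carry their usual topologies. -/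

import Mathlib

open scoped TensorProduct

universe u

namespace FreeLoc

/-! ### Right ideals, Gabriel topologies, rings of right quotients -/

/-- Right ideals of a ring `A`: submodules of the right regular module. -/
abbrev RightIdeal (A : Type u) [Ring A] := Submodule Aᵐᵒᵖ A

/-- The right ideal `(R : a) = {x | a * x ∈ R}`. -/
def RightIdeal.colon {A : Type u} [Ring A] (R : RightIdeal A) (a : A) : RightIdeal A where
  carrier := {x | a * x ∈ R}
  add_mem' := by
    intro x y hx hy
    simp only [Set.mem_ofPred_eq] at hx hy ⊢
    rw [mul_add]
    exact R.add_mem hx hy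
  zero_mem' := by simp
  smul_mem' := by
    intro c x hx
    simp only [Set.mem_ofPred_eq] at hx ⊢
    have h := R.smul_mem c hx
    rwa [← mul_smul_comm] at h

/-- A (right) Gabriel topology on `A`, given by its set of open right ideals. -/
structure IsGabrielTopology {A : Type u} [Ring A] (F : Set (RightIdeal A)) : Prop where
  top_mem : ⊤ ∈ F
  mem_of_le : ∀ R ∈ F, ∀ S : RightIdeal A, R ≤ S → S ∈ F
  inf_mem : ∀ R ∈ F, ∀ S ∈ F, R ⊓ S ∈ F
  colon_mem : ∀ R ∈ F, ∀ a : A, R.colon a ∈ F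
  mem_of_colon_mem : ∀ S : RightIdeal A, (∃ R ∈ F, ∀ a ∈ R, S.colon a ∈ F) → S ∈ F

/-- `φ : A → Q` is (isomorphic over `A` to) the canonical map from `A` to its ring of right quotients
`A_F = colim_{J ∈ F} Hom_A(J, A / t(A))` with respect to the Gabriel topology `F`, where `t(A)` is
the `F`-torsion of `A`. The kernel of `φ` is `t(A)`, so `φ(A) ≅ A / t(A)`, and sending `q` to the
germ of left multiplication by `q` is a well-defined (`exists_dom`), injective (`torsion_free`) and
surjective (`exists_of_hom`) map from `Q` to `colim_{J ∈ F} Hom_A(J, φ(A))`; it turns products into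
compositions. -/
structure IsRingOfRightQuotients {A Q : Type u} [Ring A] [Ring Q] (F : Set (RightIdeal A))
    (φ : A →+* Q) : Prop where
  map_eq_zero_iff : ∀ a : A, φ a = 0 ↔ ∃ J ∈ F, ∀ x ∈ J, a * x = 0
  exists_dom : ∀ q : Q, ∃ J ∈ F, ∀ x ∈ J, q * φ x ∈ φ.range
  torsion_free : ∀ q : Q, (∃ J ∈ F, ∀ x ∈ J, q * φ x = 0) → q = 0
  exists_of_hom : ∀ J ∈ F, ∀ f : J →+ Q, (∀ x, f x ∈ φ.range) →
    (∀ (x : J) (a : A), f (MulOpposite.op a • x) = f x * φ a) → ∃ q : Q, ∀ x : J, f x = q * φ x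

/-! ### Flat bimorphisms -/

section Tensor

variable (A : Type u) [Ring A] (M M' : Type u) [AddCommGroup M] [Module Aᵐᵒᵖ M]
  [AddCommGroup M'] [Module Aᵐᵒᵖ M'] (N : Type u) [AddCommGroup N]

/-- The relations `(x a) ⊗ y = x ⊗ (a y)` which cut `M ⊗_A N` out of `M ⊗_ℤ N`. -/
def balancedRel [Module A N] : AddSubgroup (M ⊗[ℤ] N) :=
  AddSubgroup.closure {t | ∃ (x : M) (a : A) (y : N),
    t = (MulOpposite.op a • x) ⊗ₜ[ℤ] y - x ⊗ₜ[ℤ] (a • y)}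

/-- The tensor product `M ⊗_A N` (an abelian group) of a right and a left module over a not
necessarily commutative ring `A`. -/
abbrev BalancedTensor [Module A N] : Type u := (M ⊗[ℤ] N) ⧸ balancedRel A M N

variable {A M M'}

/-- `f ⊗_ℤ N : M ⊗_ℤ N → M' ⊗_ℤ N`. -/
def intMap (f : M →ₗ[Aᵐᵒᵖ] M') : M ⊗[ℤ] N →+ M' ⊗[ℤ] N :=
  (LinearMap.rTensor N f.toAddMonoidHom.toIntLinearMap).toAddMonoidHom

theorem intMap_tmul (f : M →ₗ[Aᵐᵒᵖ] M') (x : M) (y : N) :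
    intMap N f (x ⊗ₜ[ℤ] y) = f x ⊗ₜ[ℤ] y := rfl

/-- `f ⊗_A N : M ⊗_A N → M' ⊗_A N`. -/
def balancedMap [Module A N] (f : M →ₗ[Aᵐᵒᵖ] M') :
    BalancedTensor A M N →+ BalancedTensor A M' N :=
  QuotientAddGroup.map (balancedRel A M N) (balancedRel A M' N) (intMap N f) <| by
    refine (AddSubgroup.closure_le _).2 ?_
    rintro _ ⟨x, a, y, rfl⟩
    refine AddSubgroup.subset_closure ⟨f x, a, y, ?_⟩
    rw [map_sub, intMap_tmul, intMap_tmul, map_smul]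

end Tensor

/-- A left module `N` over a ring `A` is flat if `- ⊗_A N` preserves injections of right modules. -/
def IsLeftFlat (A : Type u) [Ring A] (N : Type u) [AddCommGroup N] [Module A N] : Prop :=
  ∀ (M M' : Type u) [AddCommGroup M] [Module Aᵐᵒᵖ M] [AddCommGroup M'] [Module Aᵐᵒᵖ M']
    (f : M →ₗ[Aᵐᵒᵖ] M'), Function.Injective f → Function.Injective (balancedMap N f)

/-- Epimorphisms in the category of rings. -/
def IsRingEpi {A Q : Type u} [Ring A] [Ring Q] (φ : A →+* Q) : Prop :=
  ∀ (C : Type u) [Ring C] (α β : Q →+* C), α.comp φ = β.comp φ → α = β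

/-- A flat bimorphism `φ : A → Q`: an injective ring epimorphism which makes `Q` a flat left
`A`-module. -/
structure IsFlatBimorphism {A Q : Type u} [Ring A] [Ring Q] (φ : A →+* Q) : Prop where
  injective : Function.Injective φ
  epi : IsRingEpi φ
  flat : @IsLeftFlat A _ Q _ (Module.compHom Q φ)

/-! ### Module type -/

/-- `Q` has module type `(m, k)`, `1 ≤ m < k`: these are the smallest integers such that the free
right modules `Q ^ m` and `Q ^ k` are isomorphic. -/
structure HasModuleType (Q : Type u) [Ring Q] (m k : ℕ) : Prop where
  one_le : 1 ≤ m
  lt : m < k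
  iso : Nonempty ((Fin m → Q) ≃ₗ[Qᵐᵒᵖ] (Fin k → Q))
  least : ∀ p q : ℕ, 1 ≤ p → p < q → Nonempty ((Fin p → Q) ≃ₗ[Qᵐᵒᵖ] (Fin q → Q)) → m ≤ p ∧ k ≤ q

/-! ### Sets of maximal two-sided ideals of finite codimension -/

/-- The maximal two-sided ideals of finite codimension of a `K`-algebra `A`. (In Mathlib, `Ideal A`
is the type of left ideals; two-sidedness is the predicate `Ideal.IsTwoSided`.) -/
@[ext]
structure MaxFinIdeal (K A : Type u) [Field K] [Ring A] [Algebra K A] where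
  /-- The underlying ideal. -/
  toIdeal : Ideal A
  isTwoSided : toIdeal.IsTwoSided
  ne_top : toIdeal ≠ ⊤
  maximal : ∀ J : Ideal A, J.IsTwoSided → toIdeal < J → J = ⊤
  finite : FiniteDimensional K (A ⧸ toIdeal)

attribute [instance] MaxFinIdeal.isTwoSided

section Products

variable {K A : Type u} [Field K] [Ring A] [Algebra K A]

/-- The product of a finite sequence of ideals taken from `Λ` (the empty product is `A`). -/
def prodIdeal {Λ : Set (MaxFinIdeal K A)} (L : List Λ) : Ideal A :=
  (L.map fun I => I.1.toIdeal).prod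

/-- The open right ideals of the topology `𝔗_Λ`: those containing a product of ideals from `Λ`. -/
def openRightIdeals (Λ : Set (MaxFinIdeal K A)) : Set (RightIdeal A) :=
  {R | ∃ L : List Λ, ∀ x ∈ prodIdeal L, x ∈ R}

theorem prodIdeal_isTwoSided {Λ : Set (MaxFinIdeal K A)} (L : List Λ) :
    (prodIdeal L).IsTwoSided := by
  induction L with
  | nil =>
    simp only [prodIdeal, List.map_nil, List.prod_nil, Ideal.one_eq_top]
    infer_instance
  | cons I L ih =>
    have h : prodIdeal (I :: L) = I.1.toIdeal * prodIdeal L := by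
      simp [prodIdeal]
    rw [h]
    infer_instance

theorem prodIdeal_append_le {Λ : Set (MaxFinIdeal K A)} (L L' : List Λ) :
    prodIdeal (L ++ L') ≤ prodIdeal L ⊓ prodIdeal L' := by
  induction L with
  | nil => simp [prodIdeal, Ideal.one_eq_top]
  | cons I L ih =>
    have h : ∀ M : List Λ, prodIdeal (I :: M) = I.1.toIdeal * prodIdeal M := by
      intro M
      simp [prodIdeal]
    rw [List.cons_append, h, h]
    refine le_inf (Ideal.mul_mono le_rfl (ih.trans inf_le_left)) ?_
    refine Ideal.mul_le.2 fun r _ s hs => (prodIdeal L').mul_mem_left r ?_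
    exact (ih.trans inf_le_right) hs

/-- Products of ideals from `Λ` are a basis of neighbourhoods of zero of a ring topology. -/
theorem ringSubgroupsBasis (Λ : Set (MaxFinIdeal K A)) :
    RingSubgroupsBasis fun L : List Λ => (prodIdeal L).toAddSubgroup where
  inter L L' := ⟨L ++ L', prodIdeal_append_le L L'⟩
  mul L := by
    refine ⟨L, ?_⟩
    rintro _ ⟨x, _, y, hy, rfl⟩
    exact (prodIdeal L).mul_mem_left x hy
  leftMul x L := ⟨L, fun _ hy => (prodIdeal L).mul_mem_left x hy⟩
  rightMul x L := ⟨L, fun _ hy => by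
    have := prodIdeal_isTwoSided L
    exact (prodIdeal L).mul_mem_right x hy⟩

/-- The ring `A` with the topology `𝔗_Λ`. -/
def Topologized (_Λ : Set (MaxFinIdeal K A)) : Type u := A

namespace Topologized

variable (Λ : Set (MaxFinIdeal K A))

instance : Ring (Topologized Λ) := inferInstanceAs (Ring A)

instance : TopologicalSpace (Topologized Λ) := (ringSubgroupsBasis Λ).topology

instance : IsTopologicalRing (Topologized Λ) :=
  (ringSubgroupsBasis Λ).toRingFilterBasis.isTopologicalRing

instance : UniformSpace (Topologized Λ) := IsTopologicalAddGroup.rightUniformSpace (Topologized Λ)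

instance : IsUniformAddGroup (Topologized Λ) := isUniformAddGroup_of_addCommGroup

/-- The identity map, from `A` to `A` with the topology `𝔗_Λ`. -/
def mk : A →+* Topologized Λ := RingHom.id A

end Topologized

end Products

/-! ### The inverse limit of the powers of an ideal -/

section AdicLimit

variable {A : Type u} [Ring A] (I : Ideal A) [I.IsTwoSided]

/-- `lim A / I ^ l` as the subring of coherent sequences in the product of the `A / I ^ l`. -/
def adicSubring : Subring (∀ l : ℕ, A ⧸ I ^ l) where
  carrier := {x | ∀ (k l : ℕ) (h : k ≤ l),
    Ideal.Quotient.factor (Ideal.pow_le_pow_right h) (x l) = x k}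
  mul_mem' := by
    intro x y hx hy k l h
    rw [Pi.mul_apply, map_mul, hx k l h, hy k l h, Pi.mul_apply]
  one_mem' := by
    intro k l h
    rw [Pi.one_apply, map_one, Pi.one_apply]
  add_mem' := by
    intro x y hx hy k l h
    rw [Pi.add_apply, map_add, hx k l h, hy k l h, Pi.add_apply]
  zero_mem' := by
    intro k l h
    rw [Pi.zero_apply, map_zero, Pi.zero_apply]
  neg_mem' := by
    intro x hx k l h
    rw [Pi.neg_apply, map_neg, hx k l h, Pi.neg_apply]

/-- The inverse limit `lim A / I ^ l`. -/
def AdicLimit : Type u := adicSubring I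

namespace AdicLimit

instance : Ring (AdicLimit I) := inferInstanceAs (Ring (adicSubring I))

/-- The inverse limit topology, all `A / I ^ l` being discrete. -/
instance : TopologicalSpace (AdicLimit I) :=
  TopologicalSpace.induced (fun x : adicSubring I => (x : ∀ l : ℕ, A ⧸ I ^ l))
    (@Pi.topologicalSpace ℕ (fun l => A ⧸ I ^ l) fun _ => ⊥)

/-- The canonical map `A → lim A / I ^ l`. -/
def of : A →+* AdicLimit I :=
  RingHom.codRestrict (RingHom.pi fun l : ℕ => Ideal.Quotient.mk (I ^ l)) (adicSubring I)
    fun _ _ _ _ => rfl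

end AdicLimit

end AdicLimit

end FreeLoc

set_option linter.unusedSectionVars false

namespace FreeLoc

open MulOpposite

/-! ### Kernels of maps from free modules onto finite-dimensional modules -/

section FreeAlgebraInduction

variable {K X : Type*} [Field K]

/-! Everything rests on Schreier's formula (`exists_ker_equiv_free`): the kernel of a map from `A^ι`
onto a module `V` of finite dimension `N` is free of rank `|ι| + N (n - 1)`. It is read off from the
exact sequence `0 → V ⊗ A^X → V ⊗ A → V → 0`, with a basis of `V` given by a prefix-closed set of
words. In particular right ideals of finite codimension are free of finite rank.

Flat bimorphisms. Finite generation of the products of ideals from `Λ` gives the Gabriel axioms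
(`isGabrielTopology_of_fg`). If `φ` is a flat bimorphism, then `Q` is the ring of quotients for the
right ideals `R` with `RQ = Q`: flatness turns `m ⊗ 1 = 0` into `ann(m) Q = Q`, and epimorphy gives
`1 ⊗ q = q ⊗ 1`. Such an `R` contains a finitely generated one, which is essential by flatness and
so has finite codimension (`finiteDimensional_quotient_of_essential`). Its two-sided core still
generates `Q` and contains a product of maximal ideals that generate `Q`. Conversely, each `I ∈ Λ`
is free, its coordinate functions are left multiplications by elements of `Q`, and so `IQ = Q`; this
makes `φ` a flat epimorphism. It is injective because `A` is a domain.

The factor rings are simple and Artinian, so Wedderburn's theorem applies.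

Module type. The elements whose matrix modulo `I` has a zero row form an open right ideal of
codimension `l m`, which is free of rank `1 + l m (n - 1)`; hence `Q ≅ Q^(1 + l m (n - 1))`, and
`FreeIso.of_gcd` passes to the gcd. In the other direction, an isomorphism `Q^p ≅ Q^q` yields one
`A`-lattice inside both `A^p` and `A^q` whose codimensions are divisible by `d`. Comparing its two
Schreier ranks bounds `q - p` below (`IsRingOfRightQuotients.rank_le`).

Completion. Distinct maximal ideals are comaximal, so when they commute a product contains an
intersection of powers. The topology is then induced from the product of the adic limits, where `A`
is dense by the Chinese remainder theorem. -/

theorem freeAlgebra_left_induction {P : FreeAlgebra K X → Prop} (one : P 1)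
    (add : ∀ a b, P a → P b → P (a + b)) (smul : ∀ (k : K) a, P a → P (k • a))
    (mul : ∀ x a, P a → P (FreeAlgebra.ι K x * a)) (a : FreeAlgebra K X) : P a := by
  suffices h : ∀ a b : FreeAlgebra K X, P b → P (a * b) by simpa using h a 1 one
  intro a
  induction a with
  | grade0 r => intro b hb; rw [← Algebra.smul_def]; exact smul r b hb
  | grade1 x => exact mul x
  | mul a b ha hb => intro c hc; rw [mul_assoc]; exact ha _ (hb _ hc)
  | add a b ha hb => intro c hc; rw [add_mul]; exact add _ _ (ha _ hc) (hb _ hc)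

theorem freeAlgebra_right_induction {P : FreeAlgebra K X → Prop} (one : P 1)
    (add : ∀ a b, P a → P b → P (a + b)) (smul : ∀ (k : K) a, P a → P (k • a))
    (mul : ∀ x a, P a → P (a * FreeAlgebra.ι K x)) (a : FreeAlgebra K X) : P a := by
  suffices h : ∀ a b : FreeAlgebra K X, P b → P (b * a) by simpa using h a 1 one
  intro a
  induction a with
  | grade0 r => intro b hb; rw [← Algebra.commutes, ← Algebra.smul_def]; exact smul r b hb
  | grade1 x => exact mul x
  | mul a b ha hb => intro c hc; rw [← mul_assoc]; exact hb _ (ha _ hc)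
  | add a b ha hb => intro c hc; rw [mul_add]; exact add _ _ (ha _ hc) (hb _ hc)

end FreeAlgebraInduction

/-- Extension by zero along an injection of index types, as a linear map. -/
noncomputable def extendZero {S B : Type*} (R A : Type*) [Ring R] [AddCommGroup A] [Module R A]
    (c : S → B) (hc : Function.Injective c) : (S → A) →ₗ[R] (B → A) where
  toFun g := Function.extend c g 0
  map_add' f g := by
    ext p
    by_cases hp : ∃ s, c s = p
    · obtain ⟨s, rfl⟩ := hp
      simp [hc.extend_apply]
    · simp [Function.extend_apply' _ _ _ hp]
  map_smul' r g := by
    ext p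
    by_cases hp : ∃ s, c s = p
    · obtain ⟨s, rfl⟩ := hp
      simp [hc.extend_apply]
    · simp [Function.extend_apply' _ _ _ hp]

/-- If a block of columns of a map between free modules is invertible, then the kernel is free on
the remaining columns. -/
theorem exists_ker_equiv_of_bijective_block {R A B S : Type*} [Ring R] [AddCommGroup A] [Module R A]
    (Φ : (B → A) →ₗ[R] (S → A)) (c : S → B) (hc : Function.Injective c)
    (h : Function.Bijective (Φ ∘ₗ extendZero R A c hc)) :
    Nonempty (LinearMap.ker Φ ≃ₗ[R] ({p : B // p ∉ Set.range c} → A)) := by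
  let ρ : (B → A) →ₗ[R] ({p : B // p ∉ Set.range c} → A) := LinearMap.funLeft R A Subtype.val
  have hext : ∀ g : S → A, ρ (extendZero R A c hc g) = 0 := by
    intro g
    ext ⟨p, hp⟩
    change Function.extend c g 0 p = 0
    rw [Function.extend_apply' _ _ _ (by simpa using hp)]
    rfl
  -- Restricting to the unselected coordinates loses nothing on the kernel: the selected ones are
  -- found uniquely by solving with the invertible block.
  refine ⟨LinearEquiv.ofBijective (ρ ∘ₗ (LinearMap.ker Φ).subtype) ⟨?_, ?_⟩⟩
  · refine (injective_iff_map_eq_zero _).2 ?_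
    rintro ⟨f, hf⟩ hρ
    have hf' : extendZero R A c hc (f ∘ c) = f := by
      ext p
      change Function.extend c (f ∘ c) 0 p = f p
      by_cases hp : p ∈ Set.range c
      · obtain ⟨s, rfl⟩ := hp
        rw [hc.extend_apply]
        rfl
      · rw [Function.extend_apply' _ _ _ (by simpa using hp)]
        exact (congrFun hρ ⟨p, hp⟩).symm
    have h0 : f ∘ c = 0 := by
      apply h.1
      rw [LinearMap.comp_apply, hf', map_zero]
      exact hf
    rw [h0, map_zero] at hf'
    exact Subtype.ext hf'.symm
  · intro r
    classical
    let f₀ : B → A := fun p => if hp : p ∈ Set.range c then 0 else r ⟨p, hp⟩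
    obtain ⟨g, hg⟩ := h.2 (-Φ f₀)
    refine ⟨⟨extendZero R A c hc g + f₀, ?_⟩, ?_⟩
    · rw [LinearMap.mem_ker, map_add]
      rw [LinearMap.comp_apply] at hg
      rw [hg, neg_add_cancel]
    · rw [LinearMap.comp_apply, Submodule.subtype_apply, map_add, hext, zero_add]
      ext ⟨p, hp⟩
      exact dif_neg hp

/-! ### Schreier's rank formula. -/

section Schreier

variable {K X ι : Type*} [Field K] {V : Type*} [AddCommGroup V]
  [Module (FreeAlgebra K X)ᵐᵒᵖ V] [Module K V]

variable (K) in
/-- The element `v i * x₁ ⋯ x_k` for the word `(i, [x_k, …, x₁])`. -/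
def wordVal (v : ι → V) : ι × List X → V
  | (i, []) => v i
  | (i, x :: w) => op (FreeAlgebra.ι K x) • wordVal v (i, w)

/-- Independence bounds the cardinality by `dim V`, so a closed independent set of maximal size
exists. If an empty word or a one-letter extension of a member had its value outside the span, it
could be adjoined; hence the span contains the generators and is stable under all letters. The last
letter of a word is the head of its list, so closure under tails means closure under prefixes. -/
theorem exists_schreier_transversal [IsScalarTower K (FreeAlgebra K X)ᵐᵒᵖ V] [FiniteDimensional K V]
    (v : ι → V) (hv : Submodule.span (FreeAlgebra K X)ᵐᵒᵖ (Set.range v) = ⊤) :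
    ∃ S : Finset (ι × List X), (∀ i x w, (i, x :: w) ∈ S → (i, w) ∈ S) ∧
      LinearIndependent K (fun s : S => wordVal K v (s : ι × List X)) ∧
      ⊤ ≤ Submodule.span K (Set.range fun s : S => wordVal K v (s : ι × List X)) := by
  classical
  let P : Finset (ι × List X) → Prop := fun S => (∀ i x w, (i, x :: w) ∈ S → (i, w) ∈ S) ∧
      LinearIndependent K (fun s : S => wordVal K v (s : ι × List X))
  have hcard : ∀ S, P S → S.card ≤ Module.finrank K V := by
    intro S hS
    simpa using hS.2.fintype_card_le_finrank
  have h0 : P ∅ := ⟨by simp, linearIndependent_empty_type⟩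
  obtain ⟨S, hS, hmax⟩ : ∃ S, P S ∧ ∀ S', P S' → S'.card ≤ S.card := by
    by_contra! hcon
    have : ∀ k : ℕ, ∃ S, P S ∧ k ≤ S.card := by
      intro k
      induction k with
      | zero => exact ⟨∅, h0, by simp⟩
      | succ k ih =>
        obtain ⟨S, hS, hk⟩ := ih
        obtain ⟨S', hS', hlt⟩ := hcon S hS
        exact ⟨S', hS', by omega⟩
    obtain ⟨S, hS, hk⟩ := this (Module.finrank K V + 1)
    have := hcard S hS
    omega
  refine ⟨S, hS.1, hS.2, ?_⟩
  set W := Submodule.span K (Set.range fun s : S => wordVal K v (s : ι × List X)) with hW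
  have hWim : W = Submodule.span K (wordVal K v '' (S : Set (ι × List X))) := by
    rw [hW]
    congr 1
    ext y
    simp
  have hmem : ∀ s ∈ S, wordVal K v s ∈ W := fun s hs => Submodule.subset_span ⟨⟨s, hs⟩, rfl⟩
  have key : ∀ i w, ((i, w) ∈ S ∨ w = [] ∨ (i, w.tail) ∈ S) → wordVal K v (i, w) ∈ W := by
    intro i w hw
    by_contra hcon
    have hnot : (i, w) ∉ S := fun h => hcon (hmem _ h)
    have hP : P (insert (i, w) S) := by
      refine ⟨?_, ?_⟩
      · intro i' x' w' h'
        rcases Finset.mem_insert.1 h' with h' | h'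
        · obtain ⟨rfl, rfl⟩ := Prod.mk.inj h'
          rcases hw with hw | hw | hw
          · exact absurd hw hnot
          · simp at hw
          · exact Finset.mem_insert_of_mem hw
        · exact Finset.mem_insert_of_mem (hS.1 _ _ _ h')
      · have hl : LinearIndepOn K (wordVal K v) (S : Set (ι × List X)) := hS.2
        have := hl.insert (x := (i, w)) (by rw [← hWim]; exact hcon)
        have h2 : LinearIndepOn K (wordVal K v) ((insert (i, w) S : Finset _) : Set (ι × List X)) := by
          rw [Finset.coe_insert]
          exact this
        exact h2
    have := hmax _ hP
    rw [Finset.card_insert_of_notMem hnot] at this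
    omega
  have hstep : ∀ (x : X), ∀ y ∈ W, op (FreeAlgebra.ι K x) • y ∈ W := by
    intro x y hy
    induction hy using Submodule.span_induction with
    | mem y hy =>
      obtain ⟨⟨⟨i, w⟩, hs⟩, rfl⟩ := hy
      have h := key i (x :: w) (Or.inr (Or.inr hs))
      rwa [wordVal] at h
    | zero => rw [smul_zero]; exact W.zero_mem
    | add y z _ _ hy hz => rw [smul_add]; exact W.add_mem hy hz
    | smul k y _ hy => rw [smul_algebra_smul_comm]; exact W.smul_mem k hy
  have hall : ∀ (a : FreeAlgebra K X), ∀ y ∈ W, op a • y ∈ W := by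
    intro a
    induction a using freeAlgebra_left_induction with
    | one => intro y hy; simpa using hy
    | add a b ha hb => intro y hy; rw [op_add, add_smul]; exact W.add_mem (ha y hy) (hb y hy)
    | smul k a ha => intro y hy; rw [op_smul, smul_assoc]; exact W.smul_mem k (ha y hy)
    | mul x a ha => intro y hy; rw [op_mul, mul_smul]; exact ha _ (hstep x y hy)
  intro y _
  have hy : y ∈ Submodule.span (FreeAlgebra K X)ᵐᵒᵖ (Set.range v) := by rw [hv]; trivial
  induction hy using Submodule.span_induction with
  | mem y hy =>
    obtain ⟨i, rfl⟩ := hy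
    have h := key i [] (Or.inr (Or.inl rfl))
    rwa [wordVal] at h
  | zero => exact W.zero_mem
  | add y z _ _ hy hz => exact W.add_mem (hy trivial) (hz trivial)
  | smul a y _ hy => exact hall a.unop y (hy trivial)

variable [IsScalarTower K (FreeAlgebra K X)ᵐᵒᵖ V] {S : Type*} [Fintype S] [Fintype X]
  (b : Module.Basis S K V)

/-- In coordinates, the map `V ⊗ A → V`, `y ⊗ a ↦ y * a`. -/
noncomputable def evalMap : (S → FreeAlgebra K X) →ₗ[(FreeAlgebra K X)ᵐᵒᵖ] V where
  toFun g := ∑ s, op (g s) • b s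
  map_add' f g := by simp [add_smul, Finset.sum_add_distrib]
  map_smul' a g := by
    simp only [Pi.smul_apply, RingHom.id_apply, Finset.smul_sum, smul_smul]
    rfl

/-- In coordinates, the map `V ⊗ Aˣ → V ⊗ A`, `y ⊗ e_x a ↦ y * x ⊗ a - y ⊗ x * a`. -/
noncomputable def boundaryMap : (S × X → FreeAlgebra K X) →ₗ[(FreeAlgebra K X)ᵐᵒᵖ] (S → FreeAlgebra K X) where
  toFun f := fun s => ∑ t, ∑ x, b.repr (op (FreeAlgebra.ι K x) • b t) s • f (t, x) -
    ∑ x, FreeAlgebra.ι K x * f (s, x)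
  map_add' f g := by
    ext s
    simp only [Pi.add_apply, smul_add, mul_add, Finset.sum_add_distrib]
    abel
  map_smul' a g := by
    ext s
    simp only [Pi.smul_apply, RingHom.id_apply, smul_sub, Finset.smul_sum]
    congr 1
    · refine Finset.sum_congr rfl fun t _ => Finset.sum_congr rfl fun x _ => smul_comm _ _ _
    · refine Finset.sum_congr rfl fun t _ => mul_smul_comm _ _ _

theorem boundaryMap_apply (f : S × X → FreeAlgebra K X) (s : S) :
    boundaryMap b f s = ∑ t, ∑ x, b.repr (op (FreeAlgebra.ι K x) • b t) s • f (t, x) -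
    ∑ x, FreeAlgebra.ι K x * f (s, x) := rfl

open Classical in
/-- The endomorphisms defining the contracting homotopy `homotopyFun` by recursion. -/
noncomputable def homotopyStep (x : X) :
    Module.End K ((S → S × X → FreeAlgebra K X) × FreeAlgebra K X) where
  toFun p := (fun t => ∑ s, b.repr (op (FreeAlgebra.ι K x) • b t) s • p.1 s -
    Pi.single (t, x) p.2, FreeAlgebra.ι K x * p.2)
  map_add' p q := by
    ext1
    · funext t
      simp only [Prod.fst_add, Pi.add_apply, smul_add, Finset.sum_add_distrib, Prod.snd_add,
        Pi.single_add]
      abel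
    · simp [mul_add]
  map_smul' k p := by
    ext1
    · funext t
      simp only [Prod.smul_fst, Pi.smul_apply, Prod.smul_snd, RingHom.id_apply, smul_sub,
        Finset.smul_sum, Pi.single_smul]
      congr 1
      exact Finset.sum_congr rfl fun s _ => smul_comm _ _ _
    · simp

/-- In coordinates, the contracting homotopy `V ⊗ A → V ⊗ Aˣ`. -/
noncomputable def homotopyFun : FreeAlgebra K X →ₗ[K] (S → S × X → FreeAlgebra K X) :=
  LinearMap.fst K _ _ ∘ₗ LinearMap.applyₗ (0, 1) ∘ₗ
    (FreeAlgebra.lift K (homotopyStep b)).toLinearMap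

theorem homotopyFun_one : homotopyFun b (1 : FreeAlgebra K X) = 0 := by
  simp [homotopyFun]

/-- The second component only records the element acted with so far, which the recursion in the
first component needs for its overflow term. -/
theorem lift_homotopyStep_snd (a : FreeAlgebra K X) :
    (FreeAlgebra.lift K (homotopyStep b) a (0, 1)).2 = a := by
  induction a using freeAlgebra_left_induction with
  | one => simp
  | add a b ha hb => simp [ha, hb]
  | smul k a ha => simp [ha]
  | mul x a ha =>
    rw [map_mul, FreeAlgebra.lift_ι_apply, Module.End.mul_apply]
    change FreeAlgebra.ι K x * _ = _
    rw [ha]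

open Classical in
theorem homotopyFun_mul (x : X) (a : FreeAlgebra K X) (t : S) :
    homotopyFun b (FreeAlgebra.ι K x * a) t =
      ∑ s, b.repr (op (FreeAlgebra.ι K x) • b t) s • homotopyFun b a s - Pi.single (t, x) a := by
  have h : homotopyFun b (FreeAlgebra.ι K x * a) =
      (homotopyStep b x (FreeAlgebra.lift K (homotopyStep b) a (0, 1))).1 := by
    simp [homotopyFun]
  rw [h]
  change ∑ s, _ • _ - Pi.single (M := fun _ => FreeAlgebra K X) (t, x)
    (FreeAlgebra.lift K (homotopyStep b) a (0, 1)).2 = _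
  rw [lift_homotopyStep_snd]
  rfl

open Classical in
-- The homotopy is a left inverse of the boundary: the terms with structure constants cancel by the
-- recursion, leaving the coordinates of `f`.
theorem sum_homotopyFun_boundaryMap (f : S × X → FreeAlgebra K X) :
    ∑ s, homotopyFun b (boundaryMap b f s) s = f := by
  simp only [boundaryMap_apply, map_sub, map_sum, map_smul, Pi.sub_apply, Finset.sum_apply,
    Pi.smul_apply, homotopyFun_mul, Finset.sum_sub_distrib]
  have h1 : ∑ s, ∑ t, ∑ x, b.repr (op (FreeAlgebra.ι K x) • b t) s • homotopyFun b (f (t, x)) s =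
      ∑ t, ∑ x, ∑ s, b.repr (op (FreeAlgebra.ι K x) • b t) s • homotopyFun b (f (t, x)) s := by
    rw [Finset.sum_comm]
    exact Finset.sum_congr rfl fun t _ => Finset.sum_comm
  rw [h1, sub_sub_cancel, ← Fintype.sum_prod_type (fun p => Pi.single p (f p))]
  exact Finset.univ_sum_single f

theorem boundaryMap_single [DecidableEq S] [DecidableEq (S × X)] (t : S) (x : X) (a : FreeAlgebra K X) (s : S) :
    boundaryMap b (Pi.single (t, x) a) s =
      b.repr (op (FreeAlgebra.ι K x) • b t) s • a - Pi.single (M := fun _ => FreeAlgebra K X) t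
        (FreeAlgebra.ι K x * a) s := by
  rw [boundaryMap_apply]
  congr 1
  · rw [← Fintype.sum_prod_type
      (fun p : S × X => b.repr (op (FreeAlgebra.ι K p.2) • b p.1) s •
        (Pi.single (M := fun _ => FreeAlgebra K X) (t, x) a p))]
    rw [Finset.sum_eq_single (t, x)]
    · simp
    · intro p _ hp
      rw [Pi.single_eq_of_ne hp, smul_zero]
    · simp
  · by_cases hst : s = t
    · subst hst
      rw [Finset.sum_eq_single x]
      · simp
      · intro y _ hy
        rw [Pi.single_eq_of_ne (by simpa using hy), mul_zero]
      · simp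
    · rw [Pi.single_eq_of_ne hst]
      refine Finset.sum_eq_zero fun y _ => ?_
      rw [Pi.single_eq_of_ne (by simp [hst]), mul_zero]

open Classical in
-- In invariant terms the boundary of the homotopy is `y ⊗ a ↦ y ⊗ a - y a ⊗ 1`. The induction
-- prepends a letter to `a`, which replaces `b t` by a combination of other basis vectors; hence `t`
-- is generalized.
theorem boundaryMap_homotopyFun (a : FreeAlgebra K X) (t : S) :
    boundaryMap b (homotopyFun b a t) =
      Pi.single t a - fun s => b.repr (op a • b t) s • (1 : FreeAlgebra K X) := by
  induction a using freeAlgebra_left_induction generalizing t with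
  | one =>
    ext s
    simp [homotopyFun_one, Finsupp.single_apply, Pi.single_apply, eq_comm (a := s)]
  | add a c ha hc =>
    rw [map_add, Pi.add_apply, map_add, ha, hc, Pi.single_add]
    ext s
    simp [add_smul]
    abel
  | smul k a ha =>
    have h : boundaryMap b (k • homotopyFun b a t) = k • boundaryMap b (homotopyFun b a t) := by
      rw [← algebraMap_smul (FreeAlgebra K X)ᵐᵒᵖ k (homotopyFun b a t), map_smul,
        algebraMap_smul]
    rw [map_smul, Pi.smul_apply, h, ha]
    ext s
    simp [Pi.single_apply, smul_sub, smul_smul]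
  | mul x a ha =>
    have h : ∀ (k : K) (f : S × X → FreeAlgebra K X), boundaryMap b (k • f) = k • boundaryMap b f := by
      intro k f
      rw [← algebraMap_smul (FreeAlgebra K X)ᵐᵒᵖ k f, map_smul, algebraMap_smul]
    rw [homotopyFun_mul, map_sub, map_sum]
    simp only [h, ha]
    have h2 : op (FreeAlgebra.ι K x * a) • b t =
        ∑ s, b.repr (op (FreeAlgebra.ι K x) • b t) s • (op a • b s) := by
      rw [op_mul, mul_smul]
      conv_lhs => rw [← b.sum_repr (op (FreeAlgebra.ι K x) • b t)]
      rw [Finset.smul_sum]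
      exact Finset.sum_congr rfl fun s _ => smul_algebra_smul_comm _ _ _
    rw [h2]
    ext s
    simp only [Pi.sub_apply, boundaryMap_single, Finset.sum_apply, Pi.smul_apply, map_sum, map_smul,
      Finsupp.coe_finsetSum, Finsupp.coe_smul, smul_sub, Finset.sum_sub_distrib, Finset.sum_smul,
      smul_smul, smul_eq_mul]
    rw [Finset.sum_eq_single s (by
      intro u _ hu
      rw [Pi.single_eq_of_ne (Ne.symm hu), smul_zero]) (by simp)]
    rw [Pi.single_eq_same]
    abel

theorem boundaryMap_injective : Function.Injective (boundaryMap (X := X) b) := by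
  intro f g h
  rw [← sum_homotopyFun_boundaryMap b f, h, sum_homotopyFun_boundaryMap]

/-- Apply the homotopy to `g`: the correction term of `boundaryMap_homotopyFun` is the evaluation of
`g`, tensored with `1`, and it vanishes. -/
theorem exists_boundaryMap_eq {g : S → FreeAlgebra K X} (hg : evalMap b g = 0) :
    ∃ f, boundaryMap b f = g := by
  classical
  refine ⟨∑ s, homotopyFun b (g s) s, ?_⟩
  rw [map_sum]
  simp only [boundaryMap_homotopyFun, Finset.sum_sub_distrib]
  rw [Finset.univ_sum_single g, sub_eq_self]
  ext s
  have h := congrArg (fun y => b.repr y s) hg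
  simp only [evalMap, LinearMap.coe_mk, AddHom.coe_mk, map_sum, map_zero, Finsupp.coe_zero,
    Pi.zero_apply, Finsupp.coe_finsetSum, Finset.sum_apply] at h
  rw [Finset.sum_apply, ← Finset.sum_smul, h, zero_smul]
  rfl

theorem evalMap_boundaryMap (f : S × X → FreeAlgebra K X) : evalMap b (boundaryMap b f) = 0 := by
  simp only [evalMap, LinearMap.coe_mk, AddHom.coe_mk, boundaryMap_apply, op_sub, Finset.op_sum, sub_smul,
    Finset.sum_smul, Finset.sum_sub_distrib]
  rw [sub_eq_zero, Finset.sum_comm]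
  refine Finset.sum_congr rfl fun t _ => ?_
  rw [Finset.sum_comm]
  refine Finset.sum_congr rfl fun x _ => ?_
  rw [op_mul, mul_smul]
  conv_rhs => rw [← b.sum_repr (op (FreeAlgebra.ι K x) • b t), Finset.smul_sum]
  refine Finset.sum_congr rfl fun s _ => ?_
  rw [op_smul, smul_assoc, smul_algebra_smul_comm]

theorem evalMap_repr {ι : Type*} [Fintype ι] (v : ι → V) (g : ι → FreeAlgebra K X) :
    evalMap b (fun s => ∑ i, b.repr (v i) s • g i) = ∑ i, op (g i) • v i := by
  simp only [evalMap, LinearMap.coe_mk, AddHom.coe_mk, Finset.op_sum, Finset.sum_smul]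
  rw [Finset.sum_comm]
  refine Finset.sum_congr rfl fun i _ => ?_
  conv_rhs => rw [← b.sum_repr (v i), Finset.smul_sum]
  refine Finset.sum_congr rfl fun s _ => ?_
  rw [op_smul, smul_assoc, smul_algebra_smul_comm]

/-- The map `A^ι ⊕ V ⊗ Aˣ → V ⊗ A` whose kernel is the kernel of `A^ι → V`, `e_i ↦ v i`. -/
noncomputable def presentationMap {ι : Type*} [Fintype ι] (v : ι → V) :
    (ι ⊕ S × X → FreeAlgebra K X) →ₗ[(FreeAlgebra K X)ᵐᵒᵖ] (S → FreeAlgebra K X) where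
  toFun f := (fun s => ∑ i, b.repr (v i) s • f (Sum.inl i)) + boundaryMap b (f ∘ Sum.inr)
  map_add' f g := by
    have h : (f + g) ∘ Sum.inr = f ∘ (Sum.inr : S × X → ι ⊕ S × X) + g ∘ Sum.inr := rfl
    rw [h, map_add]
    ext s
    simp only [Pi.add_apply, smul_add, Finset.sum_add_distrib]
    abel
  map_smul' a g := by
    have h : (a • g) ∘ Sum.inr = a • (g ∘ (Sum.inr : S × X → ι ⊕ S × X)) := rfl
    rw [h, map_smul, RingHom.id_apply, smul_add]
    congr 1
    ext s
    simp only [Pi.smul_apply, Finset.smul_sum]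
    exact Finset.sum_congr rfl fun i _ => smul_comm _ _ _

theorem presentationMap_apply {ι : Type*} [Fintype ι] (v : ι → V)
    (f : ι ⊕ S × X → FreeAlgebra K X) :
    presentationMap b v f = (fun s => ∑ i, b.repr (v i) s • f (Sum.inl i)) +
      boundaryMap b (f ∘ Sum.inr) := rfl

theorem evalMap_presentationMap {ι : Type*} [Fintype ι] (v : ι → V)
    (f : ι ⊕ S × X → FreeAlgebra K X) :
    evalMap b (presentationMap b v f) = ∑ i, op (f (Sum.inl i)) • v i := by
  rw [presentationMap_apply, map_add, evalMap_repr b v (fun i => f (Sum.inl i)),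
    evalMap_boundaryMap, add_zero]

/-- If `π g = 0`, the lift of `∑ v i * g i` to `V ⊗ A` evaluates to zero, so it is the boundary of
exactly one element. The component in `V ⊗ A^X` of a kernel element is thus determined by, and
exists for, each `g` in `ker π`. -/
theorem exists_ker_presentationMap_equiv {ι : Type*} [Fintype ι] [DecidableEq ι]
    (π : (ι → FreeAlgebra K X) →ₗ[(FreeAlgebra K X)ᵐᵒᵖ] V) :
    Nonempty (LinearMap.ker (presentationMap (X := X) b fun i => π (Pi.single i 1))
      ≃ₗ[(FreeAlgebra K X)ᵐᵒᵖ] LinearMap.ker π) := by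
  have hπ : ∀ f, π f = ∑ i, op (f i) • π (Pi.single i 1) := by
    intro f
    conv_lhs => rw [← Finset.univ_sum_single f, map_sum]
    refine Finset.sum_congr rfl fun i _ => ?_
    rw [← map_smul, ← Pi.single_smul]
    simp
  set Φ := presentationMap (X := X) b fun i => π (Pi.single i 1) with hΦ
  let r : LinearMap.ker Φ →ₗ[(FreeAlgebra K X)ᵐᵒᵖ] LinearMap.ker π :=
    (LinearMap.funLeft _ (FreeAlgebra K X) (Sum.inl : ι → ι ⊕ S × X)).restrict (by
      intro f hf
      have h : evalMap b (Φ f) = π (f ∘ Sum.inl) := by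
        rw [hΦ, evalMap_presentationMap, hπ]
        rfl
      rw [LinearMap.mem_ker] at hf ⊢
      rw [hf, map_zero] at h
      exact h.symm)
  refine ⟨LinearEquiv.ofBijective r ⟨?_, ?_⟩⟩
  · refine (injective_iff_map_eq_zero _).2 ?_
    rintro ⟨f, hf⟩ hr
    have h0 : ∀ i, f (Sum.inl i) = 0 := fun i => congrFun (congrArg Subtype.val hr) i
    rw [LinearMap.mem_ker, hΦ, presentationMap_apply] at hf
    simp only [h0, smul_zero, Finset.sum_const_zero] at hf
    have h1 : f ∘ Sum.inr = 0 := by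
      apply boundaryMap_injective b
      rw [map_zero, ← hf]
      ext s
      simp
    apply Subtype.ext
    funext p
    rcases p with i | p
    · exact h0 i
    · exact congrFun h1 p
  · rintro ⟨g, hg⟩
    obtain ⟨f, hf⟩ := exists_boundaryMap_eq (X := X) b
      (g := -fun s => ∑ i, b.repr (π (Pi.single i 1)) s • g i) (by
        rw [map_neg, evalMap_repr b (fun i => π (Pi.single i 1)) g, ← hπ, hg, neg_zero])
    refine ⟨⟨Sum.elim g f, ?_⟩, ?_⟩
    · rw [LinearMap.mem_ker, hΦ, presentationMap_apply, Sum.elim_comp_inr, hf]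
      ext s
      simp
    · rfl

theorem extendZero_single {S B A R : Type*} [Ring R] [AddCommGroup A] [Module R A]
    [DecidableEq S] [DecidableEq B] (c : S → B) (hc : Function.Injective c) (t : S) (a : A) :
    extendZero R A c hc (Pi.single t a) = Pi.single (c t) a := by
  ext p
  change Function.extend c (Pi.single t a) (0 : B → A) p = _
  by_cases hp : ∃ s, c s = p
  · obtain ⟨s, rfl⟩ := hp
    rw [hc.extend_apply]
    by_cases hs : s = t
    · subst hs; simp
    · rw [Pi.single_eq_of_ne hs, Pi.single_eq_of_ne (fun h => hs (hc h))]
  · rw [Function.extend_apply' _ _ _ hp, Pi.single_eq_of_ne (fun h => hp ⟨t, h.symm⟩)]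
    rfl

/-- The kernel of a map from a free right module over a free algebra onto a finite-dimensional
module is free, of the rank given by Schreier's formula. -/
theorem exists_ker_equiv_free [FiniteDimensional K V] {ι : Type*} [Fintype ι]
    (π : (ι → FreeAlgebra K X) →ₗ[(FreeAlgebra K X)ᵐᵒᵖ] V) (hπ : Function.Surjective π) :
    ∃ r : ℕ, r + Module.finrank K V = Fintype.card ι + Module.finrank K V * Fintype.card X ∧
      Nonempty (LinearMap.ker π ≃ₗ[(FreeAlgebra K X)ᵐᵒᵖ] (Fin r → FreeAlgebra K X)) := by
  classical
  set v : ι → V := fun i => π (Pi.single i 1) with hv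
  have hspan : Submodule.span (FreeAlgebra K X)ᵐᵒᵖ (Set.range v) = ⊤ := by
    rw [eq_top_iff]
    intro y _
    obtain ⟨f, rfl⟩ := hπ y
    rw [← Finset.univ_sum_single f, map_sum]
    refine Submodule.sum_mem _ fun i _ => ?_
    have : Pi.single i (f i) = op (f i) • (Pi.single i 1 : ι → FreeAlgebra K X) := by
      rw [← Pi.single_smul]; simp
    rw [this, map_smul]
    exact Submodule.smul_mem _ _ (Submodule.subset_span ⟨i, rfl⟩)
  obtain ⟨S, hclosed, hli, htop⟩ := exists_schreier_transversal v hspan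
  let b : Module.Basis S K V := Module.Basis.mk hli htop
  have hb : ∀ s : S, b s = wordVal K v (s : ι × List X) := fun s => Module.Basis.mk_apply hli htop s
  -- A word selects the column that creates it: its generator if it is empty, otherwise the boundary
  -- column of its parent and its last letter.
  let c : S → ι ⊕ S × X := fun s => match s with
    | ⟨(i, []), _⟩ => Sum.inl i
    | ⟨(i, x :: w), h⟩ => Sum.inr (⟨(i, w), hclosed i x w h⟩, x)
  have hc : Function.Injective c := by
    rintro ⟨⟨i, w⟩, h⟩ ⟨⟨i', w'⟩, h'⟩ hcc
    rcases w with _ | ⟨x, w⟩ <;> rcases w' with _ | ⟨x', w'⟩ <;> simp_all [c]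
  set Φ := presentationMap (X := X) b v with hΦ
  have hnil : ∀ (i : ι) (a : FreeAlgebra K X) (h : (i, []) ∈ S),
      Φ (extendZero (FreeAlgebra K X)ᵐᵒᵖ (FreeAlgebra K X) c hc (Pi.single ⟨(i, []), h⟩ a)) = Pi.single ⟨(i, []), h⟩ a := by
    intro i a h
    rw [extendZero_single]
    change Φ (Pi.single (Sum.inl i) a) = _
    have h1 : (Pi.single (Sum.inl i) a : ι ⊕ S × X → FreeAlgebra K X) ∘ Sum.inr = 0 := by
      ext p; simp
    rw [hΦ, presentationMap_apply, h1, map_zero, add_zero]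
    ext s
    rw [Finset.sum_eq_single i (fun j _ hj => by
      rw [Pi.single_eq_of_ne (by simpa using hj), smul_zero]) (by simp), Pi.single_eq_same]
    have h2 : v i = b ⟨(i, []), h⟩ := by rw [hb, wordVal]
    rw [h2, b.repr_self, Finsupp.single_apply, Pi.single_apply]
    simp only [eq_comm (a := s)]
    split_ifs <;> simp
  have hcons : ∀ (i : ι) (x : X) (w : List X) (a : FreeAlgebra K X) (h : (i, x :: w) ∈ S),
      Φ (extendZero (FreeAlgebra K X)ᵐᵒᵖ (FreeAlgebra K X) c hc (Pi.single ⟨(i, x :: w), h⟩ a)) = Pi.single ⟨(i, x :: w), h⟩ a -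
        Pi.single ⟨(i, w), hclosed i x w h⟩ (FreeAlgebra.ι K x * a) := by
    intro i x w a h
    rw [extendZero_single]
    change Φ (Pi.single (Sum.inr (⟨(i, w), hclosed i x w h⟩, x)) a) = _
    have h1 : (Pi.single (Sum.inr (⟨(i, w), hclosed i x w h⟩, x)) a :
        ι ⊕ S × X → FreeAlgebra K X) ∘ Sum.inr = Pi.single (⟨(i, w), hclosed i x w h⟩, x) a := by
      ext p
      simp [Pi.single_apply]
    rw [hΦ, presentationMap_apply, h1]
    ext s
    rw [Pi.add_apply, boundaryMap_single, Finset.sum_eq_zero (by intro j _; simp), zero_add,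
      Pi.sub_apply]
    congr 1
    have h2 : op (FreeAlgebra.ι K x) • b ⟨(i, w), hclosed i x w h⟩ = b ⟨(i, x :: w), h⟩ := by
      rw [hb, hb, wordVal]
    rw [h2, b.repr_self, Finsupp.single_apply, Pi.single_apply]
    simp only [eq_comm (a := s)]
    split_ifs <;> simp
  -- The selected block sends a word to itself minus a term supported at its parent. So it is `1 -
  -- ν` where `ν` shortens words, and `ν` is nilpotent because lengths in `S` are bounded.
  let ν : Module.End (FreeAlgebra K X)ᵐᵒᵖ (S → FreeAlgebra K X) :=
    1 - Φ ∘ₗ extendZero (FreeAlgebra K X)ᵐᵒᵖ (FreeAlgebra K X) c hc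
  have hν : ∀ (w : List X) (i : ι) (a : FreeAlgebra K X) (h : (i, w) ∈ S) (k : ℕ), w.length < k →
      (ν ^ k) (Pi.single ⟨(i, w), h⟩ a) = 0 := by
    intro w
    induction w with
    | nil =>
      intro i a h k hk
      obtain ⟨k, rfl⟩ : ∃ l, k = l + 1 := ⟨k - 1, by simp at hk; omega⟩
      rw [pow_succ, Module.End.mul_apply]
      have : ν (Pi.single ⟨(i, []), h⟩ a) = 0 := by
        change Pi.single _ _ - Φ (extendZero (FreeAlgebra K X)ᵐᵒᵖ (FreeAlgebra K X) c hc _) = 0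
        rw [hnil, sub_self]
      rw [this, map_zero]
    | cons x w ih =>
      intro i a h k hk
      obtain ⟨k, rfl⟩ : ∃ l, k = l + 1 := ⟨k - 1, by simp at hk; omega⟩
      rw [pow_succ, Module.End.mul_apply]
      have : ν (Pi.single ⟨(i, x :: w), h⟩ a) =
          Pi.single ⟨(i, w), hclosed i x w h⟩ (FreeAlgebra.ι K x * a) := by
        change Pi.single _ _ - Φ (extendZero (FreeAlgebra K X)ᵐᵒᵖ (FreeAlgebra K X) c hc _) = _
        rw [hcons, sub_sub_cancel]
      rw [this]
      exact ih _ _ _ _ (by simp at hk; omega)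
  have hnilp : IsNilpotent ν := by
    refine ⟨(S.sup fun s => s.2.length) + 1, ?_⟩
    refine LinearMap.ext fun g => ?_
    rw [← Finset.univ_sum_single g, map_sum, LinearMap.zero_apply]
    refine Finset.sum_eq_zero fun s _ => ?_
    obtain ⟨⟨i, w⟩, hs⟩ := s
    exact hν w i _ hs _ (Nat.lt_succ_of_le (Finset.le_sup (f := fun s => s.2.length) hs))
  have hunit : IsUnit (Φ ∘ₗ extendZero (FreeAlgebra K X)ᵐᵒᵖ (FreeAlgebra K X) c hc : Module.End _ (S → FreeAlgebra K X)) := by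
    have := hnilp.isUnit_one_sub
    rwa [show 1 - ν = Φ ∘ₗ extendZero (FreeAlgebra K X)ᵐᵒᵖ (FreeAlgebra K X) c hc from sub_sub_cancel _ _] at this
  obtain ⟨e₁⟩ := exists_ker_equiv_of_bijective_block Φ c hc ((Module.End.isUnit_iff _).1 hunit)
  obtain ⟨e₂⟩ := exists_ker_presentationMap_equiv b π
  have hcardS : Module.finrank K V = Fintype.card S := Module.finrank_eq_card_basis b
  have hcard : Fintype.card {p : ι ⊕ S × X // p ∉ Set.range c} + Module.finrank K V =
      Fintype.card ι + Module.finrank K V * Fintype.card X := by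
    rw [hcardS]
    have h1 := Fintype.card_subtype_compl (fun p : ι ⊕ S × X => p ∈ Set.range c)
    have h2 : Fintype.card {p : ι ⊕ S × X // p ∈ Set.range c} = Fintype.card S :=
      Set.card_range_of_injective hc
    have h3 : Fintype.card S ≤ Fintype.card (ι ⊕ S × X) := Fintype.card_le_of_injective c hc
    rw [h2, Fintype.card_sum, Fintype.card_prod] at h1
    rw [Fintype.card_sum, Fintype.card_prod] at h3
    rw [h1]
    omega
  exact ⟨_, hcard, ⟨(e₂.symm.trans e₁).trans
    (LinearEquiv.funCongrLeft _ _ (Fintype.equivFin _).symm)⟩⟩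

end Schreier

end FreeLoc

namespace FreeLoc

open MulOpposite

/-! ### Essential finitely generated right ideals -/

section Essential

variable {K : Type u} {X : Type*} [Field K]

variable (K X) in
/-- The span of `1` and the generators of a free algebra. -/
def genSpan : Submodule K (FreeAlgebra K X) :=
  Submodule.span K (insert 1 (Set.range (FreeAlgebra.ι K)))

theorem one_le_genSpan : 1 ≤ genSpan K X := by
  rw [Submodule.one_eq_span]
  exact Submodule.span_mono (by simp)

theorem genSpan_pow_mono {k l : ℕ} (h : k ≤ l) : genSpan K X ^ k ≤ genSpan K X ^ l :=
  pow_le_pow_right₀ one_le_genSpan h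

theorem ι_mem_genSpan (x : X) : FreeAlgebra.ι K x ∈ genSpan K X :=
  Submodule.subset_span (Set.mem_insert_of_mem _ ⟨x, rfl⟩)

theorem exists_mem_genSpan_pow (a : FreeAlgebra K X) : ∃ d, a ∈ genSpan K X ^ d := by
  induction a using freeAlgebra_right_induction with
  | one => exact ⟨0, by simp [Submodule.mem_one]⟩
  | add a b ha hb =>
    obtain ⟨k, hk⟩ := ha
    obtain ⟨l, hl⟩ := hb
    exact ⟨max k l, Submodule.add_mem _ (genSpan_pow_mono (le_max_left _ _) hk)
      (genSpan_pow_mono (le_max_right _ _) hl)⟩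
  | smul k a ha => exact ⟨_, Submodule.smul_mem _ k ha.choose_spec⟩
  | mul x a ha =>
    obtain ⟨k, hk⟩ := ha
    exact ⟨k + 1, by rw [pow_succ]; exact Submodule.mul_mem_mul hk (ι_mem_genSpan x)⟩

theorem exists_finset_subset_genSpan_pow (s : Finset (FreeAlgebra K X)) :
    ∃ d, ∀ a ∈ s, a ∈ genSpan K X ^ d := by
  choose f hf using exists_mem_genSpan_pow (K := K) (X := X)
  exact ⟨s.sup f, fun a ha => genSpan_pow_mono (Finset.le_sup ha) (hf a)⟩

theorem genSpan_pow_fg [Finite X] (d : ℕ) : (genSpan K X ^ d).FG :=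
  Submodule.FG.pow (Submodule.fg_span ((Set.finite_range _).insert _)) d

/-! ### A module that overflows from `M` into a free module. -/

section Action

variable {M : Type*} [AddCommGroup M] [Module (FreeAlgebra K X)ᵐᵒᵖ M] [Module K M]
  [IsScalarTower K (FreeAlgebra K X)ᵐᵒᵖ M] (p : M →ₗ[K] M) (θ : M →ₗ[K] K)

/-- The action of a generator on `M × A` which is that of `M`, compressed by the projection `p`,
with overflow into the free module `A` measured by `θ`. -/
noncomputable def overflowStep (x : X) : Module.End K (M × FreeAlgebra K X) where
  toFun y := (p (op (FreeAlgebra.ι K x) • y.1),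
    θ (op (FreeAlgebra.ι K x) • y.1) • 1 + y.2 * FreeAlgebra.ι K x)
  map_add' y z := by
    ext1
    · simp
    · simp only [Prod.fst_add, Prod.snd_add, smul_add, map_add, add_smul, add_mul]
      abel
  map_smul' k y := by
    have h : op (FreeAlgebra.ι K x) • k • y.1 = k • (op (FreeAlgebra.ι K x) • y.1) :=
      smul_algebra_smul_comm _ _ _
    ext1
    · simp [h]
    · simp [h, smul_smul]

/-- The right action of the free algebra on `M × A` extending `overflowStep`. -/
noncomputable def overflowAction :
    FreeAlgebra K X →ₐ[K] (Module.End K (M × FreeAlgebra K X))ᵐᵒᵖ :=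
  FreeAlgebra.lift K fun x => op (overflowStep p θ x)

theorem overflowAction_mul (a b : FreeAlgebra K X) (y : M × FreeAlgebra K X) :
    (overflowAction p θ (a * b)).unop y =
      (overflowAction p θ b).unop ((overflowAction p θ a).unop y) := by
  rw [map_mul, unop_mul, Module.End.mul_apply]

theorem overflowAction_ι (x : X) (y : M × FreeAlgebra K X) :
    (overflowAction p θ (FreeAlgebra.ι K x)).unop y = (p (op (FreeAlgebra.ι K x) • y.1),
      θ (op (FreeAlgebra.ι K x) • y.1) • 1 + y.2 * FreeAlgebra.ι K x) := by
  rw [overflowAction, FreeAlgebra.lift_ι_apply]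
  rfl

theorem overflowAction_zero_left (a b : FreeAlgebra K X) :
    (overflowAction p θ a).unop ((0, b) : M × FreeAlgebra K X) = (0, b * a) := by
  induction a using freeAlgebra_right_induction with
  | one => simp
  | add a c ha hc => simp [ha, hc, mul_add]
  | smul k a ha => simp [ha]
  | mul x a ha => simp [ha, overflowAction_ι, mul_assoc]

end Action

/-- In a free algebra, a finitely generated right ideal which meets every non-zero principal right
ideal has finite codimension. -/
theorem finiteDimensional_quotient_of_essential [Finite X] (R : RightIdeal (FreeAlgebra K X))
    (hfg : R.FG) (hess : ∀ a : FreeAlgebra K X, a ≠ 0 → ∃ x, x ≠ 0 ∧ a * x ∈ R) :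
    FiniteDimensional K (FreeAlgebra K X ⧸ R) := by
  classical
  obtain ⟨s, rfl⟩ := hfg
  obtain ⟨d, hd⟩ := exists_finset_subset_genSpan_pow s
  set R : RightIdeal (FreeAlgebra K X) :=
    Submodule.span (FreeAlgebra K X)ᵐᵒᵖ (s : Set (FreeAlgebra K X)) with hR
  let mk : FreeAlgebra K X →ₗ[K] FreeAlgebra K X ⧸ R := (R.mkQ).restrictScalars K
  have hmk : ∀ a, mk a = 0 ↔ a ∈ R := fun a => Submodule.Quotient.mk_eq_zero R
  have hmk_mul : ∀ a b, mk (a * b) = op b • mk a := fun a b => rfl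
  have hmk_surj : Function.Surjective mk := R.mkQ_surjective
  set V' := (genSpan K X ^ d).map mk with hV'
  by_cases hcase : ∀ a ∈ genSpan K X ^ (d + 1), mk a ∈ V'
  · have htop : V' = ⊤ := by
      rw [eq_top_iff]
      intro y _
      obtain ⟨a, rfl⟩ := hmk_surj y
      clear * - hcase hmk_mul
      induction a using freeAlgebra_right_induction with
      | one =>
        exact Submodule.mem_map_of_mem (genSpan_pow_mono (Nat.zero_le d) (by simp [Submodule.mem_one]))
      | add a b ha hb => rw [map_add]; exact V'.add_mem ha hb
      | smul k a ha => rw [map_smul]; exact V'.smul_mem k ha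
      | mul x a ha =>
        obtain ⟨f, hf, hfa⟩ := ha
        rw [hmk_mul, ← hfa, ← hmk_mul]
        exact hcase _ (by rw [pow_succ]; exact Submodule.mul_mem_mul hf (ι_mem_genSpan x))
    have h1 : V'.FG := (genSpan_pow_fg d).map mk
    rw [htop] at h1
    exact ⟨h1⟩
  · exfalso
    push Not at hcase
    obtain ⟨t, ht, htV⟩ := hcase
    obtain ⟨p', hp'⟩ := V'.subtype.exists_leftInverse_of_injective V'.ker_subtype
    have hp'V : ∀ y (hy : y ∈ V'), p' y = ⟨y, hy⟩ := fun y hy => LinearMap.congr_fun hp' ⟨y, hy⟩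
    let p : (FreeAlgebra K X ⧸ R) →ₗ[K] (FreeAlgebra K X ⧸ R) := V'.subtype ∘ₗ p'
    have hpV : ∀ y ∈ V', p y = y := fun y hy => by
      change ((p' y : V') : FreeAlgebra K X ⧸ R) = y
      rw [hp'V y hy]
    have hpmem : ∀ y, p y ∈ V' := fun y => (p' y).2
    obtain ⟨t', ht', htt'⟩ : p (mk t) ∈ V' := hpmem _
    -- Subtracting a lift of the projection makes `p` kill the class of `c`, while that class stays
    -- outside `V'`.
    set c := t - t' with hc
    have hcd : c ∈ genSpan K X ^ (d + 1) :=
      Submodule.sub_mem _ ht (genSpan_pow_mono (Nat.le_succ d) ht')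
    have hpc : p (mk c) = 0 := by
      rw [hc, map_sub, htt', map_sub, hpV _ (hpmem _), sub_self]
    have hcV : mk c ∉ V' := by
      intro h
      apply htV
      have := V'.add_mem h (Submodule.mem_map_of_mem (f := mk) ht')
      rwa [← map_add, hc, sub_add_cancel] at this
    obtain ⟨θ, hθc, hθV⟩ : ∃ θ : (FreeAlgebra K X ⧸ R) →ₗ[K] K, θ (mk c) = 1 ∧ ∀ y ∈ V', θ y = 0 := by
      obtain ⟨f, hf, hfV⟩ := Submodule.exists_le_ker_of_notMem hcV
      refine ⟨(f (mk c))⁻¹ • f, ?_, ?_⟩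
      · simp [hf]
      · intro y hy
        have : f y = 0 := hfV hy
        simp [this]
    -- On classes of degree at most `d` the projection is the identity and `θ` vanishes, so the
    -- overflow can first appear in degree `d + 1`.
    have hact : ∀ k ≤ d + 1, ∀ a ∈ genSpan K X ^ k,
        (overflowAction p θ a).unop (mk 1, 0) = (p (mk a), algebraMap K _ (θ (mk a))) := by
      intro k
      have hsmall : ∀ j ≤ d, ∀ a ∈ genSpan K X ^ j, p (mk a) = mk a ∧ θ (mk a) = 0 := by
        intro j hj a ha
        have := Submodule.mem_map_of_mem (f := mk) (genSpan_pow_mono hj ha)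
        exact ⟨hpV _ this, hθV _ this⟩
      induction k with
      | zero =>
        intro _ a ha
        obtain ⟨h1, h2⟩ := hsmall 0 (Nat.zero_le d) a ha
        rw [h1, h2, map_zero]
        rw [pow_zero, Submodule.mem_one] at ha
        obtain ⟨k, rfl⟩ := ha
        have h3 : algebraMap K (FreeAlgebra K X) k = k • 1 := Algebra.algebraMap_eq_smul_one k
        rw [h3, map_smul, map_smul, map_one]
        change k • (mk 1, (0 : FreeAlgebra K X)) = _
        rw [Prod.smul_mk, smul_zero]
      | succ k ih =>
        intro hk a ha
        rw [pow_succ] at ha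
        induction ha using Submodule.mul_induction_on' with
        | add y _ z _ hy hz =>
          simp only [map_add, unop_add, LinearMap.add_apply, hy, hz, Prod.mk_add_mk]
        | mem_mul_mem y hy z hz =>
          induction hz using Submodule.span_induction with
          | zero => simp; rfl
          | add z w _ _ hz hw =>
            simp only [mul_add, map_add, unop_add, LinearMap.add_apply, hz, hw, Prod.mk_add_mk]
          | smul k z _ hz =>
            rw [mul_smul_comm, map_smul, unop_smul, LinearMap.smul_apply, hz, Prod.smul_mk, map_smul,
              map_smul, map_smul, Algebra.smul_def, smul_eq_mul,
              (algebraMap K (FreeAlgebra K X)).map_mul]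
          | mem z hz =>
            rcases hz with rfl | ⟨x, rfl⟩
            · rw [mul_one]
              exact ih (by omega) y hy
            · obtain ⟨h1, h2⟩ := hsmall k (by omega) y hy
              rw [overflowAction_mul, ih (by omega) y hy, h1, h2, map_zero, overflowAction_ι, hmk_mul]
              simp [Algebra.algebraMap_eq_smul_one]
    -- The generators of `R` have degree at most `d`, so all of `R` kills `(1, 0)`. But `c` moves
    -- this vector to `(0, 1)`, which generates a free module, so `c * x ∈ R` forces `x = 0`,
    -- against essentiality.
    have hkill : ∀ a ∈ R, (overflowAction p θ a).unop (mk 1, 0) = 0 := by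
      intro a ha
      induction ha using Submodule.span_induction with
      | mem a ha =>
        have h1 : mk a = 0 := (hmk a).2 (Submodule.subset_span ha)
        rw [hact d (Nat.le_succ d) a (hd a ha), h1]
        simp
      | zero => simp
      | add a b _ _ ha hb => simp [ha, hb]
      | smul b a _ ha =>
        change (overflowAction p θ (a * b.unop)).unop _ = 0
        rw [overflowAction_mul, ha, map_zero]
    have hc0 : c ≠ 0 := by
      intro h
      apply hcV
      rw [h, map_zero]
      exact V'.zero_mem
    obtain ⟨x, hx, hcx⟩ := hess c hc0
    have h := hkill _ hcx
    rw [overflowAction_mul, hact (d + 1) le_rfl c hcd, hpc, hθc, map_one, overflowAction_zero_left,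
      one_mul] at h
    exact hx (congrArg Prod.snd h)

end Essential

end FreeLoc

namespace FreeLoc

open MulOpposite

/-! ### Tensor products over noncommutative rings -/

section BalancedTensor

variable {A : Type u} [Ring A] {M M' : Type u} [AddCommGroup M] [Module Aᵐᵒᵖ M]
  [AddCommGroup M'] [Module Aᵐᵒᵖ M'] {N : Type u} [AddCommGroup N] [Module A N]

variable (A) in
/-- Pure tensors in `M ⊗_A N`. -/
def btmul (x : M) (y : N) : BalancedTensor A M N := QuotientAddGroup.mk (x ⊗ₜ[ℤ] y)

theorem btmul_add_left (x x' : M) (y : N) : btmul A (x + x') y = btmul A x y + btmul A x' y := by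
  rw [btmul, TensorProduct.add_tmul]; rfl

theorem btmul_add_right (x : M) (y y' : N) : btmul A x (y + y') = btmul A x y + btmul A x y' := by
  rw [btmul, TensorProduct.tmul_add]; rfl

theorem btmul_zero_left (y : N) : btmul A (0 : M) y = 0 := by
  rw [btmul, TensorProduct.zero_tmul]; rfl

theorem btmul_sum_left {ι : Type*} (s : Finset ι) (f : ι → M) (y : N) :
    btmul A (∑ i ∈ s, f i) y = ∑ i ∈ s, btmul A (f i) y :=
  map_sum (AddMonoidHom.mk' (fun x => btmul A x y) fun a b => btmul_add_left a b y) f s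

theorem btmul_sum_right {ι : Type*} (s : Finset ι) (f : ι → N) (x : M) :
    btmul A x (∑ i ∈ s, f i) = ∑ i ∈ s, btmul A x (f i) :=
  map_sum (AddMonoidHom.mk' (fun y => btmul A x y) fun a b => btmul_add_right x a b) f s

theorem btmul_smul (x : M) (a : A) (y : N) : btmul A (op a • x) y = btmul A x (a • y) := by
  refine (QuotientAddGroup.eq_iff_sub_mem).2 ?_
  exact AddSubgroup.subset_closure ⟨x, a, y, rfl⟩

theorem balancedMap_btmul (f : M →ₗ[Aᵐᵒᵖ] M') (x : M) (y : N) :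
    balancedMap N f (btmul A x y) = btmul A (f x) y := rfl

theorem balancedTensor_induction {P : BalancedTensor A M N → Prop} (zero : P 0)
    (tmul : ∀ x y, P (btmul A x y)) (add : ∀ s t, P s → P t → P (s + t)) (t) : P t := by
  obtain ⟨t', rfl⟩ := QuotientAddGroup.mk_surjective t
  induction t' using TensorProduct.induction_on with
  | zero => exact zero
  | tmul x y => exact tmul x y
  | add s t hs ht => exact add _ _ hs ht

theorem balancedTensor_hom_ext {G : Type*} [AddCommGroup G] {f g : BalancedTensor A M N →+ G}
    (h : ∀ x y, f (btmul A x y) = g (btmul A x y)) : f = g := by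
  refine AddMonoidHom.ext fun t => ?_
  induction t using balancedTensor_induction with
  | zero => simp
  | tmul x y => exact h x y
  | add s t hs ht => rw [map_add, map_add, hs, ht]

/-- The map out of `M ⊗_A N` given by a balanced biadditive map. -/
noncomputable def balancedLift {G : Type*} [AddCommGroup G] (f : M →+ N →+ G)
    (hf : ∀ x (a : A) y, f (op a • x) y = f x (a • y)) : BalancedTensor A M N →+ G :=
  QuotientAddGroup.lift _ (TensorProduct.liftAddHom f (by
    intro k x y
    rw [map_zsmul, map_zsmul]
    rfl)) <| by
    refine (AddSubgroup.closure_le _).2 ?_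
    rintro _ ⟨x, a, y, rfl⟩
    rw [SetLike.mem_coe, AddMonoidHom.mem_ker, map_sub, sub_eq_zero]
    exact hf x a y

theorem balancedLift_btmul {G : Type*} [AddCommGroup G] (f : M →+ N →+ G)
    (hf : ∀ x (a : A) y, f (op a • x) y = f x (a • y)) (x : M) (y : N) :
    balancedLift f hf (btmul A x y) = f x y := rfl

end BalancedTensor

/-! ### Right ideals which generate the unit ideal -/

section Dense

variable {A Q : Type u} [Ring A] [Ring Q] (φ : A →+* Q)

/-- The set `S` generates the unit right ideal of `Q`. -/
def GeneratesUnit (S : Set A) : Prop := (1 : Q) ∈ Submodule.span Qᵐᵒᵖ (φ '' S)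

/-- The right ideals `R` of `A` such that `R Q = Q`. -/
def unitIdeals : Set (RightIdeal A) := {R | GeneratesUnit φ (R : Set A)}

variable {φ}

theorem generatesUnit_iff {S : Set A} : GeneratesUnit φ S ↔
    ∃ (k : ℕ) (r : Fin k → A) (q : Fin k → Q), (∀ i, r i ∈ S) ∧ ∑ i, φ (r i) * q i = 1 := by
  rw [GeneratesUnit, Submodule.mem_span_set']
  constructor
  · rintro ⟨k, f, g, h⟩
    choose r hr hrg using fun i => (g i).2
    refine ⟨k, r, fun i => (f i).unop, hr, ?_⟩
    rw [← h]
    refine Finset.sum_congr rfl fun i _ => ?_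
    rw [hrg]
    rfl
  · rintro ⟨k, r, q, hr, h⟩
    exact ⟨k, fun i => op (q i), fun i => ⟨φ (r i), r i, hr i, rfl⟩, h⟩

theorem GeneratesUnit.mono {S T : Set A} (h : GeneratesUnit φ S) (hST : S ⊆ T) :
    GeneratesUnit φ T :=
  Submodule.span_mono (Set.image_mono hST) h

theorem GeneratesUnit.mul {S T U : Set A} (hS : GeneratesUnit φ S) (hT : GeneratesUnit φ T)
    (hU : ∀ s ∈ S, ∀ t ∈ T, s * t ∈ U) : GeneratesUnit φ U := by
  obtain ⟨k, r, q, hr, hrq⟩ := generatesUnit_iff.1 hS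
  obtain ⟨l, t, p, ht, htp⟩ := generatesUnit_iff.1 hT
  have h : ∑ i, ∑ j, op (p j * q i) • φ (r i * t j) = (1 : Q) := by
    rw [← hrq]
    refine Finset.sum_congr rfl fun i _ => ?_
    conv_rhs => rw [← one_mul (q i), ← htp, Finset.sum_mul, Finset.mul_sum]
    refine Finset.sum_congr rfl fun j _ => ?_
    simp [mul_assoc]
  rw [GeneratesUnit, ← h]
  refine Submodule.sum_mem _ fun i _ => Submodule.sum_mem _ fun j _ => Submodule.smul_mem _ _ ?_
  exact Submodule.subset_span ⟨_, hU _ (hr i) _ (ht j), rfl⟩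

theorem GeneratesUnit.eq_zero {S : Set A} (h : GeneratesUnit φ S) {C : Type*} [Ring C]
    (γ : Q →+* C) {c : C} (hc : ∀ x ∈ S, c * γ (φ x) = 0) : c = 0 := by
  obtain ⟨k, r, q, hr, hrq⟩ := generatesUnit_iff.1 h
  rw [← mul_one c, ← map_one γ, ← hrq, map_sum, Finset.mul_sum]
  refine Finset.sum_eq_zero fun i _ => ?_
  rw [map_mul, ← mul_assoc, hc _ (hr i), zero_mul]

theorem generatesUnit_one : GeneratesUnit φ {1} := by
  rw [GeneratesUnit, Set.image_singleton, map_one]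
  exact Submodule.subset_span rfl

theorem GeneratesUnit.exists_fg {R : RightIdeal A} (h : R ∈ unitIdeals φ) :
    ∃ R' ≤ R, R'.FG ∧ R' ∈ unitIdeals φ := by
  obtain ⟨k, r, q, hr, hrq⟩ := generatesUnit_iff.1 h
  refine ⟨Submodule.span _ (Set.range r), Submodule.span_le.2 ?_,
    Submodule.fg_span (Set.finite_range r), ?_⟩
  · rintro _ ⟨i, rfl⟩
    exact hr i
  · exact generatesUnit_iff.2 ⟨k, r, q, fun i => Submodule.subset_span ⟨i, rfl⟩, hrq⟩

end Dense

/-! ### Flat bimorphisms -/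

section FlatBimorphism

variable {A Q : Type u} [Ring A] [Ring Q] {φ : A →+* Q} [Module A Q]

variable (A) in
/-- The annihilator of an element of a right module. -/
def annIdeal {M : Type*} [AddCommGroup M] [Module Aᵐᵒᵖ M] (m : M) : RightIdeal A where
  carrier := {a | op a • m = 0}
  add_mem' := by
    intro a b ha hb
    change op (a + b) • m = 0
    rw [op_add, add_smul, show op a • m = 0 from ha, show op b • m = 0 from hb, add_zero]
  zero_mem' := by
    change op (0 : A) • m = 0
    rw [op_zero, zero_smul]
  smul_mem' := by
    intro c a ha
    change op (a * c.unop) • m = 0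
    rw [op_mul, mul_smul, show op a • m = 0 from ha, smul_zero]

theorem mem_annIdeal {M : Type*} [AddCommGroup M] [Module Aᵐᵒᵖ M] (m : M) (a : A) :
    a ∈ annIdeal A m ↔ op a • m = 0 := Iff.rfl

variable (A) in
/-- The map `A → M`, `a ↦ m * a`. -/
def orbitMap {M : Type*} [AddCommGroup M] [Module Aᵐᵒᵖ M] (m : M) : A →ₗ[Aᵐᵒᵖ] M where
  toFun a := op a • m
  map_add' a b := by rw [op_add, add_smul]
  map_smul' c a := by
    change op (a * c.unop) • m = c • op a • m
    rw [op_mul, mul_smul]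
    rfl

/-- The map `A/R ⊗ Q → Q/RQ`, `a ⊗ q ↦ φ a * q`, sends `1 ⊗ 1` to the class of `1`. -/
theorem generatesUnit_of_btmul_one (hl : ∀ (a : A) (q : Q), a • q = φ a * q) (R : RightIdeal A)
    (h : btmul A (R.mkQ 1) (1 : Q) = 0) : R ∈ unitIdeals φ := by
  let W : AddSubgroup Q := (Submodule.span Qᵐᵒᵖ (φ '' (R : Set A))).toAddSubgroup
  let g : A →+ Q →+ Q ⧸ W :=
    AddMonoidHom.mk' (fun a => (QuotientAddGroup.mk' W).comp (AddMonoidHom.mulLeft (φ a))) (by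
      intro a b
      ext q
      simp [add_mul])
  let g' : A ⧸ R →+ Q →+ Q ⧸ W :=
    R.mkQ.toAddMonoidHom.liftOfSurjective R.mkQ_surjective ⟨g, by
      intro a ha
      have ha' : a ∈ R := (Submodule.Quotient.mk_eq_zero R).1 ha
      rw [AddMonoidHom.mem_ker]
      ext q
      refine (QuotientAddGroup.eq_zero_iff _).2 ?_
      change op q • φ a ∈ Submodule.span Qᵐᵒᵖ (φ '' (R : Set A))
      exact Submodule.smul_mem _ _ (Submodule.subset_span ⟨a, ha', rfl⟩)⟩
  have hg' : ∀ a, g' (R.mkQ a) = g a := fun a =>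
    AddMonoidHom.liftOfRightInverse_comp_apply _ _ _ _ a
  have hbal : ∀ (x : A ⧸ R) (a : A) (q : Q), g' (op a • x) q = g' x (a • q) := by
    intro x a q
    obtain ⟨x, rfl⟩ := R.mkQ_surjective x
    have : op a • R.mkQ x = R.mkQ (x * a) := rfl
    rw [this, hg', hg', hl]
    change QuotientAddGroup.mk' W (φ (x * a) * q) = QuotientAddGroup.mk' W (φ x * (φ a * q))
    rw [φ.map_mul, mul_assoc]
  have h2 := congrArg (balancedLift g' hbal) h
  rw [balancedLift_btmul, map_zero, hg'] at h2
  have h3 : φ 1 * 1 ∈ W := (QuotientAddGroup.eq_zero_iff _).1 h2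
  rw [map_one, one_mul] at h3
  exact h3

/-- The quotient `A / ann m` embeds in `M` by `1 ↦ m`, so flatness pulls `m ⊗ 1 = 0` back to `1 ⊗ 1
= 0`. This is how flatness produces right ideals that generate `Q`. -/
theorem annIdeal_mem_unitIdeals (hl : ∀ (a : A) (q : Q), a • q = φ a * q) (hflat : IsLeftFlat A Q)
    {M : Type u} [AddCommGroup M] [Module Aᵐᵒᵖ M] (m : M) (h : btmul A m (1 : Q) = 0) :
    annIdeal A m ∈ unitIdeals φ := by
  refine generatesUnit_of_btmul_one hl _ ?_
  obtain ⟨f, hf1⟩ : ∃ f : (A ⧸ annIdeal A m) →ₗ[Aᵐᵒᵖ] M,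
      ∀ a, f ((annIdeal A m).mkQ a) = op a • m :=
    ⟨Submodule.liftQ (annIdeal A m) (orbitMap A m) fun a ha => ha, fun a => rfl⟩
  have hf : Function.Injective f := by
    refine (injective_iff_map_eq_zero f).2 fun y hy => ?_
    obtain ⟨a, rfl⟩ := (annIdeal A m).mkQ_surjective y
    rw [hf1] at hy
    exact (Submodule.Quotient.mk_eq_zero _).2 hy
  apply hflat _ _ f hf
  rw [balancedMap_btmul, map_zero, hf1, op_one, one_smul, h]

/-- Lets finitely many annihilator conditions be imposed at once on a tuple. Taking `ι : Type` keeps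
the product module in `Type u`, where flatness is tested. -/
theorem btmul_pi_eq_zero {ι : Type} [Fintype ι] {M : ι → Type u} [∀ i, AddCommGroup (M i)]
    [∀ i, Module Aᵐᵒᵖ (M i)] (m : ∀ i, M i) (q : Q) (h : ∀ i, btmul A (m i) q = 0) :
    btmul A m q = 0 := by
  classical
  rw [← Finset.univ_sum_single m, btmul_sum_left]
  refine Finset.sum_eq_zero fun i _ => ?_
  have := balancedMap_btmul (LinearMap.single Aᵐᵒᵖ M i) (m i) q
  rw [h, map_zero] at this
  exact this.symm

/-- Finite intersections of ideals `(R i : a i)` with `R i Q = Q`. -/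
theorem exists_mem_unitIdeals_colon (hl : ∀ (a : A) (q : Q), a • q = φ a * q)
    (hflat : IsLeftFlat A Q) {ι : Type} [Fintype ι] (R : ι → RightIdeal A) (a : ι → A)
    (hR : ∀ i, R i ∈ unitIdeals φ) :
    ∃ J ∈ unitIdeals φ, ∀ x, x ∈ J ↔ ∀ i, a i * x ∈ R i := by
  let m : ∀ i, A ⧸ R i := fun i => (R i).mkQ (a i)
  refine ⟨annIdeal A m, annIdeal_mem_unitIdeals hl hflat m (btmul_pi_eq_zero m 1 fun i => ?_), ?_⟩
  · have h1 : ∀ b, (R i).mkQ b = op b • (R i).mkQ 1 := fun b => by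
      rw [← map_smul]
      simp
    obtain ⟨k, r, q, hr, hrq⟩ := generatesUnit_iff.1 (hR i)
    change btmul A ((R i).mkQ (a i)) (1 : Q) = 0
    rw [h1, btmul_smul, hl, mul_one, ← one_mul (φ (a i)), ← hrq, Finset.sum_mul, btmul_sum_right]
    refine Finset.sum_eq_zero fun j _ => ?_
    have h2 : (R i).mkQ (r j) = 0 := (Submodule.Quotient.mk_eq_zero _).2 (hr j)
    rw [mul_assoc, ← hl, ← btmul_smul, ← h1, h2, btmul_zero_left]
  · intro x
    rw [mem_annIdeal, funext_iff]
    exact forall_congr' fun i => Submodule.Quotient.mk_eq_zero _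

variable [Module Aᵐᵒᵖ Q]

/-- Left multiplication of `Q` on `Q ⊗_A Q`. -/
noncomputable def tensorLeftMul (hr : ∀ (a : A) (q : Q), op a • q = q * φ a) :
    Q →+* AddMonoid.End (BalancedTensor A Q Q) where
  toFun q := balancedMap Q
    { toFun := fun x => q * x
      map_add' := mul_add q
      map_smul' := fun c x => by
        rw [RingHom.id_apply, ← op_unop c, hr, hr, mul_assoc] }
  map_one' := balancedTensor_hom_ext fun x y => by
    rw [balancedMap_btmul]
    change btmul A (1 * x) y = btmul A x y
    rw [one_mul]
  map_mul' p q := balancedTensor_hom_ext fun x y => by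
    change btmul A (p * q * x) y = btmul A (p * (q * x)) y
    rw [mul_assoc]
  map_zero' := balancedTensor_hom_ext fun x y => by
    change btmul A (0 * x) y = 0
    rw [zero_mul, btmul_zero_left]
  map_add' p q := balancedTensor_hom_ext fun x y => by
    change btmul A ((p + q) * x) y = btmul A (p * x) y + btmul A (q * x) y
    rw [add_mul, btmul_add_left]

/-- On `Q × (Q ⊗ Q)`, conjugate the diagonal left action of `Q` by the shear `(y, t) ↦ (y, t + 1 ⊗
y)`. Both actions agree on `A` since `φ a ⊗ y = 1 ⊗ φ a * y`, hence on `Q`. Comparing them at `(1,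
0)` gives `0 = 1 ⊗ q - q ⊗ 1`. -/
theorem btmul_one_comm_of_epi (hl : ∀ (a : A) (q : Q), a • q = φ a * q)
    (hr : ∀ (a : A) (q : Q), op a • q = q * φ a) (hepi : IsRingEpi φ) (q : Q) :
    btmul A (1 : Q) q = btmul A q (1 : Q) := by
  let T := BalancedTensor A Q Q
  let C := AddMonoid.End (Q × T)
  let lam := tensorLeftMul hr
  have hlam : ∀ p x y, lam p (btmul A x y) = btmul A (p * x) y := fun _ _ _ => rfl
  let α : Q →+* C :=
    { toFun := fun p => AddMonoidHom.prodMap (AddMonoidHom.mulLeft p) (lam p)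
      map_one' := by
        refine AddMonoidHom.ext fun z => Prod.ext ?_ ?_
        · exact one_mul _
        · change lam 1 z.2 = z.2
          rw [map_one]
          rfl
      map_mul' := fun p p' => by
        refine AddMonoidHom.ext fun z => Prod.ext ?_ ?_
        · exact mul_assoc _ _ _
        · change lam (p * p') z.2 = lam p (lam p' z.2)
          rw [map_mul]
          rfl
      map_zero' := by
        refine AddMonoidHom.ext fun z => Prod.ext ?_ ?_
        · exact zero_mul _
        · change lam 0 z.2 = 0
          rw [map_zero]
          rfl
      map_add' := fun p p' => by
        refine AddMonoidHom.ext fun z => Prod.ext ?_ ?_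
        · exact add_mul _ _ _
        · change lam (p + p') z.2 = lam p z.2 + lam p' z.2
          rw [map_add]
          rfl }
  have hα : ∀ p z, α p z = (p * z.1, lam p z.2) := fun _ _ => rfl
  let shear (s : Q →+ T) : C :=
    (AddMonoidHom.fst Q T).prod ((AddMonoidHom.snd Q T) + s.comp (AddMonoidHom.fst Q T))
  have hshear : ∀ s z, shear s z = (z.1, z.2 + s z.1) := fun _ _ => rfl
  let τ : Q →+ T := AddMonoidHom.mk' (fun y => btmul A (1 : Q) y) (btmul_add_right 1)
  have hτ : ∀ y, τ y = btmul A (1 : Q) y := fun _ => rfl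
  let u : Cˣ :=
    { val := shear τ
      inv := shear (-τ)
      val_inv := by
        refine AddMonoidHom.ext fun z => ?_
        change shear τ (shear (-τ) z) = z
        simp [hshear]
      inv_val := by
        refine AddMonoidHom.ext fun z => ?_
        change shear (-τ) (shear τ z) = z
        simp [hshear] }
  let β : Q →+* C :=
    { toFun := fun p => u * α p * (u⁻¹ : Cˣ)
      map_one' := by simp
      map_mul' := fun p p' => by simp [mul_assoc]
      map_zero' := by simp
      map_add' := fun p p' => by simp [mul_add, add_mul] }
  have hβ : ∀ p z, β p z = shear τ (α p (shear (-τ) z)) := fun _ _ => rfl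
  have hab : α = β := by
    refine hepi C α β ?_
    refine RingHom.ext fun a => AddMonoidHom.ext fun z => ?_
    change α (φ a) z = β (φ a) z
    rw [hβ, hshear, hα, hα, hshear]
    refine Prod.ext rfl ?_
    change lam (φ a) z.2 = lam (φ a) (z.2 + -τ z.1) + τ (φ a * z.1)
    have h1 : lam (φ a) (τ z.1) = τ (φ a * z.1) := by
      rw [hτ, hτ, hlam, mul_one, ← hl, ← btmul_smul, hr, one_mul]
    rw [map_add, map_neg, h1, neg_add_cancel_right]
  have h := congrArg Prod.snd (DFunLike.congr_fun (DFunLike.congr_fun hab q) ((1 : Q), (0 : T)))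
  rw [hα, hβ, hshear, hα, hshear] at h
  change lam q 0 = lam q (0 + -τ 1) + τ (q * 1) at h
  rw [map_zero, zero_add, map_neg, hτ, hτ, hlam, mul_one] at h
  exact (neg_add_eq_zero.1 h.symm).symm

/-- Modulo `φ(A)` in the left factor, `q ⊗ 1 = 1 ⊗ q` becomes zero. So the annihilator of the tuple
of classes of the `q i` in `Q / φ(A)` generates `Q`. -/
theorem exists_common_dom_of_epi (hl : ∀ (a : A) (q : Q), a • q = φ a * q)
    (hr : ∀ (a : A) (q : Q), op a • q = q * φ a) (hepi : IsRingEpi φ) (hflat : IsLeftFlat A Q)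
    {ι : Type} [Fintype ι] (q : ι → Q) :
    ∃ J ∈ unitIdeals φ, ∀ x ∈ J, ∀ i, q i * φ x ∈ φ.range := by
  let P : Submodule Aᵐᵒᵖ Q :=
    { φ.range.toAddSubgroup with
      smul_mem' := by
        rintro c _ ⟨b, rfl⟩
        refine ⟨b * c.unop, ?_⟩
        rw [← op_unop c, hr, map_mul]
        rfl }
  have hP : ∀ x, x ∈ P ↔ x ∈ φ.range := fun _ => Iff.rfl
  let m : ι → Q ⧸ P := fun i => P.mkQ (q i)
  refine ⟨annIdeal A m, annIdeal_mem_unitIdeals hl hflat m (btmul_pi_eq_zero m 1 fun i => ?_), ?_⟩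
  · have h1 : P.mkQ 1 = 0 := (Submodule.Quotient.mk_eq_zero _).2 ((hP _).2 ⟨1, map_one φ⟩)
    have h2 := congrArg (balancedMap Q P.mkQ) (btmul_one_comm_of_epi hl hr hepi (q i))
    rw [balancedMap_btmul, balancedMap_btmul, h1, btmul_zero_left] at h2
    exact h2.symm
  · intro x hx i
    have h1 : op x • P.mkQ (q i) = 0 := congrFun hx i
    rw [← map_smul, hr] at h1
    exact (hP _).1 ((Submodule.Quotient.mk_eq_zero _).1 h1)

theorem isRingOfRightQuotients_of_isFlatBimorphism_aux (hl : ∀ (a : A) (q : Q), a • q = φ a * q)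
    (hr : ∀ (a : A) (q : Q), op a • q = q * φ a) (hinj : Function.Injective φ)
    (hepi : IsRingEpi φ) (hflat : IsLeftFlat A Q) :
    IsRingOfRightQuotients (unitIdeals φ) φ where
  map_eq_zero_iff a := by
    constructor
    · intro h
      rw [map_eq_zero_iff φ hinj] at h
      refine ⟨⊤, generatesUnit_one.mono (by simp), fun x _ => by rw [h, zero_mul]⟩
    · rintro ⟨J, hJ, h⟩
      exact GeneratesUnit.eq_zero hJ (RingHom.id Q) fun x hx => by
        rw [RingHom.id_apply, ← map_mul, h x hx, map_zero]
  exists_dom q := by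
    obtain ⟨J, hJ, h⟩ := exists_common_dom_of_epi hl hr hepi hflat fun _ : Unit => q
    exact ⟨J, hJ, fun x hx => h x hx ()⟩
  torsion_free q := by
    rintro ⟨J, hJ, h⟩
    exact GeneratesUnit.eq_zero hJ (RingHom.id Q) h
  exists_of_hom J hJ f hf hlin := by
    obtain ⟨k, r, q, hrJ, hrq⟩ := generatesUnit_iff.1 hJ
    -- The element is forced by `q = ∑ q * φ (r i) * q i`. To check it at `x`, multiply by `y`
    -- clearing the denominators of all `q i * φ x`; then `x * y` is a combination of the `r i` over
    -- `A`, to which linearity of `f` applies.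
    refine ⟨∑ i, f ⟨r i, hrJ i⟩ * q i, fun x => ?_⟩
    obtain ⟨J', hJ', h'⟩ := exists_common_dom_of_epi hl hr hepi hflat fun i => q i * φ x
    rw [← sub_eq_zero]
    refine GeneratesUnit.eq_zero hJ' (RingHom.id Q) fun y hy => ?_
    choose a ha using h' y hy
    rw [RingHom.id_apply, sub_mul, sub_eq_zero, ← hlin, Finset.sum_mul, Finset.sum_mul]
    have h1 : op y • x = ∑ i, op (a i) • (⟨r i, hrJ i⟩ : J) := by
      apply Subtype.ext
      rw [AddSubmonoidClass.coe_finsetSum]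
      change (x : A) * y = ∑ i, r i * a i
      apply hinj
      rw [map_mul, map_sum, ← one_mul (φ (x : A)), ← hrq, Finset.sum_mul, Finset.sum_mul]
      refine Finset.sum_congr rfl fun i _ => ?_
      rw [map_mul, ha, mul_assoc, mul_assoc, mul_assoc]
    rw [h1, map_sum]
    refine Finset.sum_congr rfl fun i _ => ?_
    rw [hlin, ha, mul_assoc, mul_assoc, mul_assoc]

end FlatBimorphism

theorem IsFlatBimorphism.isRingOfRightQuotients {A Q : Type u} [Ring A] [Ring Q] {φ : A →+* Q}
    (h : IsFlatBimorphism φ) : IsRingOfRightQuotients (unitIdeals φ) φ := by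
  let _ : Module A Q := Module.compHom Q φ
  let _ : Module Aᵐᵒᵖ Q := Module.compHom Q φ.op
  exact isRingOfRightQuotients_of_isFlatBimorphism_aux (fun _ _ => rfl) (fun _ _ => rfl)
    h.injective h.epi h.flat

theorem IsFlatBimorphism.exists_mem_unitIdeals_colon {A Q : Type u} [Ring A] [Ring Q] {φ : A →+* Q}
    (h : IsFlatBimorphism φ) {ι : Type} [Fintype ι] (R : ι → RightIdeal A) (a : ι → A)
    (hR : ∀ i, R i ∈ unitIdeals φ) :
    ∃ J ∈ unitIdeals φ, ∀ x, x ∈ J ↔ ∀ i, a i * x ∈ R i := by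
  let _ : Module A Q := Module.compHom Q φ
  exact FreeLoc.exists_mem_unitIdeals_colon (fun _ _ => rfl) h.flat R a hR

end FreeLoc

namespace FreeLoc

open MulOpposite

/-! ### Rings of right quotients with respect to perfect topologies -/

section RightQuotients

variable {A Q : Type u} [Ring A] [Ring Q] {φ : A →+* Q} {F : Set (RightIdeal A)}

/-- A dual basis argument: each coordinate function of a basis `b k` of `J` is left multiplication
by some `q k`. Then `∑ φ (b k) * q k` fixes `φ(J)` pointwise, so it is `1` by torsion-freeness. -/
theorem IsRingOfRightQuotients.generatesUnit_of_equiv (h : IsRingOfRightQuotients F φ)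
    {J : RightIdeal A} (hJ : J ∈ F) {r : ℕ} (e : J ≃ₗ[Aᵐᵒᵖ] (Fin r → A)) :
    GeneratesUnit φ (J : Set A) := by
  have hq : ∀ k : Fin r, ∃ q : Q, ∀ x : J, φ (e x k) = q * φ x := by
    intro k
    refine h.exists_of_hom J hJ (AddMonoidHom.mk' (fun x => φ (e x k)) ?_) ?_ ?_
    · intro x y
      rw [map_add, Pi.add_apply, map_add]
    · intro x
      exact ⟨_, rfl⟩
    · intro x a
      change φ (e (op a • x) k) = φ (e x k) * φ a
      rw [map_smul, ← map_mul]
      rfl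
  choose q hq using hq
  have h1 : ∑ k, φ (e.symm (Pi.single k 1) : J) * q k = 1 := by
    rw [← sub_eq_zero]
    refine h.torsion_free _ ⟨J, hJ, fun x hx => ?_⟩
    rw [sub_mul, one_mul, sub_eq_zero, Finset.sum_mul]
    have h2 : (⟨x, hx⟩ : J) = ∑ k, op (e ⟨x, hx⟩ k) • e.symm (Pi.single k 1) := by
      apply e.injective
      rw [map_sum]
      ext k
      rw [Finset.sum_apply, Finset.sum_eq_single k]
      · simp
      · intro l _ hl
        rw [map_smul, LinearEquiv.apply_symm_apply, Pi.smul_apply, Pi.single_eq_of_ne hl.symm,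
          smul_zero]
      · simp
    have h3 := congrArg (fun y : J => φ (y : A)) h2
    simp only [AddSubmonoidClass.coe_finsetSum, map_sum] at h3
    refine Eq.trans ?_ h3.symm
    refine Finset.sum_congr rfl fun k _ => ?_
    change _ = φ ((e.symm (Pi.single k 1) : A) * e ⟨x, hx⟩ k)
    rw [map_mul, hq, mul_assoc]
  exact generatesUnit_iff.2 ⟨r, _, q, fun k => (e.symm (Pi.single k 1)).2, h1⟩

theorem IsGabrielTopology.exists_forall_mem (hF : IsGabrielTopology F) {ι : Type*} [Finite ι]
    (R : ι → RightIdeal A) (hR : ∀ i, R i ∈ F) : ∃ J ∈ F, ∀ i, J ≤ R i := by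
  cases nonempty_fintype ι
  refine ⟨Finset.univ.inf R, ?_, fun i => Finset.inf_le (Finset.mem_univ i)⟩
  exact Finset.inf_induction hF.top_mem (fun R hR S hS => hF.inf_mem R hR S hS) fun i _ => hR i

theorem IsRingOfRightQuotients.exists_common_dom (h : IsRingOfRightQuotients F φ)
    (hF : IsGabrielTopology F) {ι : Type*} [Finite ι] (q : ι → Q) :
    ∃ J ∈ F, ∀ x ∈ J, ∀ i, q i * φ x ∈ φ.range := by
  choose R hR hq using fun i => h.exists_dom (q i)
  obtain ⟨J, hJ, hle⟩ := hF.exists_forall_mem R hR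
  exact ⟨J, hJ, fun x hx i => hq i x (hle i hx)⟩

/-- If `q J ⊆ φ(A)`, then `α q - β q` kills the image of `J` from the left, and `JQ = Q` forces it
to vanish. -/
theorem IsRingOfRightQuotients.isRingEpi (h : IsRingOfRightQuotients F φ)
    (hunit : ∀ J ∈ F, GeneratesUnit φ (J : Set A)) : IsRingEpi φ := by
  intro C _ α β hab
  have hab' : ∀ a, α (φ a) = β (φ a) := fun a => RingHom.congr_fun hab a
  refine RingHom.ext fun q => ?_
  obtain ⟨J, hJ, hq⟩ := h.exists_dom q
  rw [← sub_eq_zero]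
  refine (hunit J hJ).eq_zero α fun x hx => ?_
  obtain ⟨a, ha⟩ := hq x hx
  rw [sub_mul, ← map_mul, hab' x, ← map_mul, ← ha, hab', sub_self]

/-! ### Flatness of the ring of right quotients. -/

section Flat

variable {M : Type u} [AddCommGroup M] [Module Aᵐᵒᵖ M]

/-- Functions on `A` which vanish on an open right ideal. -/
def germKernel (hF : IsGabrielTopology F) (M : Type u) [AddCommGroup M] : AddSubgroup (A → M) where
  carrier := {g | ∃ J ∈ F, ∀ x ∈ J, g x = 0}
  add_mem' := by
    rintro f g ⟨J, hJ, hf⟩ ⟨J', hJ', hg⟩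
    refine ⟨_, hF.inf_mem J hJ J' hJ', fun x hx => ?_⟩
    rw [Pi.add_apply, hf x hx.1, hg x hx.2, add_zero]
  zero_mem' := ⟨⊤, hF.top_mem, fun _ _ => rfl⟩
  neg_mem' := by
    rintro f ⟨J, hJ, hf⟩
    exact ⟨J, hJ, fun x hx => by rw [Pi.neg_apply, hf x hx, neg_zero]⟩

open Classical in
/-- The partial function `x ↦ m * (q * x)`, defined where `q * x ∈ A`, extended by zero. -/
noncomputable def germFun (φ : A →+* Q) (m : M) (q : Q) (x : A) : M :=
  if h : ∃ a, φ a = q * φ x then op h.choose • m else 0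

theorem germFun_eq (hinj : Function.Injective φ) (m : M) {q : Q} {x a : A} (h : φ a = q * φ x) :
    germFun φ m q x = op a • m := by
  have h' : ∃ a, φ a = q * φ x := ⟨a, h⟩
  rw [germFun, dif_pos h', hinj (h'.choose_spec.trans h.symm)]

/-- Sending `m ⊗ q` to the germ of `x ↦ m (q x)`, defined on an open right ideal, is balanced, and
`m ⊗ 1` goes to the germ of `x ↦ m x`. Germs of arbitrary functions suffice, since only an abelian
group is needed as target. -/
theorem IsRingOfRightQuotients.exists_mem_of_btmul_one_eq_zero [Module A Q]
    (hl : ∀ (a : A) (q : Q), a • q = φ a * q) (h : IsRingOfRightQuotients F φ)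
    (hF : IsGabrielTopology F) (hinj : Function.Injective φ) {m : M}
    (hm : btmul A m (1 : Q) = 0) : ∃ J ∈ F, ∀ x ∈ J, op x • m = 0 := by
  let G := (A → M) ⧸ germKernel hF M
  have heq : ∀ f g : A → M, (∃ J ∈ F, ∀ x ∈ J, f x = g x) →
      (QuotientAddGroup.mk f : G) = QuotientAddGroup.mk g := by
    rintro f g ⟨J, hJ, hfg⟩
    refine QuotientAddGroup.eq_iff_sub_mem.2 ⟨J, hJ, fun x hx => ?_⟩
    rw [Pi.sub_apply, hfg x hx, sub_self]
  let γ : M →+ Q →+ G := AddMonoidHom.mk' (fun m => AddMonoidHom.mk'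
      (fun q => (QuotientAddGroup.mk (germFun φ m q) : G)) (by
      intro p q
      obtain ⟨J, hJ, hd⟩ := h.exists_common_dom hF ![p, q]
      refine heq _ (germFun φ m p + germFun φ m q) ⟨J, hJ, fun x hx => ?_⟩
      obtain ⟨a, ha⟩ := hd x hx 0
      obtain ⟨b, hb⟩ := hd x hx 1
      change φ a = p * φ x at ha
      change φ b = q * φ x at hb
      rw [Pi.add_apply, germFun_eq hinj m ha, germFun_eq hinj m hb,
        germFun_eq hinj m (a := a + b) (by rw [map_add, ha, hb, add_mul]), op_add, add_smul])) (by
    intro m m'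
    refine AddMonoidHom.ext fun q => ?_
    obtain ⟨J, hJ, hd⟩ := h.exists_dom q
    refine heq _ (germFun φ m q + germFun φ m' q) ⟨J, hJ, fun x hx => ?_⟩
    obtain ⟨a, ha⟩ := hd x hx
    rw [Pi.add_apply, germFun_eq hinj m ha, germFun_eq hinj m' ha, germFun_eq hinj _ ha, smul_add])
  have hγ : ∀ m q, γ m q = (QuotientAddGroup.mk (germFun φ m q) : G) := fun _ _ => rfl
  have hbal : ∀ (m : M) (a : A) (q : Q), γ (op a • m) q = γ m (a • q) := by
    intro m a q
    rw [hγ, hγ]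
    obtain ⟨J, hJ, hd⟩ := h.exists_dom q
    refine heq _ _ ⟨J, hJ, fun x hx => ?_⟩
    obtain ⟨b, hb⟩ := hd x hx
    rw [germFun_eq hinj _ hb, germFun_eq hinj m (a := a * b) (by rw [hl, map_mul, hb, mul_assoc]),
      smul_smul]
    rfl
  have h0 := congrArg (balancedLift γ hbal) hm
  rw [balancedLift_btmul, map_zero, hγ] at h0
  obtain ⟨J, hJ, hx⟩ := (QuotientAddGroup.eq_zero_iff _).1 h0
  exact ⟨J, hJ, fun x hxJ => by rw [← hx x hxJ, germFun_eq hinj m (a := x) (by rw [one_mul])]⟩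

/-- Let `t` map to zero. For `x` in an open ideal, `t x` has the form `m ⊗ 1`, and `f m ⊗ 1 = 0`
makes `f m`, hence `m`, torsion. Since open ideals generate `Q`, this gives `m ⊗ 1 = 0`; so `t x =
0` on an open ideal, and the same principle gives `t = 0`. -/
theorem IsRingOfRightQuotients.isLeftFlat [Module A Q]
    (hl : ∀ (a : A) (q : Q), a • q = φ a * q) (h : IsRingOfRightQuotients F φ)
    (hF : IsGabrielTopology F) (hinj : Function.Injective φ)
    (hunit : ∀ J ∈ F, GeneratesUnit φ (J : Set A)) : IsLeftFlat A Q := by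
  intro M M' _ _ _ _ f hf
  have hrmul : ∀ (N : Type u) [AddCommGroup N] [Module Aᵐᵒᵖ N], ∃ ρ : Q → BalancedTensor A N Q →+
      BalancedTensor A N Q, ∀ p x y, ρ p (btmul A x y) = btmul A x (y * p) := by
    intro N _ _
    refine ⟨fun p => balancedLift (AddMonoidHom.mk' (fun x => AddMonoidHom.mk'
      (fun y => btmul A x (y * p)) ?_) ?_) ?_, fun p x y => rfl⟩
    · intro y z
      rw [add_mul, btmul_add_right]
    · intro x x'
      exact AddMonoidHom.ext fun y => btmul_add_left x x' _
    · intro x a y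
      change btmul A (op a • x) (y * p) = btmul A x (a • y * p)
      rw [btmul_smul, hl, hl, mul_assoc]
  obtain ⟨ρ, hρ⟩ := hrmul M
  obtain ⟨ρ', hρ'⟩ := hrmul M'
  have hcomm : ∀ p t, balancedMap Q f (ρ p t) = ρ' p (balancedMap Q f t) := by
    intro p t
    induction t using balancedTensor_induction with
    | zero => simp
    | tmul x y => rw [hρ, balancedMap_btmul, balancedMap_btmul, hρ']
    | add s t hs ht => simp only [map_add, hs, ht]
  have hdecomp : ∀ t : BalancedTensor A M Q, ∃ J ∈ F, ∀ x ∈ J, ∃ m, ρ (φ x) t = btmul A m (1 : Q) := by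
    intro t
    induction t using balancedTensor_induction with
    | zero => exact ⟨⊤, hF.top_mem, fun x _ => ⟨0, by rw [map_zero, btmul_zero_left]⟩⟩
    | tmul m q =>
      obtain ⟨J, hJ, hd⟩ := h.exists_dom q
      refine ⟨J, hJ, fun x hx => ?_⟩
      obtain ⟨a, ha⟩ := hd x hx
      exact ⟨op a • m, by rw [hρ, btmul_smul, hl, mul_one, ha]⟩
    | add s t hs ht =>
      obtain ⟨J, hJ, hs⟩ := hs
      obtain ⟨J', hJ', ht⟩ := ht
      refine ⟨_, hF.inf_mem J hJ J' hJ', fun x hx => ?_⟩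
      obtain ⟨m, hm⟩ := hs x hx.1
      obtain ⟨m', hm'⟩ := ht x hx.2
      exact ⟨m + m', by rw [map_add, hm, hm', btmul_add_left]⟩
  refine (injective_iff_map_eq_zero _).2 fun t ht => ?_
  obtain ⟨J, hJ, hd⟩ := hdecomp t
  have hzero : ∀ x ∈ J, ρ (φ x) t = 0 := by
    intro x hx
    obtain ⟨m, hm⟩ := hd x hx
    have h1 : btmul A (f m) (1 : Q) = 0 := by
      rw [← balancedMap_btmul, ← hm, hcomm, ht, map_zero]
    obtain ⟨J', hJ', hx'⟩ := h.exists_mem_of_btmul_one_eq_zero hl hF hinj h1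
    obtain ⟨k, r, q, hr, hrq⟩ := generatesUnit_iff.1 (hunit J' hJ')
    rw [hm, ← hrq, btmul_sum_right]
    refine Finset.sum_eq_zero fun i _ => ?_
    have h2 : op (r i) • m = 0 := by
      apply hf
      rw [map_smul, hx' _ (hr i), map_zero]
    rw [← hl, ← btmul_smul, h2, btmul_zero_left]
  obtain ⟨k, r, q, hr, hrq⟩ := generatesUnit_iff.1 (hunit J hJ)
  have hsum : ∀ t : BalancedTensor A M Q, t = ∑ i, ρ (q i) (ρ (φ (r i)) t) := by
    intro t
    induction t using balancedTensor_induction with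
    | zero => simp
    | tmul x y =>
      simp only [hρ]
      rw [← btmul_sum_right]
      congr 1
      conv_lhs => rw [← mul_one y, ← hrq, Finset.mul_sum]
      exact Finset.sum_congr rfl fun i _ => (mul_assoc _ _ _).symm
    | add s t hs ht =>
      conv_lhs => rw [hs, ht]
      simp only [map_add, Finset.sum_add_distrib]
  rw [hsum t]
  exact Finset.sum_eq_zero fun i _ => by rw [hzero _ (hr i), map_zero]

end Flat

theorem IsRingOfRightQuotients.isFlatBimorphism (h : IsRingOfRightQuotients F φ)
    (hF : IsGabrielTopology F) (hinj : Function.Injective φ)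
    (hunit : ∀ J ∈ F, GeneratesUnit φ (J : Set A)) : IsFlatBimorphism φ := by
  let _ : Module A Q := Module.compHom Q φ
  exact ⟨hinj, h.isRingEpi hunit, h.isLeftFlat (fun _ _ => rfl) hF hinj hunit⟩

/-- A basis of `J` over `A` becomes a basis of `JQ = Q` over `Q`: a relation over `Q`, multiplied by
elements of a common ideal of denominators, is a relation over `A`. -/
theorem IsRingOfRightQuotients.exists_equiv_of_equiv (h : IsRingOfRightQuotients F φ)
    (hF : IsGabrielTopology F) (hinj : Function.Injective φ) {J : RightIdeal A} (hJ : J ∈ F)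
    {r : ℕ} (e : J ≃ₗ[Aᵐᵒᵖ] (Fin r → A)) : Nonempty (Q ≃ₗ[Qᵐᵒᵖ] (Fin r → Q)) := by
  let b : Fin r → J := fun k => e.symm (Pi.single k 1)
  have hb : ∀ x : J, ∑ k, op (e x k) • b k = x := by
    intro x
    apply e.injective
    rw [map_sum]
    ext k
    rw [Finset.sum_apply, Finset.sum_eq_single k]
    · simp [b]
    · intro l _ hl
      rw [map_smul, LinearEquiv.apply_symm_apply, Pi.smul_apply, Pi.single_eq_of_ne hl.symm,
        smul_zero]
    · simp
  have he : ∀ c : Fin r → A, e (∑ k, op (c k) • b k) = c := by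
    intro c
    rw [map_sum]
    ext k
    rw [Finset.sum_apply, Finset.sum_eq_single k]
    · simp [b]
    · intro l _ hl
      rw [map_smul, LinearEquiv.apply_symm_apply, Pi.smul_apply, Pi.single_eq_of_ne hl.symm,
        smul_zero]
    · simp
  let T : (Fin r → Q) →ₗ[Qᵐᵒᵖ] Q :=
    { toFun := fun q => ∑ k, φ (b k) * q k
      map_add' := fun p q => by simp [mul_add, Finset.sum_add_distrib]
      map_smul' := fun c q => by
        rw [RingHom.id_apply, Finset.smul_sum]
        refine Finset.sum_congr rfl fun k _ => ?_
        change φ (b k) * (q k * c.unop) = φ (b k) * q k * c.unop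
        rw [mul_assoc] }
  have hT : ∀ q, T q = ∑ k, φ (b k) * q k := fun _ => rfl
  refine ⟨(LinearEquiv.ofBijective T ⟨?_, ?_⟩).symm⟩
  · refine (injective_iff_map_eq_zero _).2 fun q hq => ?_
    rw [hT] at hq
    obtain ⟨J', hJ', hd⟩ := h.exists_common_dom hF q
    funext k
    refine h.torsion_free _ ⟨J', hJ', fun x hx => ?_⟩
    choose c hc using hd x hx
    have h1 : ∑ k, op (c k) • b k = 0 := by
      apply Subtype.ext
      rw [AddSubmonoidClass.coe_finsetSum]
      apply hinj
      change φ (∑ k, (b k : A) * c k) = φ 0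
      rw [map_zero, map_sum, ← zero_mul (φ x), ← hq, Finset.sum_mul]
      refine Finset.sum_congr rfl fun k _ => ?_
      rw [map_mul, hc, mul_assoc]
    have h2 := he c
    rw [h1, map_zero] at h2
    rw [← hc, ← h2, Pi.zero_apply, map_zero]
  · have h1 : GeneratesUnit φ (J : Set A) := h.generatesUnit_of_equiv hJ e
    have h2 : Submodule.span Qᵐᵒᵖ (φ '' (J : Set A)) ≤ LinearMap.range T := by
      rw [Submodule.span_le]
      rintro _ ⟨x, hx, rfl⟩
      refine ⟨fun k => φ (e ⟨x, hx⟩ k), ?_⟩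
      have h3 := congrArg (fun y : J => φ (y : A)) (hb ⟨x, hx⟩)
      simp only [AddSubmonoidClass.coe_finsetSum, map_sum] at h3
      rw [hT, ← h3]
      refine Finset.sum_congr rfl fun k _ => ?_
      rw [← map_mul]
      rfl
    intro q
    have h4 := (LinearMap.range T).smul_mem (op q) (h2 h1)
    simpa using h4

end RightQuotients

end FreeLoc

namespace FreeLoc

open MulOpposite

/-! ### Two-sided ideals of finite codimension -/

section PrimeArtinian

/-- Primeness kills the nilpotent Jacobson radical, so `B` is semisimple and `J` has a complementary
left ideal `J'`. As `J J' ⊆ J ∩ J' = 0`, `J'` lies in the right annihilator of `J`, which is zero by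
primeness. -/
theorem eq_top_of_prime_artinian {B : Type*} [Ring B] [IsArtinianRing B]
    (hprime : ∀ J₁ J₂ : Ideal B, J₁.IsTwoSided → J₂.IsTwoSided → J₁ * J₂ = ⊥ → J₁ = ⊥ ∨ J₂ = ⊥)
    (J : Ideal B) [J.IsTwoSided] (hJ : J ≠ ⊥) : J = ⊤ := by
  have hjac : Ring.jacobson B = ⊥ := by
    obtain ⟨k, hk⟩ := IsSemiprimaryRing.isNilpotent (R := B)
    induction k with
    | zero =>
      rw [Submodule.pow_zero, Ideal.one_eq_top] at hk
      rw [eq_bot_iff]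
      exact le_top.trans hk.le
    | succ k ih =>
      rw [Submodule.pow_succ] at hk
      rcases hprime _ _ inferInstance inferInstance hk with h | h
      · exact ih h
      · exact h
  have : IsSemisimpleRing B := IsArtinianRing.isSemisimpleRing_iff_jacobson.2 hjac
  obtain ⟨J', hJ'⟩ := exists_isCompl J
  let N : Ideal B :=
    { carrier := {x | ∀ j ∈ J, j * x = 0}
      add_mem' := fun ha hb j hj => by rw [mul_add, ha j hj, hb j hj, add_zero]
      zero_mem' := fun j _ => mul_zero j
      smul_mem' := fun c x hx j hj => by
        rw [smul_eq_mul, ← mul_assoc]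
        exact hx _ (J.mul_mem_right c hj) }
  have hN : N.IsTwoSided := ⟨fun b ha j hj => by rw [← mul_assoc, ha j hj, zero_mul]⟩
  have hJN : J * N = ⊥ := by
    rw [eq_bot_iff, Ideal.mul_le]
    intro j hj x hx
    exact hx j hj
  have hN0 : N = ⊥ := (hprime J N inferInstance hN hJN).resolve_left hJ
  have hJ'N : J' ≤ N := by
    intro x hx j hj
    have h : j * x ∈ J ⊓ J' := ⟨J.mul_mem_right x hj, J'.mul_mem_left j hx⟩
    rw [hJ'.inf_eq_bot] at h
    exact h
  rw [hN0, le_bot_iff] at hJ'N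
  rw [← sup_bot_eq J, ← hJ'N, hJ'.sup_eq_top]

end PrimeArtinian

/-! ### Products of maximal ideals, cores, and the Gabriel axioms. -/

section FiniteCodim

variable {K A : Type u} [Field K] [Ring A] [Algebra K A]

theorem finiteDimensional_quotient_of_le {I J : Ideal A} (h : I ≤ J)
    [FiniteDimensional K (A ⧸ I)] : FiniteDimensional K (A ⧸ J) :=
  Module.Finite.of_surjective ((Submodule.factor h).restrictScalars K)
    (Submodule.factor_surjective h)

theorem finrank_quotient_lt {I J : Ideal A} (h : I < J) [FiniteDimensional K (A ⧸ I)] :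
    Module.finrank K (A ⧸ J) < Module.finrank K (A ⧸ I) := by
  let f := (Submodule.factor h.le).restrictScalars K
  have hf : Function.Surjective f := Submodule.factor_surjective h.le
  have h1 := f.finrank_range_add_finrank_ker
  rw [LinearMap.range_eq_top.2 hf, finrank_top] at h1
  obtain ⟨x, hxJ, hxI⟩ := SetLike.exists_of_lt h
  have h2 : 0 < Module.finrank K (LinearMap.ker f) := by
    have : Nontrivial (LinearMap.ker f) := by
      refine ⟨⟨⟨Submodule.Quotient.mk x, ?_⟩, 0, ?_⟩⟩
      · exact (Submodule.Quotient.mk_eq_zero J).2 hxJ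
      · intro h
        exact hxI ((Submodule.Quotient.mk_eq_zero I).1 (congrArg Subtype.val h))
    exact Module.finrank_pos
  omega

theorem prodIdeal_nil {Λ : Set (MaxFinIdeal K A)} : prodIdeal ([] : List Λ) = ⊤ := by
  rw [prodIdeal, List.map_nil, List.prod_nil, Ideal.one_eq_top]

theorem prodIdeal_cons {Λ : Set (MaxFinIdeal K A)} (I : Λ) (L : List Λ) :
    prodIdeal (I :: L) = I.1.toIdeal * prodIdeal L := by
  rw [prodIdeal, List.map_cons, List.prod_cons]
  rfl

theorem prodIdeal_append {Λ : Set (MaxFinIdeal K A)} (L L' : List Λ) :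
    prodIdeal (L ++ L') = prodIdeal L * prodIdeal L' := by
  induction L with
  | nil => rw [List.nil_append, prodIdeal_nil, Ideal.top_mul]
  | cons I L ih => rw [List.cons_append, prodIdeal_cons, prodIdeal_cons, ih, mul_assoc]

/-- Induction on the codimension. If `I` is proper and not maximal, `A/I` is not prime by
`eq_top_of_prime_artinian`, so two strictly larger ideals have their product inside `I`, and their
lists can be concatenated. -/
theorem exists_prodIdeal_le (Λ : Set (MaxFinIdeal K A)) (I : Ideal A) [I.IsTwoSided]
    [FiniteDimensional K (A ⧸ I)] (hΛ : ∀ P : MaxFinIdeal K A, I ≤ P.toIdeal → P ∈ Λ) :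
    ∃ L : List Λ, prodIdeal L ≤ I := by
  obtain ⟨k, hk⟩ : ∃ k, Module.finrank K (A ⧸ I) = k := ⟨_, rfl⟩
  induction k using Nat.strong_induction_on generalizing I with
  | _ k ih =>
  by_cases htop : I = ⊤
  · exact ⟨[], htop ▸ le_top⟩
  by_cases hmax : ∀ J : Ideal A, J.IsTwoSided → I < J → J = ⊤
  · let P : MaxFinIdeal K A := ⟨I, inferInstance, htop, hmax, inferInstance⟩
    refine ⟨[⟨P, hΛ P le_rfl⟩], ?_⟩
    simp [prodIdeal, P]
  push Not at hmax
  obtain ⟨J, hJ, hIJ, hJtop⟩ := hmax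
  have hart : IsArtinianRing (A ⧸ I) := IsArtinianRing.of_finite K _
  have hnp : ¬ ∀ J₁ J₂ : Ideal (A ⧸ I), J₁.IsTwoSided → J₂.IsTwoSided → J₁ * J₂ = ⊥ →
      J₁ = ⊥ ∨ J₂ = ⊥ := by
    intro hprime
    have : RingHomSurjective (Ideal.Quotient.mk I) := ⟨Ideal.Quotient.mk_surjective⟩
    have h1 := eq_top_of_prime_artinian hprime (J.map (Ideal.Quotient.mk I)) (by
      intro h
      rw [Ideal.map_eq_bot_iff_le_ker, Ideal.mk_ker] at h
      exact hIJ.not_ge h)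
    apply hJtop
    rw [← Ideal.comap_map_mk hIJ.le, h1, Ideal.comap_top]
  push Not at hnp
  obtain ⟨J₁, J₂, h₁, h₂, h12, hb₁, hb₂⟩ := hnp
  have key : ∀ J' : Ideal (A ⧸ I), J'.IsTwoSided → J' ≠ ⊥ →
      ∃ L : List Λ, prodIdeal L ≤ J'.comap (Ideal.Quotient.mk I) := by
    intro J' hJ' hb
    have hle : I ≤ J'.comap (Ideal.Quotient.mk I) := by
      intro x hx
      rw [Ideal.mem_comap, Ideal.Quotient.eq_zero_iff_mem.2 hx]
      exact J'.zero_mem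
    have hlt : I < J'.comap (Ideal.Quotient.mk I) := by
      refine lt_of_le_of_ne hle fun h => hb ?_
      rw [← Ideal.map_comap_of_surjective (Ideal.Quotient.mk I) Ideal.Quotient.mk_surjective J', ← h,
        Ideal.map_quotient_self]
    have := finiteDimensional_quotient_of_le (K := K) hle
    exact ih _ (hk ▸ finrank_quotient_lt hlt) _ (fun P hP => hΛ P (hle.trans hP)) rfl
  obtain ⟨L₁, hL₁⟩ := key J₁ h₁ hb₁
  obtain ⟨L₂, hL₂⟩ := key J₂ h₂ hb₂
  refine ⟨L₁ ++ L₂, ?_⟩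
  rw [prodIdeal_append, Ideal.mul_le]
  intro x hx y hy
  rw [← Ideal.Quotient.eq_zero_iff_mem, map_mul, ← Submodule.mem_bot (A ⧸ I), ← h12]
  exact Ideal.mul_mem_mul (hL₁ hx) (hL₂ hy)

theorem MaxFinIdeal.isSimpleRing (I : MaxFinIdeal K A) : IsSimpleRing (A ⧸ I.toIdeal) := by
  rw [isSimpleRing_iff_isTwoSided_imp]
  refine ⟨Ideal.Quotient.nontrivial_iff.2 I.ne_top, fun J hJ => ?_⟩
  have hle : I.toIdeal ≤ J.comap (Ideal.Quotient.mk I.toIdeal) := by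
    intro x hx
    rw [Ideal.mem_comap, Ideal.Quotient.eq_zero_iff_mem.2 hx]
    exact J.zero_mem
  rcases hle.lt_or_eq with h | h
  · right
    have h1 := I.maximal _ inferInstance h
    rw [← Ideal.map_comap_of_surjective (Ideal.Quotient.mk I.toIdeal) Ideal.Quotient.mk_surjective J,
      h1, Ideal.map_top]
  · left
    rw [← Ideal.map_comap_of_surjective (Ideal.Quotient.mk I.toIdeal) Ideal.Quotient.mk_surjective J,
      ← h, Ideal.map_quotient_self]

theorem MaxFinIdeal.exists_algEquiv_matrix (I : MaxFinIdeal K A) :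
    ∃ (m : ℕ) (D : Type u) (_ : DivisionRing D) (_ : Algebra K D), 1 ≤ m ∧ FiniteDimensional K D ∧
      Nonempty ((A ⧸ I.toIdeal) ≃ₐ[K] Matrix (Fin m) (Fin m) D) := by
  have := I.isSimpleRing
  have := I.finite
  have : IsArtinianRing (A ⧸ I.toIdeal) := IsArtinianRing.of_finite K _
  obtain ⟨m, hm, D, hD, hKD, hfin, e⟩ :=
    IsSimpleRing.exists_algEquiv_matrix_divisionRing_finite K (A ⧸ I.toIdeal)
  exact ⟨m, D, hD, hKD, Nat.one_le_iff_ne_zero.2 hm.out, hfin, e⟩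

/-- A two-sided ideal as a right ideal. -/
def toRight (I : Ideal A) [I.IsTwoSided] : RightIdeal A where
  carrier := I
  add_mem' := I.add_mem
  zero_mem' := I.zero_mem
  smul_mem' c _ hx := I.mul_mem_right c.unop hx

theorem mem_toRight {I : Ideal A} [I.IsTwoSided] {x : A} : x ∈ toRight I ↔ x ∈ I := Iff.rfl

/-- The quotient by a two-sided ideal, as a vector space, does not depend on the side. -/
def quotientToRightEquiv (I : Ideal A) [I.IsTwoSided] : (A ⧸ I) ≃ₗ[K] (A ⧸ toRight I) :=
  (Submodule.Quotient.restrictScalarsEquiv K I).symm.trans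
    ((Submodule.quotEquivOfEq (I.restrictScalars K) ((toRight I).restrictScalars K)
      (by ext; rfl)).trans (Submodule.Quotient.restrictScalarsEquiv K (toRight I)))

theorem finiteDimensional_toRight (I : Ideal A) [I.IsTwoSided] [FiniteDimensional K (A ⧸ I)] :
    FiniteDimensional K (A ⧸ toRight I) :=
  Module.Finite.equiv (quotientToRightEquiv I)

theorem finiteDimensional_quotient_iff (N : Submodule K A) :
    FiniteDimensional K (A ⧸ N) ↔ ∃ W : Submodule K A, W.FG ∧ W ⊔ N = ⊤ := by
  constructor
  · intro h
    obtain ⟨s, hs⟩ := h.fg_top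
    choose f hf using N.mkQ_surjective
    refine ⟨Submodule.span K (f '' s), Submodule.fg_span (s.finite_toSet.image f), ?_⟩
    have h1 : (Submodule.span K (f '' s)).map N.mkQ = ⊤ := by
      rw [Submodule.map_span, ← Set.image_comp]
      have : N.mkQ ∘ f = id := funext hf
      rw [this, Set.image_id, hs]
    have h2 := congrArg (Submodule.comap N.mkQ) h1
    rwa [Submodule.comap_map_eq, N.ker_mkQ, Submodule.comap_top] at h2
  · rintro ⟨W, hW, h⟩
    refine ⟨?_⟩
    have h1 := congrArg (Submodule.map N.mkQ) h
    rw [Submodule.map_sup, Submodule.map_top, N.range_mkQ, Submodule.mkQ_map_self, sup_bot_eq] at h1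
    rw [← h1]
    exact hW.map _

theorem finiteDimensional_restrictScalars_iff {S : Type*} [Ring S] [Module S A] [SMul K S]
    [IsScalarTower K S A] (N : Submodule S A) :
    FiniteDimensional K (A ⧸ N.restrictScalars K) ↔ FiniteDimensional K (A ⧸ N) :=
  ⟨fun _ => Module.Finite.equiv (Submodule.Quotient.restrictScalarsEquiv K N),
    fun _ => Module.Finite.equiv (Submodule.Quotient.restrictScalarsEquiv K N).symm⟩

/-- Write `A = W + I = W' + J` and `I = E A` with `W`, `W'`, `E` finite-dimensional. Then `I = E (W'
+ J) ⊆ E W' + I J`, so `W + E W'` spans `A` modulo `I J`. -/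
theorem finiteDimensional_quotient_mul (I J : Ideal A) [I.IsTwoSided]
    [FiniteDimensional K (A ⧸ I)] [FiniteDimensional K (A ⧸ J)] (hI : (toRight I).FG) :
    FiniteDimensional K (A ⧸ I * J) := by
  rw [← finiteDimensional_restrictScalars_iff, finiteDimensional_quotient_iff]
  obtain ⟨W, hW, hWI⟩ := (finiteDimensional_quotient_iff (I.restrictScalars K)).1
    ((finiteDimensional_restrictScalars_iff I).2 inferInstance)
  obtain ⟨W', hW', hWJ⟩ := (finiteDimensional_quotient_iff (J.restrictScalars K)).1
    ((finiteDimensional_restrictScalars_iff J).2 inferInstance)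
  obtain ⟨s, hs⟩ := hI
  let E := Submodule.span K (s : Set A)
  refine ⟨W ⊔ E * W', hW.sup (Submodule.FG.mul (Submodule.fg_span s.finite_toSet) hW'), ?_⟩
  have hsI : ∀ e ∈ s, e ∈ I := fun e he => by
    have : e ∈ toRight I := hs ▸ Submodule.subset_span he
    exact this
  have hEI : E ≤ I.restrictScalars K := Submodule.span_le.2 fun e he => hsI e he
  have h1 : I.restrictScalars K ≤ E * W' ⊔ (I * J).restrictScalars K := by
    intro x hx
    have hx' : x ∈ Submodule.span Aᵐᵒᵖ (s : Set A) := hs.symm ▸ hx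
    clear hx
    have h2 : E * ⊤ ≤ E * W' ⊔ (I * J).restrictScalars K := by
      rw [← hWJ, Submodule.mul_sup]
      refine sup_le_sup le_rfl ?_
      rw [Submodule.mul_le]
      intro a ha b hb
      exact Ideal.mul_mem_mul (hEI ha) hb
    apply h2
    induction hx' using Submodule.span_induction with
    | mem x hx =>
      rw [← mul_one x]
      exact Submodule.mul_mem_mul (Submodule.subset_span hx) trivial
    | zero => exact Submodule.zero_mem _
    | add x y _ _ hx hy => exact Submodule.add_mem _ hx hy
    | smul a x _ hx =>
      change x * a.unop ∈ _
      have h3 : x * a.unop ∈ E * ⊤ * ⊤ := Submodule.mul_mem_mul hx trivial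
      rw [mul_assoc] at h3
      exact Submodule.mul_le.2 (fun m hm n _ => Submodule.mul_mem_mul hm Submodule.mem_top) h3
  rw [eq_top_iff, ← hWI, sup_assoc]
  exact sup_le_sup le_rfl h1

/-- The largest two-sided ideal contained in a right ideal. -/
def coreIdeal (R : RightIdeal A) : Ideal A where
  carrier := {a | ∀ b, b * a ∈ R}
  add_mem' ha hb c := by rw [mul_add]; exact R.add_mem (ha c) (hb c)
  zero_mem' c := by rw [mul_zero]; exact R.zero_mem
  smul_mem' c x hx b := by rw [smul_eq_mul, ← mul_assoc]; exact hx _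

theorem mul_mem_rightIdeal (R : RightIdeal A) {x : A} (hx : x ∈ R) (a : A) : x * a ∈ R :=
  R.smul_mem (op a) hx

instance coreIdeal_isTwoSided (R : RightIdeal A) : (coreIdeal R).IsTwoSided :=
  ⟨fun c ha b => by rw [← mul_assoc]; exact mul_mem_rightIdeal R (ha b) c⟩

theorem coreIdeal_le {R : RightIdeal A} {x : A} (hx : x ∈ coreIdeal R) : x ∈ R := by
  simpa using hx 1

/-- Since `R a ⊆ R`, whether `b * a ∈ R` depends only on the class of `b`, and linearly; lifts of a
basis of `A/R` suffice as tests. The core is thus a finite intersection of ideals `(R : b i)`. -/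
theorem exists_mem_coreIdeal_iff (R : RightIdeal A) [FiniteDimensional K (A ⧸ R)] :
    ∃ (k : ℕ) (b : Fin k → A), ∀ a, a ∈ coreIdeal R ↔ ∀ i, b i * a ∈ R := by
  let B := Module.finBasis K (A ⧸ R)
  choose b hb using fun i => R.mkQ_surjective (B i)
  refine ⟨_, b, fun a => ⟨fun h i => h (b i), fun h c => ?_⟩⟩
  have h1 : c - ∑ i, B.repr (R.mkQ c) i • b i ∈ R := by
    rw [← Submodule.Quotient.mk_eq_zero R]
    change R.mkQ _ = 0
    have h2 : ∀ (k : K) x, R.mkQ (k • x) = k • R.mkQ x := fun k x => rfl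
    rw [map_sub, map_sum]
    simp only [h2, hb]
    rw [B.sum_repr, sub_self]
  have h3 : c * a = (c - ∑ i, B.repr (R.mkQ c) i • b i) * a +
      ∑ i, B.repr (R.mkQ c) i • (b i * a) := by
    rw [sub_mul, Finset.sum_mul]
    simp
  rw [h3]
  exact R.add_mem (mul_mem_rightIdeal R h1 a)
    (R.sum_mem fun i _ => (R.restrictScalars K).smul_mem _ (h i))

theorem finiteDimensional_coreIdeal (R : RightIdeal A) [FiniteDimensional K (A ⧸ R)] :
    FiniteDimensional K (A ⧸ coreIdeal R) := by
  obtain ⟨k, b, hb⟩ := exists_mem_coreIdeal_iff (K := K) R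
  let f : A →ₗ[K] (Fin k → A ⧸ R) :=
    LinearMap.pi fun i => (R.mkQ.restrictScalars K) ∘ₗ LinearMap.mulLeft K (b i)
  have hf : LinearMap.ker f = (coreIdeal R).restrictScalars K := by
    ext a
    rw [LinearMap.mem_ker, Submodule.restrictScalars_mem, hb, funext_iff]
    exact forall_congr' fun i => Submodule.Quotient.mk_eq_zero R
  rw [← finiteDimensional_restrictScalars_iff, ← hf]
  exact Module.Finite.equiv f.quotKerEquivRange.symm

theorem isGabrielTopology_of_fg (Λ : Set (MaxFinIdeal K A))
    (hfg : ∀ L : List Λ, ∃ s : Finset A, ∀ x ∈ prodIdeal L,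
      x ∈ Submodule.span Aᵐᵒᵖ ((s : Set A) ∩ (prodIdeal L : Set A))) :
    IsGabrielTopology (openRightIdeals Λ) where
  top_mem := ⟨[], fun _ _ => trivial⟩
  mem_of_le := by
    rintro R ⟨L, hL⟩ S hRS
    exact ⟨L, fun x hx => hRS (hL x hx)⟩
  inf_mem := by
    rintro R ⟨L, hL⟩ S ⟨L', hL'⟩
    exact ⟨L ++ L', fun x hx => ⟨hL x (prodIdeal_append_le L L' hx).1,
      hL' x (prodIdeal_append_le L L' hx).2⟩⟩
  colon_mem := by
    rintro R ⟨L, hL⟩ a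
    exact ⟨L, fun x hx => hL _ ((prodIdeal L).mul_mem_left a hx)⟩
  mem_of_colon_mem := by
    rintro S ⟨R, ⟨L, hL⟩, hS⟩
    obtain ⟨s, hs⟩ := hfg L
    have hcommon : ∀ t : Finset A, (∀ e ∈ t, e ∈ prodIdeal L) →
        ∃ L' : List Λ, ∀ e ∈ t, ∀ x ∈ prodIdeal L', e * x ∈ S := by
      classical
      intro t
      induction t using Finset.induction_on with
      | empty => exact fun _ => ⟨[], by simp⟩
      | insert e t _ ih =>
        intro ht
        obtain ⟨L₁, h₁⟩ := ih fun e' he' => ht e' (Finset.mem_insert_of_mem he')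
        obtain ⟨L₂, h₂⟩ := hS e (hL e (ht e (Finset.mem_insert_self e t)))
        refine ⟨L₁ ++ L₂, fun e' he' x hx => ?_⟩
        have hx' := prodIdeal_append_le L₁ L₂ hx
        rcases Finset.mem_insert.1 he' with rfl | he'
        · exact h₂ x hx'.2
        · exact h₁ e' he' x hx'.1
    classical
    obtain ⟨L', hL'⟩ := hcommon (s.filter (· ∈ prodIdeal L)) fun e he => (Finset.mem_filter.1 he).2
    refine ⟨L ++ L', fun y hy => ?_⟩
    rw [prodIdeal_append] at hy
    induction hy using Submodule.mul_induction_on' with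
    | add x _ y _ hx hy => exact S.add_mem hx hy
    | mem_mul_mem m hm z hz =>
      have := prodIdeal_isTwoSided L'
      have hm' := hs m hm
      clear hm
      induction hm' using Submodule.span_induction generalizing z with
      | mem x hx => exact hL' x (Finset.mem_filter.2 hx) z hz
      | zero => rw [zero_mul]; exact S.zero_mem
      | add x y _ _ hx hy => rw [add_mul]; exact S.add_mem (hx z hz) (hy z hz)
      | smul a x _ hx =>
        change x * a.unop * z ∈ S
        rw [mul_assoc]
        exact hx _ ((prodIdeal L').mul_mem_left _ hz)

end FiniteCodim

end FreeLoc

namespace FreeLoc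

open MulOpposite

/-! ### The topologies on a free algebra -/

section FreeAlgebraTopology

variable {K : Type u} [Field K] {X : Type} [Fintype X]

/-- Schreier's formula for submodules of finite codimension of a free right module. -/
theorem exists_equiv_free_of_finite_codim {ι : Type*} [Fintype ι]
    (N : Submodule (FreeAlgebra K X)ᵐᵒᵖ (ι → FreeAlgebra K X))
    [FiniteDimensional K ((ι → FreeAlgebra K X) ⧸ N)] :
    ∃ r : ℕ, r + Module.finrank K ((ι → FreeAlgebra K X) ⧸ N) = Fintype.card ι +
        Module.finrank K ((ι → FreeAlgebra K X) ⧸ N) * Fintype.card X ∧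
      Nonempty (N ≃ₗ[(FreeAlgebra K X)ᵐᵒᵖ] (Fin r → FreeAlgebra K X)) := by
  obtain ⟨r, hr, ⟨e⟩⟩ := exists_ker_equiv_free N.mkQ N.mkQ_surjective
  exact ⟨r, hr, ⟨(LinearEquiv.ofEq _ _ N.ker_mkQ).symm.trans e⟩⟩

/-- Schreier's formula for right ideals of finite codimension. -/
theorem exists_rightIdeal_equiv_free (R : RightIdeal (FreeAlgebra K X))
    [FiniteDimensional K (FreeAlgebra K X ⧸ R)] :
    ∃ r : ℕ, r + Module.finrank K (FreeAlgebra K X ⧸ R) = 1 +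
        Module.finrank K (FreeAlgebra K X ⧸ R) * Fintype.card X ∧
      Nonempty (R ≃ₗ[(FreeAlgebra K X)ᵐᵒᵖ] (Fin r → FreeAlgebra K X)) := by
  let e₀ := LinearEquiv.funUnique Unit (FreeAlgebra K X)ᵐᵒᵖ (FreeAlgebra K X)
  obtain ⟨r, hr, ⟨e⟩⟩ := exists_ker_equiv_free (R.mkQ ∘ₗ e₀.toLinearMap)
    (R.mkQ_surjective.comp e₀.surjective)
  have h : LinearMap.ker (R.mkQ ∘ₗ e₀.toLinearMap) = R.comap e₀.toLinearMap := by
    rw [LinearMap.ker_comp, R.ker_mkQ]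
  exact ⟨r, by simpa using hr,
    ⟨((e₀.ofSubmodule' R).symm.trans (LinearEquiv.ofEq _ _ h.symm)).trans e⟩⟩

theorem rightIdeal_fg (R : RightIdeal (FreeAlgebra K X))
    [FiniteDimensional K (FreeAlgebra K X ⧸ R)] : R.FG := by
  obtain ⟨r, -, ⟨e⟩⟩ := exists_rightIdeal_equiv_free R
  let e' : (FreeAlgebra K X)ᵐᵒᵖ ≃ₗ[(FreeAlgebra K X)ᵐᵒᵖ] FreeAlgebra K X :=
    { (opAddEquiv (α := FreeAlgebra K X)).symm with map_smul' := fun _ _ => rfl }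
  have : Module.Finite (FreeAlgebra K X)ᵐᵒᵖ (FreeAlgebra K X) := Module.Finite.equiv e'
  have : Module.Finite (FreeAlgebra K X)ᵐᵒᵖ R := Module.Finite.equiv e.symm
  exact (Submodule.fg_top R).1 this.fg_top

variable {Λ : Set (MaxFinIdeal K (FreeAlgebra K X))}

theorem finiteDimensional_prodIdeal (L : List Λ) :
    FiniteDimensional K (FreeAlgebra K X ⧸ prodIdeal L) := by
  induction L with
  | nil =>
    rw [prodIdeal_nil]
    have : Subsingleton (FreeAlgebra K X ⧸ (⊤ : Ideal (FreeAlgebra K X))) :=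
      Submodule.Quotient.subsingleton_iff.2 rfl
    infer_instance
  | cons I L ih =>
    rw [prodIdeal_cons]
    have := I.1.finite
    have := finiteDimensional_toRight (K := K) I.1.toIdeal
    exact finiteDimensional_quotient_mul _ _ (rightIdeal_fg _)

variable (Λ) in
theorem isGabrielTopology_openRightIdeals : IsGabrielTopology (openRightIdeals Λ) := by
  refine isGabrielTopology_of_fg Λ fun L => ?_
  have := prodIdeal_isTwoSided L
  have := finiteDimensional_prodIdeal L
  have := finiteDimensional_toRight (K := K) (prodIdeal L)
  obtain ⟨s, hs⟩ := rightIdeal_fg (toRight (prodIdeal L))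
  refine ⟨s, fun x hx => ?_⟩
  have h1 : (s : Set (FreeAlgebra K X)) ⊆ prodIdeal L := fun y hy => by
    have : y ∈ toRight (prodIdeal L) := hs ▸ Submodule.subset_span hy
    exact this
  rw [Set.inter_eq_left.2 h1, hs]
  exact hx

variable {Q : Type u} [Ring Q] {φ : FreeAlgebra K X →+* Q}

theorem generatesUnit_prodIdeal
    (hΛ : ∀ I ∈ Λ, GeneratesUnit φ (I.toIdeal : Set (FreeAlgebra K X))) (L : List Λ) :
    GeneratesUnit φ (prodIdeal L : Set (FreeAlgebra K X)) := by
  induction L with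
  | nil => rw [prodIdeal_nil]; exact generatesUnit_one.mono (by simp)
  | cons I L ih =>
    rw [prodIdeal_cons]
    exact (hΛ I.1 I.2).mul ih fun s hs t ht => Ideal.mul_mem_mul hs ht

/-- Each `I ∈ Λ` is itself open and is free of finite rank by Schreier's formula, so it generates
`Q`; this passes to products and to larger right ideals. -/
theorem IsRingOfRightQuotients.generatesUnit_of_mem
    (h : IsRingOfRightQuotients (openRightIdeals Λ) φ) :
    ∀ J ∈ openRightIdeals Λ, GeneratesUnit φ (J : Set (FreeAlgebra K X)) := by
  rintro J ⟨L, hL⟩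
  refine (generatesUnit_prodIdeal (fun I hI => ?_) L).mono hL
  have := I.finite
  have := finiteDimensional_toRight (K := K) I.toIdeal
  obtain ⟨r, -, ⟨e⟩⟩ := exists_rightIdeal_equiv_free (toRight I.toIdeal)
  refine h.generatesUnit_of_equiv (J := toRight I.toIdeal) ⟨[⟨I, hI⟩], ?_⟩ e
  simp [prodIdeal, mem_toRight]

theorem not_finiteDimensional_freeAlgebra [Nonempty X] :
    ¬ FiniteDimensional K (FreeAlgebra K X) := by
  intro h
  have x₀ : X := Classical.arbitrary X
  let f : FreeAlgebra K X →ₐ[K] Polynomial K := FreeAlgebra.lift K fun _ => Polynomial.X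
  have hf : Function.Surjective f := by
    rw [← AlgHom.range_eq_top, eq_top_iff, ← Polynomial.adjoin_X, Algebra.adjoin_le_iff]
    rintro _ rfl
    exact ⟨FreeAlgebra.ι K x₀, by simp [f]⟩
  have := Module.Finite.of_surjective f.toLinearMap hf
  exact Polynomial.not_finite this

theorem MaxFinIdeal.ne_bot [Nonempty X] (I : MaxFinIdeal K (FreeAlgebra K X)) : I.toIdeal ≠ ⊥ := by
  intro h
  have h1 := I.finite
  rw [h] at h1
  exact not_finiteDimensional_freeAlgebra (K := K) (X := X)
    (Module.Finite.equiv ((Submodule.quotEquivOfEqBot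
      (⊥ : Submodule (FreeAlgebra K X) (FreeAlgebra K X)) rfl).restrictScalars K))

theorem prodIdeal_ne_bot [Nonempty X] (L : List Λ) : prodIdeal L ≠ ⊥ := by
  induction L with
  | nil => rw [prodIdeal_nil]; exact top_ne_bot
  | cons I L ih =>
    rw [prodIdeal_cons, Ne, Ideal.mul_eq_bot, not_or]
    exact ⟨I.1.ne_bot, ih⟩

/-- The free algebra is an infinite-dimensional domain, so products of ideals of finite codimension
are non-zero and nothing but `0` is torsion. -/
theorem IsRingOfRightQuotients.injective [Nonempty X]
    (h : IsRingOfRightQuotients (openRightIdeals Λ) φ) : Function.Injective φ := by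
  refine (injective_iff_map_eq_zero φ).2 fun a ha => ?_
  obtain ⟨J, ⟨L, hL⟩, hJ⟩ := (h.map_eq_zero_iff a).1 ha
  obtain ⟨x, hx, hx0⟩ := Submodule.exists_mem_ne_zero_of_ne_bot (prodIdeal_ne_bot L)
  exact (mul_eq_zero.1 (hJ x (hL x hx))).resolve_right hx0

/-- The set `Λ` consists of all maximal ideals of finite codimension that generate `Q`; the point is
that every `R` with `RQ = Q` contains a product of these. -/
theorem IsFlatBimorphism.exists_eq_openRightIdeals (h : IsFlatBimorphism φ) :
    ∃ Λ : Set (MaxFinIdeal K (FreeAlgebra K X)), openRightIdeals Λ = unitIdeals φ := by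
  obtain ⟨Λ, hΛ⟩ : ∃ Λ : Set (MaxFinIdeal K (FreeAlgebra K X)), ∀ I, I ∈ Λ ↔
      GeneratesUnit φ (I.toIdeal : Set (FreeAlgebra K X)) := ⟨{I | _}, fun I => Iff.rfl⟩
  refine ⟨Λ, Set.Subset.antisymm ?_ ?_⟩
  · rintro R ⟨L, hL⟩
    have h1 := generatesUnit_prodIdeal (fun I hI => (hΛ I).1 hI) L
    exact h1.mono fun x hx => hL x hx
  intro R hR
  obtain ⟨R', hR'R, hfg, hR'⟩ := GeneratesUnit.exists_fg hR
  have hnt : Nontrivial Q := h.injective.nontrivial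
  -- Essentiality: `(R' : a)` generates the non-zero ring `Q`, so it contains a non-zero element.
  have hfd : FiniteDimensional K (FreeAlgebra K X ⧸ R') := by
    refine finiteDimensional_quotient_of_essential R' hfg fun a _ => ?_
    obtain ⟨J, hJ, hJa⟩ := h.exists_mem_unitIdeals_colon (fun _ : Unit => R') (fun _ => a)
      fun _ => hR'
    by_contra! hcon
    have h0 : ∀ x ∈ J, x = 0 := fun x hx => by
      by_contra hx0
      exact hcon x hx0 ((hJa x).1 hx ())
    refine one_ne_zero (α := Q) (GeneratesUnit.eq_zero hJ (RingHom.id Q) fun x hx => ?_)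
    rw [h0 x hx, map_zero, map_zero, mul_zero]
  obtain ⟨k, b, hb⟩ := exists_mem_coreIdeal_iff (K := K) R'
  obtain ⟨J, hJ, hJb⟩ := h.exists_mem_unitIdeals_colon (fun _ : Fin k => R') b fun _ => hR'
  have hcore : GeneratesUnit φ (coreIdeal R' : Set (FreeAlgebra K X)) := by
    refine GeneratesUnit.mono hJ fun x hx => ?_
    exact (hb x).2 ((hJb x).1 hx)
  have := finiteDimensional_coreIdeal (K := K) R'
  obtain ⟨L, hL⟩ := exists_prodIdeal_le Λ (coreIdeal R') fun P hP => (hΛ P).2 (hcore.mono hP)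
  exact ⟨L, fun x hx => hR'R (coreIdeal_le (hL hx))⟩

theorem isFlatBimorphism_iff [Nonempty X] : IsFlatBimorphism φ ↔
    ∃ Λ : Set (MaxFinIdeal K (FreeAlgebra K X)), IsRingOfRightQuotients (openRightIdeals Λ) φ := by
  constructor
  · intro h
    obtain ⟨Λ, hΛ⟩ := h.exists_eq_openRightIdeals
    exact ⟨Λ, hΛ ▸ h.isRingOfRightQuotients⟩
  · rintro ⟨Λ, h⟩
    exact h.isFlatBimorphism (isGabrielTopology_openRightIdeals Λ) h.injective
      h.generatesUnit_of_mem

end FreeAlgebraTopology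

end FreeLoc

namespace FreeLoc

open MulOpposite

/-! ### Dimensions of modules -/

section Dimensions

variable {K : Type u} [Field K]

/-- The dimension of a right module over `M_m(D)` is divisible by that of `D ^ m`. -/
theorem dvd_finrank_of_matrix_action {D W : Type*} [DivisionRing D] [Algebra K D] [AddCommGroup W]
    [Module K W] [FiniteDimensional K W] {m : ℕ} [NeZero m]
    (σ : Matrix (Fin m) (Fin m) D →ₐ[K] (Module.End K W)ᵐᵒᵖ) :
    Module.finrank K D * m ∣ Module.finrank K W := by
  let E : Fin m → Fin m → D → Module.End K W := fun i j d => (σ (Matrix.single i j d)).unop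
  have hE : ∀ i j k d d' w, E j k d' (E i j d w) = E i k (d * d') w := by
    intro i j k d d' w
    change ((σ (Matrix.single j k d')).unop * (σ (Matrix.single i j d)).unop) w = _
    rw [← unop_mul, ← map_mul, Matrix.single_mul_single_same]
  have hE0 : ∀ i j j' k d d' w, j ≠ j' → E j' k d' (E i j d w) = 0 := by
    intro i j j' k d d' w hj
    change ((σ (Matrix.single j' k d')).unop * (σ (Matrix.single i j d)).unop) w = _
    rw [← unop_mul, ← map_mul, Matrix.single_mul_single_of_ne _ _ _ _ hj, map_zero]
    rfl
  have hEadd : ∀ i j d d', E i j (d + d') = E i j d + E i j d' := by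
    intro i j d d'
    change (σ _).unop = (σ _).unop + (σ _).unop
    rw [← unop_add, ← map_add, Matrix.single_add]
  have hEsmul : ∀ i j (k : K) d, E i j (k • d) = k • E i j d := by
    intro i j k d
    change (σ _).unop = k • (σ _).unop
    rw [← unop_smul, ← map_smul, Matrix.smul_single]
  have hE1 : ∀ w, ∑ i, E i i 1 w = w := by
    intro w
    have h1 : ∑ i, Matrix.single i i (1 : D) = (1 : Matrix (Fin m) (Fin m) D) :=
      Matrix.sum_single_one
    have h2 : ∑ i, E i i 1 = (σ 1).unop := by
      rw [← h1, map_sum, Finset.unop_sum]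
    rw [← LinearMap.sum_apply, h2, map_one]
    rfl
  -- The matrix units identify `W` with `m` copies of `W e₀₀`, which is a right vector space over
  -- `D`.
  let W₀ : Submodule K W := LinearMap.range (E 0 0 1)
  have hW₀ : ∀ i d w, E i 0 d w ∈ W₀ := fun i d w => ⟨E i 0 d w, by rw [hE, mul_one]⟩
  have hfix : ∀ w ∈ W₀, E 0 0 1 w = w := by
    rintro _ ⟨w, rfl⟩
    rw [hE, mul_one]
  let ψ : W ≃ₗ[K] (Fin m → W₀) :=
    LinearEquiv.ofLinearMap
      (LinearMap.pi fun i => (E i 0 1).codRestrict W₀ (hW₀ i 1))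
      (∑ i, E 0 i 1 ∘ₗ W₀.subtype ∘ₗ LinearMap.proj i)
      (by
        refine LinearMap.ext fun w => funext fun j => Subtype.ext ?_
        change E j 0 1 ((∑ i, E 0 i 1 ∘ₗ W₀.subtype ∘ₗ LinearMap.proj i) w) = (w j : W)
        rw [LinearMap.sum_apply, map_sum, Finset.sum_eq_single j]
        · change E j 0 1 (E 0 j 1 (w j : W)) = _
          rw [hE, mul_one, hfix _ (w j).2]
        · intro i _ hij
          exact hE0 _ _ _ _ _ _ _ hij
        · simp)
      (by
        refine LinearMap.ext fun w => ?_
        rw [LinearMap.comp_apply, LinearMap.sum_apply, LinearMap.id_apply]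
        conv_rhs => rw [← hE1 w]
        refine Finset.sum_congr rfl fun i _ => ?_
        change E 0 i 1 (E i 0 1 w) = _
        rw [hE, mul_one])
  have hψ : Module.finrank K W = m * Module.finrank K W₀ := by
    rw [ψ.finrank_eq, Module.finrank_pi_fintype]
    simp
  let ρ : Dᵐᵒᵖ →+* Module.End K W₀ :=
    { toFun := fun d => (E 0 0 d.unop).restrict fun w _ => hW₀ 0 d.unop w
      map_one' := LinearMap.ext fun w => Subtype.ext (hfix _ w.2)
      map_mul' := fun d d' => LinearMap.ext fun w => Subtype.ext (by
        change E 0 0 (d * d').unop w = E 0 0 d.unop (E 0 0 d'.unop w)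
        rw [hE, unop_mul])
      map_zero' := LinearMap.ext fun w => Subtype.ext (by
        change E 0 0 0 w = 0
        have := hEadd 0 0 0 0
        rw [add_zero, left_eq_add] at this
        rw [this]
        rfl)
      map_add' := fun d d' => LinearMap.ext fun w => Subtype.ext (by
        change E 0 0 (d.unop + d'.unop) w = E 0 0 d.unop w + E 0 0 d'.unop w
        rw [hEadd]
        rfl) }
  let _ : Module Dᵐᵒᵖ W₀ := Module.compHom W₀ ρ
  have : IsScalarTower K Dᵐᵒᵖ W₀ := ⟨fun k d w => Subtype.ext (by
    change E 0 0 (k • d.unop) w = k • E 0 0 d.unop w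
    rw [hEsmul]
    rfl)⟩
  have h1 := Module.finrank_mul_finrank K Dᵐᵒᵖ W₀
  have h2 : Module.finrank K Dᵐᵒᵖ = Module.finrank K D :=
    (opLinearEquiv K : D ≃ₗ[K] Dᵐᵒᵖ).finrank_eq.symm
  rw [h2] at h1
  rw [hψ, ← h1, mul_comm (Module.finrank K D) m]
  exact mul_dvd_mul_left m (Dvd.intro _ rfl)

variable {A : Type u} [Ring A] [Algebra K A]

theorem dvd_finrank_of_annihilated {I : Ideal A} [I.IsTwoSided] {D : Type*} [DivisionRing D]
    [Algebra K D] {m : ℕ} [NeZero m] (e : (A ⧸ I) ≃ₐ[K] Matrix (Fin m) (Fin m) D) {V : Type*}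
    [AddCommGroup V] [Module Aᵐᵒᵖ V] [Module K V] [IsScalarTower K Aᵐᵒᵖ V]
    [FiniteDimensional K V] (hV : ∀ x ∈ I, ∀ v : V, op x • v = 0) : Module.finrank K D * m ∣ Module.finrank K V := by
  let τ : A →ₐ[K] (Module.End K V)ᵐᵒᵖ := AlgHom.ofLinearMap
    { toFun := fun a => op
        { toFun := fun v => op a • v
          map_add' := fun v w => smul_add _ _ _
          map_smul' := fun k v => smul_algebra_smul_comm _ _ _ }
      map_add' := fun a b => unop_injective (LinearMap.ext fun v => add_smul (op a) (op b) v)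
      map_smul' := fun k a => unop_injective (LinearMap.ext fun v => smul_assoc k (op a) v) }
    (unop_injective (LinearMap.ext fun v => one_smul Aᵐᵒᵖ v))
    (fun a b => unop_injective (LinearMap.ext fun v => mul_smul (op b) (op a) v))
  have hτ : ∀ a v, (τ a).unop v = op a • v := fun _ _ => rfl
  let τ' : (A ⧸ I) →ₐ[K] (Module.End K V)ᵐᵒᵖ := Ideal.Quotient.liftₐ I τ fun a ha =>
    unop_injective (LinearMap.ext fun v => hV a ha v)
  exact dvd_finrank_of_matrix_action (τ'.comp e.symm.toAlgHom)

/-- Filter `V` by `V I`: the quotient `V / V I` is a module over a matrix ring, and `V I` is killed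
by the product of the remaining ideals. -/
theorem dvd_finrank_of_prodIdeal {Λ : Set (MaxFinIdeal K A)} {m l : Λ → ℕ} {D : Λ → Type u}
    [∀ i, DivisionRing (D i)] [∀ i, Algebra K (D i)]
    (e : ∀ i : Λ, Nonempty ((A ⧸ i.1.toIdeal) ≃ₐ[K] Matrix (Fin (m i)) (Fin (m i)) (D i)))
    (hm : ∀ i, m i ≠ 0) (hl : ∀ i, Module.finrank K (D i) = l i) {d : ℕ} (hd : ∀ i, d ∣ l i * m i)
    (L : List Λ) (V : Type u) [AddCommGroup V] [Module Aᵐᵒᵖ V] [Module K V]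
    [IsScalarTower K Aᵐᵒᵖ V] [FiniteDimensional K V]
    (hV : ∀ x ∈ prodIdeal L, ∀ v : V, op x • v = 0) : d ∣ Module.finrank K V := by
  induction L generalizing V with
  | nil =>
    have : Subsingleton V := subsingleton_of_forall_eq 0 fun v => by
      have := hV 1 (by rw [prodIdeal_nil]; trivial) v
      rwa [op_one, one_smul] at this
    rw [Module.finrank_zero_of_subsingleton]
    exact dvd_zero d
  | cons I L ih =>
    let V' : Submodule Aᵐᵒᵖ V :=
      Submodule.span Aᵐᵒᵖ {y | ∃ x ∈ I.1.toIdeal, ∃ v : V, y = op x • v}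
    have hV'fd : FiniteDimensional K V' :=
      inferInstanceAs (FiniteDimensional K (V'.restrictScalars K))
    have h1 : d ∣ Module.finrank K V' := by
      refine ih V' fun x hx v => ?_
      have hPL := prodIdeal_isTwoSided L
      obtain ⟨v, hv⟩ := v
      apply Subtype.ext
      change op x • v = 0
      induction hv using Submodule.span_induction generalizing x with
      | mem y hy =>
        obtain ⟨z, hz, w, rfl⟩ := hy
        rw [← mul_smul, ← op_mul]
        exact hV _ (by rw [prodIdeal_cons]; exact Ideal.mul_mem_mul hz hx) w
      | zero => rw [smul_zero]
      | add y z _ _ hy hz => rw [smul_add, hy x hx, hz x hx, add_zero]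
      | smul a y _ hy =>
        rw [← mul_smul, ← op_unop a, ← op_mul]
        exact hy _ ((prodIdeal L).mul_mem_left _ hx)
    have h2 : d ∣ Module.finrank K (V ⧸ V') := by
      obtain ⟨e'⟩ := e I
      have : NeZero (m I) := ⟨hm I⟩
      refine (hd I).trans ?_
      rw [← hl I]
      refine dvd_finrank_of_annihilated e' fun x hx v => ?_
      obtain ⟨v, rfl⟩ := V'.mkQ_surjective v
      rw [← map_smul]
      exact (Submodule.Quotient.mk_eq_zero V').2 (Submodule.subset_span ⟨x, hx, v, rfl⟩)
    have h3 := (V'.restrictScalars K).finrank_quotient_add_finrank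
    rw [(Submodule.Quotient.restrictScalarsEquiv K V').finrank_eq] at h3
    rw [← h3]
    exact dvd_add h2 h1

end Dimensions

end FreeLoc

namespace FreeLoc

open MulOpposite

/-! ### The module type -/

section IsoRanks

/-- The free right modules `Q ^ a` and `Q ^ b` are isomorphic. -/
def FreeIso (Q : Type u) [Ring Q] (a b : ℕ) : Prop := Nonempty ((Fin a → Q) ≃ₗ[Qᵐᵒᵖ] (Fin b → Q))

variable {Q : Type u} [Ring Q]

theorem FreeIso.refl (a : ℕ) : FreeIso Q a a := ⟨LinearEquiv.refl _ _⟩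

theorem FreeIso.symm {a b : ℕ} (h : FreeIso Q a b) : FreeIso Q b a := ⟨h.some.symm⟩

theorem FreeIso.trans {a b c : ℕ} (h : FreeIso Q a b) (h' : FreeIso Q b c) : FreeIso Q a c :=
  ⟨h.some.trans h'.some⟩

theorem FreeIso.add {a b a' b' : ℕ} (h : FreeIso Q a b) (h' : FreeIso Q a' b') :
    FreeIso Q (a + a') (b + b') := by
  obtain ⟨e⟩ := h
  obtain ⟨e'⟩ := h'
  let s : ∀ i j : ℕ, (Fin (i + j) → Q) ≃ₗ[Qᵐᵒᵖ] (Fin i → Q) × (Fin j → Q) := fun i j =>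
    (LinearEquiv.funCongrLeft Qᵐᵒᵖ Q finSumFinEquiv).trans
      (LinearEquiv.sumArrowLequivProdArrow (Fin i) (Fin j) Qᵐᵒᵖ Q)
  exact ⟨(s a a').trans ((e.prodCongr e').trans (s b b').symm)⟩

theorem FreeIso.of_equiv {r : ℕ} (e : Q ≃ₗ[Qᵐᵒᵖ] (Fin r → Q)) : FreeIso Q 1 r :=
  ⟨(LinearEquiv.funUnique (Fin 1) Qᵐᵒᵖ Q).trans e⟩

/-- If `Q ≅ Q ^ (1 + c i * k)` for all `i`, then `Q ≅ Q ^ (1 + d * k)` for the greatest common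
divisor `d` of the numbers `c i`. -/
theorem FreeIso.of_gcd {ι : Type*} {c : ι → ℕ} {k : ℕ} (h : ∀ i, FreeIso Q 1 (1 + c i * k)) {d : ℕ}
    (hd : ∀ a : ℕ, (∀ i, a ∣ c i) → a ∣ d) : FreeIso Q 1 (1 + d * k) := by
  have hadd : ∀ u v : ℕ, FreeIso Q 1 (1 + u * k) → FreeIso Q 1 (1 + v * k) →
      FreeIso Q 1 (1 + (u + v) * k) := by
    intro u v hu hv
    have := hv.trans (hu.add (FreeIso.refl (v * k)))
    rwa [add_assoc, ← add_mul] at this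
  -- The admissible exponents only form a monoid; their differences form a group, whose generator
  -- divides every `c i` and hence `d`.
  let E : AddSubgroup ℤ :=
    { carrier := {z | ∃ u v : ℕ, z = u - v ∧ FreeIso Q 1 (1 + u * k) ∧ FreeIso Q 1 (1 + v * k)}
      add_mem' := by
        rintro _ _ ⟨u, v, rfl, hu, hv⟩ ⟨u', v', rfl, hu', hv'⟩
        exact ⟨u + u', v + v', by push_cast; ring, hadd _ _ hu hu', hadd _ _ hv hv'⟩
      zero_mem' := ⟨0, 0, by simp, by simpa using FreeIso.refl 1, by simpa using FreeIso.refl 1⟩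
      neg_mem' := by
        rintro _ ⟨u, v, rfl, hu, hv⟩
        exact ⟨v, u, by ring, hv, hu⟩ }
  have hc : ∀ i, (c i : ℤ) ∈ E := fun i => ⟨c i, 0, by simp, h i, by simpa using FreeIso.refl 1⟩
  obtain ⟨g, hg⟩ := Int.subgroup_cyclic E
  rw [← AddSubgroup.zmultiples_eq_closure] at hg
  have hgc : ∀ i, g.natAbs ∣ c i := fun i => by
    have := hc i
    rw [hg, Int.mem_zmultiples_iff] at this
    exact Int.natCast_dvd_natCast.1 (Int.natAbs_dvd.2 this)
  have hdE : (d : ℤ) ∈ E := by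
    rw [hg, Int.mem_zmultiples_iff]
    exact Int.natAbs_dvd.1 (Int.natCast_dvd_natCast.2 (hd _ hgc))
  obtain ⟨u, v, huv, hu, hv⟩ := hdE
  -- Now `Q ≅ Q^(1 + u k) = Q^(1 + v k) ⊕ Q^(d k)`, and the first summand is isomorphic to `Q`.
  obtain rfl : u = v + d := by omega
  have h1 := hv.symm.add (FreeIso.refl (Q := Q) (d * k))
  rw [add_assoc, ← add_mul] at h1
  exact hu.trans h1

end IsoRanks

/-! ### Lattices, ranks and the module type. -/

section ModuleType

variable {K : Type u} [Field K] {X : Type} [Fintype X]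

/-- The augmentation `A → K` transports the invariant basis property from `K`. -/
theorem freeAlgebra_rank_eq {a b : ℕ}
    (e : (Fin a → FreeAlgebra K X) ≃ₗ[(FreeAlgebra K X)ᵐᵒᵖ] (Fin b → FreeAlgebra K X)) :
    a = b := by
  have hibn : InvariantBasisNumber (FreeAlgebra K X) := by
    rw [invariantBasisNumber_iff_matrix]
    intro n m M N hMN hNM
    have h := (invariantBasisNumber_iff_matrix (R := K)).1 inferInstance n m
    let f : FreeAlgebra K X →+* K := (FreeAlgebra.algebraMapInv (R := K) (X := X)).toRingHom
    refine h (M.map f) (N.map f) ?_ ?_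
    · rw [← Matrix.map_mul, hMN, Matrix.map_one f (map_zero f) (map_one f)]
    · rw [← Matrix.map_mul, hNM, Matrix.map_one f (map_zero f) (map_one f)]
  let ε : (FreeAlgebra K X)ᵐᵒᵖ ≃ₗ[(FreeAlgebra K X)ᵐᵒᵖ] FreeAlgebra K X :=
    { (opAddEquiv (α := FreeAlgebra K X)).symm with map_smul' := fun _ _ => rfl }
  exact InvariantBasisNumber.eq_of_fin_equiv
    (((LinearEquiv.piCongrRight fun _ => ε).trans e).trans
      (LinearEquiv.piCongrRight fun _ => ε).symm)

variable {Λ : Set (MaxFinIdeal K (FreeAlgebra K X))}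

theorem finiteDimensional_of_prodIdeal {p : ℕ}
    (N : Submodule (FreeAlgebra K X)ᵐᵒᵖ (Fin p → FreeAlgebra K X)) (L : List Λ)
    (hN : ∀ x ∈ prodIdeal L, ∀ w : Fin p → FreeAlgebra K X, op x • w ∈ N) :
    FiniteDimensional K ((Fin p → FreeAlgebra K X) ⧸ N) := by
  have := finiteDimensional_prodIdeal L
  let g : (Fin p → FreeAlgebra K X) →ₗ[K] (Fin p → FreeAlgebra K X ⧸ prodIdeal L) :=
    LinearMap.pi fun i => ((prodIdeal L).mkQ.restrictScalars K) ∘ₗ LinearMap.proj i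
  have hg : LinearMap.ker g ≤ N.restrictScalars K := by
    intro w hw
    have hw' : ∀ i, w i ∈ prodIdeal L := fun i =>
      (Submodule.Quotient.mk_eq_zero (prodIdeal L)).1 (congrFun hw i)
    have h1 : w = ∑ i, op (w i) • (Pi.single i 1 : Fin p → FreeAlgebra K X) := by
      conv_lhs => rw [← Finset.univ_sum_single w]
      refine Finset.sum_congr rfl fun i _ => ?_
      rw [← Pi.single_smul]
      simp
    rw [Submodule.restrictScalars_mem, h1]
    exact N.sum_mem fun i _ => hN _ (hw' i) _
  have h2 : FiniteDimensional K ((Fin p → FreeAlgebra K X) ⧸ LinearMap.ker g) :=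
    Module.Finite.equiv g.quotKerEquivRange.symm
  have h3 := Module.Finite.of_surjective (Submodule.factor hg) (Submodule.factor_surjective hg)
  exact Module.Finite.equiv (Submodule.Quotient.restrictScalarsEquiv K N)

variable {Q : Type u} [Ring Q] {φ : FreeAlgebra K X →+* Q}

/-- The pairs of vectors over `A` which correspond under an isomorphism over `Q`. -/
def latticeGraph (φ : FreeAlgebra K X →+* Q) {p q : ℕ} (e : (Fin p → Q) ≃ₗ[Qᵐᵒᵖ] (Fin q → Q)) :
    Submodule (FreeAlgebra K X)ᵐᵒᵖ ((Fin p → FreeAlgebra K X) × (Fin q → FreeAlgebra K X)) where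
  carrier := {z | e (fun i => φ (z.1 i)) = fun j => φ (z.2 j)}
  add_mem' := by
    intro y z hy hz
    have h1 : (fun i => φ ((y + z).1 i)) = (fun i => φ (y.1 i)) + fun i => φ (z.1 i) := by
      ext i; simp
    have h2 : (fun i => φ ((y + z).2 i)) = (fun i => φ (y.2 i)) + fun i => φ (z.2 i) := by
      ext i; simp
    rw [Set.mem_ofPred_eq, h1, h2, map_add, hy, hz]
  zero_mem' := by
    have h1 : (fun i : Fin p => φ ((0 : (Fin p → FreeAlgebra K X) ×
        (Fin q → FreeAlgebra K X)).1 i)) = 0 := by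
      ext i; simp
    rw [Set.mem_ofPred_eq, h1, map_zero]
    ext i
    simp
  smul_mem' := by
    intro c z hz
    have h1 : (fun i => φ ((c • z).1 i)) = op (φ c.unop) • fun i => φ (z.1 i) := by
      ext i
      exact map_mul φ _ _
    have h2 : (fun i => φ ((c • z).2 i)) = op (φ c.unop) • fun i => φ (z.2 i) := by
      ext i
      exact map_mul φ _ _
    rw [Set.mem_ofPred_eq, h1, h2, map_smul, hz]

theorem mem_latticeGraph {p q : ℕ} (e : (Fin p → Q) ≃ₗ[Qᵐᵒᵖ] (Fin q → Q))
    (z : (Fin p → FreeAlgebra K X) × (Fin q → FreeAlgebra K X)) :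
    z ∈ latticeGraph φ e ↔ e (fun i => φ (z.1 i)) = fun j => φ (z.2 j) := Iff.rfl

/-- Take a common ideal of denominators for the matrix entries of `e`. The product ideal inside it
absorbs left factors, so the same `L` serves all vectors `w`. -/
theorem IsRingOfRightQuotients.exists_smul_mem_lattice
    (h : IsRingOfRightQuotients (openRightIdeals Λ) φ) {p q : ℕ}
    (e : (Fin p → Q) ≃ₗ[Qᵐᵒᵖ] (Fin q → Q)) :
    ∃ L : List Λ, ∀ x ∈ prodIdeal L, ∀ w : Fin p → FreeAlgebra K X,
      ∃ v : Fin q → FreeAlgebra K X, e (fun i => φ ((op x • w) i)) = fun j => φ (v j) := by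
  obtain ⟨J, ⟨L, hL⟩, hJ⟩ := h.exists_common_dom (isGabrielTopology_openRightIdeals Λ)
    (ι := Fin p × Fin q) fun ij => e (Pi.single ij.1 1) ij.2
  refine ⟨L, fun x hx w => ?_⟩
  have h1 : (fun i => φ ((op x • w) i)) =
      ∑ i, op (φ (w i * x)) • (Pi.single i 1 : Fin p → Q) := by
    conv_lhs => rw [← Finset.univ_sum_single (fun i => φ ((op x • w) i))]
    refine Finset.sum_congr rfl fun i _ => ?_
    rw [← Pi.single_smul]
    simp
  have h2 : ∀ i j, e (Pi.single i 1) j * φ (w i * x) ∈ φ.range := fun i j =>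
    hJ _ (hL _ ((prodIdeal L).mul_mem_left _ hx)) (i, j)
  choose v hv using h2
  refine ⟨fun j => ∑ i, v i j, ?_⟩
  rw [h1, map_sum]
  ext j
  rw [Finset.sum_apply, map_sum]
  refine Finset.sum_congr rfl fun i _ => ?_
  rw [map_smul, hv]
  rfl

variable {m l : Λ → ℕ} {D : Λ → Type u} [∀ i, DivisionRing (D i)] [∀ i, Algebra K (D i)]

/-- The lattice of corresponding pairs embeds in `A^p` and in `A^q`, with quotients killed by
products from `Λ`, hence of dimensions `d a` and `d b`. By Schreier its rank is both `p + d a k` and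
`q + d b k`, so `q - p` is a positive multiple of `d k`. -/
theorem IsRingOfRightQuotients.rank_le (h : IsRingOfRightQuotients (openRightIdeals Λ) φ)
    (hinj : Function.Injective φ)
    (e : ∀ i : Λ, Nonempty ((FreeAlgebra K X ⧸ i.1.toIdeal) ≃ₐ[K]
      Matrix (Fin (m i)) (Fin (m i)) (D i)))
    (hm : ∀ i, m i ≠ 0) (hl : ∀ i, Module.finrank K (D i) = l i) {d : ℕ} (hd : ∀ i, d ∣ l i * m i)
    {k : ℕ} (hk : Fintype.card X = k + 1) {p q : ℕ} (hpq : p < q) (hiso : FreeIso Q p q) :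
    p + d * k ≤ q := by
  obtain ⟨u⟩ := hiso
  let P := latticeGraph φ u
  let f₁ := LinearMap.fst (FreeAlgebra K X)ᵐᵒᵖ (Fin p → FreeAlgebra K X)
    (Fin q → FreeAlgebra K X) ∘ₗ P.subtype
  let f₂ := LinearMap.snd (FreeAlgebra K X)ᵐᵒᵖ (Fin p → FreeAlgebra K X)
    (Fin q → FreeAlgebra K X) ∘ₗ P.subtype
  have hf₁ : Function.Injective f₁ := by
    refine (injective_iff_map_eq_zero f₁).2 ?_
    rintro ⟨⟨w, v⟩, hz⟩ hw
    obtain rfl : w = 0 := hw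
    rw [mem_latticeGraph] at hz
    have h1 : (fun i : Fin p => φ ((0 : Fin p → FreeAlgebra K X) i)) = 0 := by ext i; simp
    rw [h1, map_zero] at hz
    have h2 : v = 0 := funext fun j => hinj (by rw [← congrFun hz j, Pi.zero_apply]; simp)
    subst h2
    rfl
  have hf₂ : Function.Injective f₂ := by
    refine (injective_iff_map_eq_zero f₂).2 ?_
    rintro ⟨⟨w, v⟩, hz⟩ hv
    obtain rfl : v = 0 := hv
    rw [mem_latticeGraph] at hz
    have h1 : (fun i : Fin q => φ ((0 : Fin q → FreeAlgebra K X) i)) = 0 := by ext i; simp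
    rw [h1, LinearEquiv.map_eq_zero_iff] at hz
    have h2 : w = 0 := funext fun j => hinj (by rw [congrFun hz j]; simp)
    subst h2
    rfl
  have key : ∀ {a : ℕ} (N : Submodule (FreeAlgebra K X)ᵐᵒᵖ (Fin a → FreeAlgebra K X)) (L : List Λ),
      (∀ x ∈ prodIdeal L, ∀ w : Fin a → FreeAlgebra K X, op x • w ∈ N) →
      ∃ r c : ℕ, r = a + d * c * k ∧
        Nonempty (N ≃ₗ[(FreeAlgebra K X)ᵐᵒᵖ] (Fin r → FreeAlgebra K X)) := by
    intro a N L hN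
    have hfd := finiteDimensional_of_prodIdeal N L hN
    have hdvd : d ∣ Module.finrank K ((Fin a → FreeAlgebra K X) ⧸ N) := by
      refine dvd_finrank_of_prodIdeal e hm hl hd L _ fun x hx v => ?_
      obtain ⟨v, rfl⟩ := N.mkQ_surjective v
      rw [← map_smul]
      exact (Submodule.Quotient.mk_eq_zero N).2 (hN x hx v)
    obtain ⟨c, hc⟩ := hdvd
    obtain ⟨r, hr, hiso⟩ := exists_equiv_free_of_finite_codim N
    refine ⟨r, c, ?_, hiso⟩
    rw [hc, hk, Fintype.card_fin, mul_add, mul_one] at hr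
    omega
  obtain ⟨L₁, hL₁⟩ := h.exists_smul_mem_lattice u
  obtain ⟨L₂, hL₂⟩ := h.exists_smul_mem_lattice u.symm
  obtain ⟨r₁, a, hr₁, ⟨e₁⟩⟩ := key (LinearMap.range f₁) L₁ fun x hx w => by
    obtain ⟨v, hv⟩ := hL₁ x hx w
    exact ⟨⟨(op x • w, v), hv⟩, rfl⟩
  obtain ⟨r₂, b, hr₂, ⟨e₂⟩⟩ := key (LinearMap.range f₂) L₂ fun x hx w => by
    obtain ⟨v, hv⟩ := hL₂ x hx w
    refine ⟨⟨(v, op x • w), ?_⟩, rfl⟩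
    rw [mem_latticeGraph, ← hv, LinearEquiv.apply_symm_apply]
  have hr := freeAlgebra_rank_eq ((e₁.symm.trans (LinearEquiv.ofInjective f₁ hf₁).symm).trans
    ((LinearEquiv.ofInjective f₂ hf₂).trans e₂))
  have hab : b < a := by
    by_contra! hcon
    have : d * a * k ≤ d * b * k := by gcongr
    omega
  obtain ⟨t, rfl⟩ := Nat.exists_eq_add_of_lt hab
  have h3 : d * (b + t + 1) * k = d * b * k + d * k + d * t * k := by ring
  omega

/-- The ideal `I` itself has too large a codimension. The open right ideal of elements whose image
matrix has zero row `0` has codimension only `dim E * M`; its Schreier basis gives the isomorphism.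
-/
theorem IsRingOfRightQuotients.freeIso (h : IsRingOfRightQuotients (openRightIdeals Λ) φ)
    (hinj : Function.Injective φ) {k : ℕ} (hk : Fintype.card X = k + 1)
    (I : Λ) {M : ℕ} [NeZero M] {E : Type u} [DivisionRing E] [Algebra K E]
    (e : (FreeAlgebra K X ⧸ I.1.toIdeal) ≃ₐ[K] Matrix (Fin M) (Fin M) E) :
    FreeIso Q 1 (1 + Module.finrank K E * M * k) := by
  have hfin := I.1.finite
  have hE : FiniteDimensional K (Matrix (Fin M) (Fin M) E) := Module.Finite.equiv e.toLinearEquiv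
  have hfinE : FiniteDimensional K E := Module.Finite.of_surjective
    (Matrix.entryLinearMap K E (0 : Fin M) (0 : Fin M)) fun x => ⟨fun _ _ => x, rfl⟩
  let f : FreeAlgebra K X →ₗ[K] (Fin M → E) :=
    LinearMap.proj (R := K) (φ := fun _ : Fin M => Fin M → E) 0 ∘ₗ
      (Matrix.ofLinearEquiv (R := K) (m := Fin M) (n := Fin M) (α := E)).symm.toLinearMap ∘ₗ
      e.toLinearMap ∘ₗ (Ideal.Quotient.mkₐ K I.1.toIdeal).toLinearMap
  have hf : ∀ a, f a = (e (Ideal.Quotient.mk _ a)) 0 := fun _ => rfl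
  have hfsurj : Function.Surjective f := by
    intro y
    obtain ⟨b, hb⟩ := e.surjective (Matrix.of fun _ => y)
    obtain ⟨a, rfl⟩ := Ideal.Quotient.mk_surjective b
    exact ⟨a, by rw [hf, hb]; rfl⟩
  let R : RightIdeal (FreeAlgebra K X) :=
    { LinearMap.ker f with
      smul_mem' := by
        intro c a ha
        change f (a * c.unop) = 0
        have ha' : e (Ideal.Quotient.mk _ a) 0 = 0 := ha
        rw [hf, map_mul, map_mul]
        ext j
        rw [Matrix.mul_apply]
        refine Finset.sum_eq_zero fun i _ => ?_
        rw [ha', Pi.zero_apply, zero_mul] }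
  have hRf : R.restrictScalars K = LinearMap.ker f := by ext; rfl
  have hR : R ∈ openRightIdeals Λ := by
    refine ⟨[I], fun x hx => ?_⟩
    have hx' : x ∈ I.1.toIdeal := by simpa [prodIdeal] using hx
    change f x = 0
    rw [hf, Ideal.Quotient.eq_zero_iff_mem.2 hx', map_zero]
    rfl
  let ε : (FreeAlgebra K X ⧸ R) ≃ₗ[K] (Fin M → E) :=
    (Submodule.Quotient.restrictScalarsEquiv K R).symm.trans
      ((Submodule.quotEquivOfEq _ _ hRf).trans (f.quotKerEquivOfSurjective hfsurj))
  have hfd : FiniteDimensional K (FreeAlgebra K X ⧸ R) := Module.Finite.equiv ε.symm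
  have hrank : Module.finrank K (FreeAlgebra K X ⧸ R) = Module.finrank K E * M := by
    rw [ε.finrank_eq, Module.finrank_pi_fintype]
    simp [mul_comm]
  obtain ⟨r, hr, ⟨e'⟩⟩ := exists_rightIdeal_equiv_free R
  obtain ⟨e''⟩ := h.exists_equiv_of_equiv (isGabrielTopology_openRightIdeals Λ) hinj hR e'
  rw [hrank, hk, mul_add, mul_one] at hr
  obtain rfl : r = 1 + Module.finrank K E * M * k := by omega
  exact FreeIso.of_equiv e''

theorem IsRingOfRightQuotients.hasModuleType [Nonempty X] (hΛ : Λ.Nonempty)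
    (h : IsRingOfRightQuotients (openRightIdeals Λ) φ)
    (e : ∀ i : Λ, Nonempty ((FreeAlgebra K X ⧸ i.1.toIdeal) ≃ₐ[K]
      Matrix (Fin (m i)) (Fin (m i)) (D i)))
    (hl : ∀ i, Module.finrank K (D i) = l i) {d : ℕ} (hd : ∀ c : ℕ, c ∣ d ↔ ∀ i, c ∣ l i * m i)
    {k : ℕ} (hk : Fintype.card X = k + 1) (hk0 : k ≠ 0) : HasModuleType Q 1 (d * k + 1) := by
  have hm : ∀ i, m i ≠ 0 := by
    intro i hi
    obtain ⟨e'⟩ := e i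
    have : Nontrivial (FreeAlgebra K X ⧸ i.1.toIdeal) :=
      Ideal.Quotient.nontrivial_iff.2 i.1.ne_top
    have h1 := e'.symm.surjective.nontrivial
    rw [hi] at h1
    exact not_subsingleton (Matrix (Fin 0) (Fin 0) (D i)) inferInstance
  -- The gcd would vanish for an empty family; a member of `Λ` contributes a non-zero number.
  have hd0 : d ≠ 0 := by
    rintro rfl
    obtain ⟨I, hI⟩ := hΛ
    obtain ⟨e'⟩ := e ⟨I, hI⟩
    have hfin := I.finite
    have hE := Module.Finite.equiv e'.toLinearEquiv
    have : NeZero (m ⟨I, hI⟩) := ⟨hm _⟩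
    have hfinE : FiniteDimensional K (D ⟨I, hI⟩) := Module.Finite.of_surjective
      (Matrix.entryLinearMap K (D ⟨I, hI⟩) (0 : Fin (m ⟨I, hI⟩)) (0 : Fin (m ⟨I, hI⟩)))
      fun x => ⟨fun _ _ => x, rfl⟩
    have h1 := (hd 0).1 (dvd_refl 0) ⟨I, hI⟩
    rw [zero_dvd_iff, mul_eq_zero, ← hl] at h1
    rcases h1 with h1 | h1
    · exact Module.finrank_pos.ne' h1
    · exact hm _ h1
  have hinj := h.injective
  have hdvd := (hd d).1 dvd_rfl
  refine ⟨le_rfl, ?_, ?_, ?_⟩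
  · have := Nat.mul_ne_zero hd0 hk0
    omega
  · have h1 : FreeIso Q 1 (1 + d * k) := by
      refine FreeIso.of_gcd (c := fun i => l i * m i) (fun i => ?_) fun a ha => (hd a).2 ha
      have : NeZero (m i) := ⟨hm i⟩
      obtain ⟨e'⟩ := e i
      rw [← hl]
      exact h.freeIso hinj hk i e'
    rw [add_comm] at h1
    exact h1
  · intro p q hp hpq hiso
    have := h.rank_le hinj e hm hl hdvd hk hpq hiso
    omega

end ModuleType

end FreeLoc

namespace FreeLoc

/-! ### Completions of topological rings -/

/-- A dense embedding of a topological ring into a complete Hausdorff ring is its completion. -/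
theorem exists_completion_ringEquiv {α β : Type u} [Ring α] [UniformSpace α]
    [IsUniformAddGroup α] [IsTopologicalRing α] [Ring β] [UniformSpace β] [IsUniformAddGroup β]
    [IsTopologicalRing β] [CompleteSpace β] [T0Space β] (f : α →+* β)
    (hf : IsUniformInducing f) (hd : DenseRange f) :
    ∃ e : UniformSpace.Completion α ≃+* β, Continuous e ∧ Continuous e.symm ∧
      ∀ a : α, e (a : UniformSpace.Completion α) = f a := by
  let P : AbstractCompletion α := ⟨β, f, inferInstance, inferInstance, inferInstance, hf, hd⟩
  let E : UniformSpace.Completion α ≃ᵤ β := UniformSpace.Completion.cPkg.compareEquiv P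
  let F : UniformSpace.Completion α →+* β :=
    UniformSpace.Completion.extensionHom f hf.uniformContinuous.continuous
  have hFE : ∀ x, F x = E x := fun x => rfl
  let e : UniformSpace.Completion α ≃+* β := { E.toEquiv, F with
    toFun := F
    invFun := E.symm
    left_inv := fun x => by rw [hFE, E.symm_apply_apply]
    right_inv := fun x => by rw [hFE, E.apply_symm_apply] }
  refine ⟨e, E.continuous, E.symm.continuous, fun a => ?_⟩
  exact UniformSpace.Completion.extensionHom_coe f hf.uniformContinuous.continuous a

/-! ### The product of adic limits inside a product of discrete rings. -/

section Limit

variable {A : Type u} [Ring A] {ι : Type u} (J : ι → Ideal A) [∀ i, (J i).IsTwoSided]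

/-- All coordinates of a family of elements of the inverse limits `lim A / J i ^ l`. -/
def limitCoord : (∀ i, AdicLimit (J i)) →+* (∀ p : ι × ℕ, A ⧸ J p.1 ^ p.2) where
  toFun x p := (x p.1).1 p.2
  map_one' := rfl
  map_mul' _ _ := rfl
  map_zero' := rfl
  map_add' _ _ := rfl

theorem limitCoord_injective : Function.Injective (limitCoord J) := by
  intro x y h
  funext i
  exact Subtype.ext (funext fun l => congrFun h (i, l))

theorem limitCoord_isInducing :
    let : ∀ p : ι × ℕ, TopologicalSpace (A ⧸ J p.1 ^ p.2) := fun _ => ⊥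
    Topology.IsInducing (limitCoord J) := by
  let : ∀ p : ι × ℕ, TopologicalSpace (A ⧸ J p.1 ^ p.2) := fun _ => ⊥
  refine ⟨?_⟩
  simp only [Pi.topologicalSpace, AdicLimit.instTopologicalSpace, induced_iInf, induced_compose,
    iInf_prod]
  refine iInf_congr fun i => induced_compose.trans ?_
  rw [induced_iInf]
  exact iInf_congr fun l => induced_compose

theorem mem_range_limitCoord {x : ∀ p : ι × ℕ, A ⧸ J p.1 ^ p.2} :
    x ∈ Set.range (limitCoord J) ↔ ∀ (i : ι) (k l : ℕ) (h : k ≤ l),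
      Ideal.Quotient.factor (Ideal.pow_le_pow_right h) (x (i, l)) = x (i, k) := by
  constructor
  · rintro ⟨y, rfl⟩ i k l h
    exact (y i).2 k l h
  · intro h
    exact ⟨fun i => ⟨fun l => x (i, l), h i⟩, rfl⟩

/-- Coherence is a family of equations between continuous maps into discrete spaces. Closedness of
the range is what makes the product of the limits complete. -/
theorem limitCoord_isClosed_range :
    let : ∀ p : ι × ℕ, TopologicalSpace (A ⧸ J p.1 ^ p.2) := fun _ => ⊥
    IsClosed (Set.range (limitCoord J)) := by
  let : ∀ p : ι × ℕ, TopologicalSpace (A ⧸ J p.1 ^ p.2) := fun _ => ⊥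
  have : ∀ p : ι × ℕ, DiscreteTopology (A ⧸ J p.1 ^ p.2) := fun _ => ⟨rfl⟩
  have h : Set.range (limitCoord J) = ⋂ (i : ι) (k : ℕ) (l : ℕ) (h : k ≤ l),
      {x | Ideal.Quotient.factor (Ideal.pow_le_pow_right h) (x (i, l)) = x (i, k)} := by
    ext x
    simp only [mem_range_limitCoord, Set.mem_iInter, Set.mem_ofPred_eq]
  rw [h]
  refine isClosed_iInter fun i => isClosed_iInter fun k => isClosed_iInter fun l =>
    isClosed_iInter fun h => ?_
  let F : A ⧸ J (i, l).1 ^ (i, l).2 → A ⧸ J (i, k).1 ^ (i, k).2 :=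
    Ideal.Quotient.factor (Ideal.pow_le_pow_right h)
  have hF : Continuous F := continuous_of_discreteTopology
  have h1 : Continuous fun x : ∀ p : ι × ℕ, A ⧸ J p.1 ^ p.2 => F (x (i, l)) :=
    hF.comp (continuous_apply (i, l))
  have h2 : Continuous fun x : ∀ p : ι × ℕ, A ⧸ J p.1 ^ p.2 => x (i, k) :=
    continuous_apply (i, k)
  have h3 : IsClosed {y : (A ⧸ J (i, k).1 ^ (i, k).2) × (A ⧸ J (i, k).1 ^ (i, k).2) |
      y.1 = y.2} := isClosed_discrete _
  exact h3.preimage (h1.prodMk h2)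

theorem isTopologicalRing_pi_adicLimit : IsTopologicalRing (∀ i, AdicLimit (J i)) := by
  let : ∀ p : ι × ℕ, TopologicalSpace (A ⧸ J p.1 ^ p.2) := fun _ => ⊥
  have : ∀ p : ι × ℕ, DiscreteTopology (A ⧸ J p.1 ^ p.2) := fun _ => ⟨rfl⟩
  have hg := limitCoord_isInducing J
  refine { continuous_add := ?_, continuous_mul := ?_, continuous_neg := ?_ }
  · refine hg.continuous_iff.2 ?_
    exact (hg.continuous.comp continuous_fst).add (hg.continuous.comp continuous_snd)
  · refine hg.continuous_iff.2 ?_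
    exact (hg.continuous.comp continuous_fst).mul (hg.continuous.comp continuous_snd)
  · exact hg.continuous_iff.2 hg.continuous.neg

/-- A dense topological embedding into `∏ lim A / J i ^ l` is a completion. -/
theorem exists_completion_ringEquiv_adicLimit {α : Type u} [Ring α] [UniformSpace α]
    [IsUniformAddGroup α] [IsTopologicalRing α] (f : α →+* ∀ i, AdicLimit (J i))
    (hf : Topology.IsInducing f) (hd : DenseRange f) :
    ∃ e : UniformSpace.Completion α ≃+* (∀ i, AdicLimit (J i)), Continuous e ∧
      Continuous e.symm ∧ ∀ a : α, e (a : UniformSpace.Completion α) = f a := by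
  have := isTopologicalRing_pi_adicLimit J
  let : UniformSpace (∀ i, AdicLimit (J i)) :=
    IsTopologicalAddGroup.rightUniformSpace (∀ i, AdicLimit (J i))
  have : IsUniformAddGroup (∀ i, AdicLimit (J i)) := isUniformAddGroup_of_addCommGroup
  let : ∀ p : ι × ℕ, UniformSpace (A ⧸ J p.1 ^ p.2) := fun _ => ⊥
  have : ∀ p : ι × ℕ, DiscreteUniformity (A ⧸ J p.1 ^ p.2) := fun _ => inferInstance
  have hg : Topology.IsInducing (limitCoord J) := limitCoord_isInducing J
  have hgu : IsUniformInducing (limitCoord J) := AddMonoidHom.isUniformInducing_of_isInducing hg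
  have : CompleteSpace (∀ i, AdicLimit (J i)) :=
    (completeSpace_iff_isComplete_range hgu).2 (limitCoord_isClosed_range J).isComplete
  have : T0Space (∀ i, AdicLimit (J i)) :=
    (Topology.IsEmbedding.mk hg (limitCoord_injective J)).t0Space
  exact exists_completion_ringEquiv f (AddMonoidHom.isUniformInducing_of_isInducing hf) hd

end Limit

/-! ### Comaximal ideals -/

section Comaximal

variable {A : Type u} [Ring A]

/-- With `1 = i + j`, split `x = i x + j x`; the second term lies in `J I`, which is where
commutation enters. -/
theorem inf_le_mul_of_sup_eq_top {I J : Ideal A} [I.IsTwoSided] [J.IsTwoSided]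
    (h : I ⊔ J = ⊤) (hc : I * J = J * I) : I ⊓ J ≤ I * J := by
  rintro x ⟨hI, hJ⟩
  obtain ⟨i, hi, j, hj, hij⟩ := Submodule.mem_sup.1 (h ▸ Submodule.mem_top : (1 : A) ∈ I ⊔ J)
  rw [← one_mul x, ← hij, add_mul]
  refine add_mem (Ideal.mul_mem_mul hi hJ) ?_
  rw [hc]
  exact Ideal.mul_mem_mul hj hI

theorem pow_mul_comm_of_mul_comm {I J : Ideal A} [I.IsTwoSided] [J.IsTwoSided]
    (hc : I * J = J * I) (k : ℕ) : I ^ k * J = J * I ^ k := by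
  induction k with
  | zero => rw [Submodule.pow_zero, Ideal.one_eq_top, Ideal.top_mul, Ideal.mul_top]
  | succ k ih => rw [Ideal.IsTwoSided.pow_succ, mul_assoc, ih, ← mul_assoc, hc, mul_assoc]

/-- The Chinese remainder theorem for finitely many pairwise comaximal two-sided ideals. -/
theorem exists_forall_sub_mem {ι : Type*} (s : Finset ι) (J : ι → Ideal A)
    [∀ i, (J i).IsTwoSided] (hJ : ∀ i ∈ s, ∀ j ∈ s, i ≠ j → J i ⊔ J j = ⊤) (a : ι → A) :
    ∃ x : A, ∀ i ∈ s, x - a i ∈ J i := by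
  classical
  induction s using Finset.induction_on with
  | empty => exact ⟨0, by simp⟩
  | insert k s hk ih =>
    obtain ⟨x, hx⟩ := ih fun i hi j hj => hJ i (Finset.mem_insert_of_mem hi) j
      (Finset.mem_insert_of_mem hj)
    have htop : J k ⊔ ⨅ i ∈ s, J i = ⊤ := Ideal.sup_iInf_eq_top fun i hi =>
      hJ k (Finset.mem_insert_self k s) i (Finset.mem_insert_of_mem hi) (by rintro rfl; exact hk hi)
    -- Subtracting `v` corrects `x` modulo `J k` without changing it modulo the ideals already
    -- treated.
    obtain ⟨u, hu, v, hv, huv⟩ := Submodule.mem_sup.1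
      (htop ▸ Submodule.mem_top : (x - a k) ∈ J k ⊔ (⨅ i ∈ s, J i))
    refine ⟨x - v, fun i hi => ?_⟩
    rcases Finset.mem_insert.1 hi with rfl | hi
    · have : x - v - a i = u := by rw [eq_sub_of_add_eq huv]; abel
      rwa [this]
    · rw [sub_right_comm]
      exact sub_mem (hx i hi) ((Submodule.mem_iInf _).1 ((Submodule.mem_iInf _).1 hv i) hi)

end Comaximal

/-! ### The completion for a commuting set of ideals. -/

section Completion

variable {K A : Type u} [Field K] [Ring A] [Algebra K A]

theorem sup_isTwoSided (I J : Ideal A) [I.IsTwoSided] [J.IsTwoSided] : (I ⊔ J).IsTwoSided := by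
  refine ⟨fun {a} b ha => ?_⟩
  obtain ⟨i, hi, j, hj, rfl⟩ := Submodule.mem_sup.1 ha
  rw [add_mul]
  exact Submodule.add_mem_sup (I.mul_mem_right b hi) (J.mul_mem_right b hj)

theorem MaxFinIdeal.sup_eq_top {I J : MaxFinIdeal K A} (h : I ≠ J) :
    I.toIdeal ⊔ J.toIdeal = ⊤ := by
  by_contra hne
  have key : ∀ {I J : MaxFinIdeal K A}, I.toIdeal ⊔ J.toIdeal ≠ ⊤ → J.toIdeal ≤ I.toIdeal := by
    intro I J hne
    by_contra hle
    exact hne (I.maximal _ (sup_isTwoSided _ _) (lt_of_le_of_ne le_sup_left fun e => hle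
      (sup_eq_left.1 e.symm)))
  exact h (MaxFinIdeal.ext (le_antisymm (key (sup_comm I.toIdeal J.toIdeal ▸ hne)) (key hne)))

variable {Λ : Set (MaxFinIdeal K A)}

theorem sup_prodIdeal_eq_top {I : Ideal A} [I.IsTwoSided] (L : List Λ)
    (h : ∀ J ∈ L, I ⊔ J.1.toIdeal = ⊤) : I ⊔ prodIdeal L = ⊤ := by
  induction L with
  | nil => rw [prodIdeal_nil, sup_top_eq]
  | cons J L ih =>
    rw [prodIdeal_cons, Ideal.sup_mul_eq_of_coprime_left (h J List.mem_cons_self)]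
    exact ih fun M hM => h M (List.mem_cons_of_mem _ hM)

theorem mul_prodIdeal_comm {I : Ideal A} [I.IsTwoSided] (L : List Λ)
    (h : ∀ J ∈ L, I * J.1.toIdeal = J.1.toIdeal * I) : I * prodIdeal L = prodIdeal L * I := by
  induction L with
  | nil => rw [prodIdeal_nil, Ideal.top_mul, Ideal.mul_top]
  | cons J L ih =>
    rw [prodIdeal_cons, ← mul_assoc, h J List.mem_cons_self, mul_assoc,
      ih fun M hM => h M (List.mem_cons_of_mem _ hM), mul_assoc]

open Classical in
theorem prodIdeal_eq_pow_count_mul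
    (hc : ∀ I ∈ Λ, ∀ J ∈ Λ, I.toIdeal * J.toIdeal = J.toIdeal * I.toIdeal) (I : Λ)
    (L : List Λ) :
    prodIdeal L = I.1.toIdeal ^ L.count I * prodIdeal (L.filter fun J => J ≠ I) := by
  induction L with
  | nil =>
    rw [List.count_nil, Submodule.pow_zero, Ideal.one_eq_top, Ideal.top_mul, List.filter_nil]
  | cons J L ih =>
    by_cases h : J = I
    · subst h
      rw [List.count_cons_self, Ideal.IsTwoSided.pow_succ, mul_assoc,
        List.filter_cons_of_neg (by simp), ← ih, prodIdeal_cons]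
    · rw [List.count_cons_of_ne h, List.filter_cons_of_pos (by simpa using h), prodIdeal_cons,
        prodIdeal_cons, ← mul_assoc, pow_mul_comm_of_mul_comm (hc I.1 I.2 J.1 J.2), mul_assoc, ← ih]

open Classical in
-- Move all copies of one `I` to the front. The resulting power and the product of the rest are
-- comaximal and commute, so lying in both suffices. The recursion is on the list without `I`, with
-- the same exponent `N`.
theorem mem_prodIdeal_of_forall_mem_pow
    (hc : ∀ I ∈ Λ, ∀ J ∈ Λ, I.toIdeal * J.toIdeal = J.toIdeal * I.toIdeal) {N : ℕ} {x : A} :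
    ∀ L : List Λ, L.length ≤ N → (∀ J ∈ L, x ∈ J.1.toIdeal ^ N) → x ∈ prodIdeal L
  | [], _, _ => by rw [prodIdeal_nil]; exact Submodule.mem_top
  | I :: t, hN, hx => by
    set L := I :: t with hL
    have hlen : (L.filter fun J => J ≠ I).length ≤ t.length := by
      rw [hL, List.filter_cons_of_neg (by simp)]
      exact List.length_filter_le _ _
    have hx' : x ∈ prodIdeal (L.filter fun J => J ≠ I) :=
      mem_prodIdeal_of_forall_mem_pow hc _ (hlen.trans ((Nat.le_succ _).trans hN))
        fun J hJ => hx J (List.mem_of_mem_filter hJ)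
    have := prodIdeal_isTwoSided (L.filter fun J => J ≠ I)
    rw [prodIdeal_eq_pow_count_mul hc I L]
    refine inf_le_mul_of_sup_eq_top ?_ ?_ ⟨?_, hx'⟩
    · refine sup_prodIdeal_eq_top _ fun J hJ => Ideal.pow_sup_eq_top (MaxFinIdeal.sup_eq_top ?_)
      intro h
      simp only [List.mem_filter, decide_eq_true_eq] at hJ
      exact hJ.2 (Subtype.ext h.symm)
    · exact mul_prodIdeal_comm _ fun J _ =>
        pow_mul_comm_of_mul_comm (hc I.1 I.2 J.1 J.2) _
    · exact Ideal.pow_le_pow_right (List.count_le_length.trans hN) (hx I List.mem_cons_self)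
  termination_by L => L.length
  decreasing_by
    exact Nat.lt_succ_of_le hlen

theorem prodIdeal_replicate (I : Λ) (l : ℕ) :
    prodIdeal (List.replicate l I) = I.1.toIdeal ^ l := by
  induction l with
  | zero => rw [List.replicate_zero, prodIdeal_nil, Submodule.pow_zero, Ideal.one_eq_top]
  | succ l ih => rw [List.replicate_succ, prodIdeal_cons, ih, Ideal.IsTwoSided.pow_succ]

variable (Λ) in
/-- The canonical map from `A` to `∏ lim A / I ^ l`. -/
def toAdicLimits : Topologized Λ →+* ∀ I : Λ, AdicLimit I.1.toIdeal :=
  (RingHom.pi fun I : Λ => AdicLimit.of I.1.toIdeal : A →+* ∀ I : Λ, AdicLimit I.1.toIdeal)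

variable (Λ) in
theorem Topologized.hasBasis_nhds_zero :
    (nhds (0 : Topologized Λ)).HasBasis (fun _ => True)
      fun L : List Λ => ((prodIdeal L : Ideal A) : Set A) :=
  (ringSubgroupsBasis Λ).hasBasis_nhds_zero

/-- Powers are products of repeated ideals, so the map is always continuous. Commutation gives the
other direction: the product over `L` contains the intersection of the powers `I ^ L.length` for `I`
in `L`. -/
theorem toAdicLimits_isInducing
    (hc : ∀ I ∈ Λ, ∀ J ∈ Λ, I.toIdeal * J.toIdeal = J.toIdeal * I.toIdeal) :
    Topology.IsInducing (toAdicLimits Λ) := by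
  classical
  let J : Λ → Ideal A := fun I => I.1.toIdeal
  let : ∀ p : Λ × ℕ, TopologicalSpace (A ⧸ J p.1 ^ p.2) := fun _ => ⊥
  have : ∀ p : Λ × ℕ, DiscreteTopology (A ⧸ J p.1 ^ p.2) := fun _ => ⟨rfl⟩
  refine Topology.IsInducing.of_comp_iff (limitCoord_isInducing J) |>.1 ?_
  let g : Topologized Λ →+* ∀ p : Λ × ℕ, A ⧸ J p.1 ^ p.2 := (limitCoord J).comp (toAdicLimits Λ)
  have hg : ∀ (a : A) (p : Λ × ℕ), g a p = Ideal.Quotient.mk (J p.1 ^ p.2) a := fun _ _ => rfl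
  change Topology.IsInducing g
  refine (IsTopologicalAddGroup.isInducing_iff_nhds_zero (f := g)).2 (le_antisymm ?_ ?_)
  · rw [← Filter.map_le_iff_le_comap]
    refine tendsto_pi_nhds.2 fun p => ?_
    rw [Pi.zero_apply, nhds_discrete (A ⧸ J p.1 ^ p.2), Filter.tendsto_pure]
    refine (Topologized.hasBasis_nhds_zero Λ).mem_iff.2 ⟨List.replicate p.2 p.1, trivial, ?_⟩
    intro a ha
    rw [prodIdeal_replicate] at ha
    exact (hg a p).trans (Ideal.Quotient.eq_zero_iff_mem.2 ha)
  · refine (Topologized.hasBasis_nhds_zero Λ).ge_iff.2 fun L _ => ?_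
    refine ⟨⋂ I ∈ L.toFinset, {x | x (I, L.length) = 0}, ?_, ?_⟩
    · refine (Filter.biInter_finset_mem _).2 fun I _ => ?_
      refine (isOpen_discrete ({0} : Set (A ⧸ J (I, L.length).1 ^ (I, L.length).2))).preimage
        (continuous_apply (I, L.length)) |>.mem_nhds (Set.mem_singleton _)
    · intro a ha
      refine mem_prodIdeal_of_forall_mem_pow hc L le_rfl fun I hI => ?_
      have h := Set.mem_iInter₂.1 ha I (List.mem_toFinset.2 hI)
      exact Ideal.Quotient.eq_zero_iff_mem.1 h

variable (Λ) in
-- A basic open set constrains finitely many coordinates `(I, l)`. With `N` the largest `l`,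
-- approximate the `N`-th coordinates simultaneously, since the powers `I ^ N` are pairwise
-- comaximal; coherence handles smaller `l`.
theorem toAdicLimits_denseRange : DenseRange (toAdicLimits Λ) := by
  classical
  let J : Λ → Ideal A := fun I => I.1.toIdeal
  let : ∀ p : Λ × ℕ, TopologicalSpace (A ⧸ J p.1 ^ p.2) := fun _ => ⊥
  have : ∀ p : Λ × ℕ, DiscreteTopology (A ⧸ J p.1 ^ p.2) := fun _ => ⟨rfl⟩
  intro x
  refine mem_closure_iff.2 fun U hU hx => ?_
  obtain ⟨V, hV, rfl⟩ := (limitCoord_isInducing J).isOpen_iff.1 hU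
  obtain ⟨s, u, hu, hsu⟩ := isOpen_pi_iff.1 hV _ hx
  let N := s.sup Prod.snd
  choose a ha using fun I : Λ => Ideal.Quotient.mk_surjective ((x I).1 N)
  obtain ⟨b, hb⟩ := exists_forall_sub_mem (s.image Prod.fst) (fun I => J I ^ N)
    (fun I _ I' _ h => Ideal.pow_sup_pow_eq_top (MaxFinIdeal.sup_eq_top fun e =>
      h (Subtype.ext e))) a
  refine ⟨toAdicLimits Λ b, hsu fun p hp => ?_, ⟨b, rfl⟩⟩
  have hpN : p.2 ≤ N := Finset.le_sup (f := Prod.snd) hp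
  have h1 : Ideal.Quotient.mk (J p.1 ^ N) b = (x p.1).1 N := by
    rw [← ha p.1]
    exact Ideal.Quotient.eq.2 (hb p.1 (Finset.mem_image_of_mem _ hp))
  have h2 : limitCoord J (toAdicLimits Λ b) p = limitCoord J x p :=
    calc limitCoord J (toAdicLimits Λ b) p
        = Ideal.Quotient.factor (Ideal.pow_le_pow_right hpN)
            (Ideal.Quotient.mk (J p.1 ^ N) b) := rfl
      _ = (x p.1).1 p.2 := by rw [h1]; exact (x p.1).2 p.2 N hpN
  rw [h2]
  exact (hu p hp).2

/-- The completion of `A` with respect to a commuting set of ideals. -/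
theorem exists_completion_topologized_ringEquiv
    (hc : ∀ I ∈ Λ, ∀ J ∈ Λ, I.toIdeal * J.toIdeal = J.toIdeal * I.toIdeal) :
    ∃ e : UniformSpace.Completion (Topologized Λ) ≃+* (∀ I : Λ, AdicLimit I.1.toIdeal),
      Continuous e ∧ Continuous e.symm ∧ ∀ a : A,
        e (Topologized.mk Λ a : UniformSpace.Completion (Topologized Λ)) =
          fun I : Λ => AdicLimit.of I.1.toIdeal a := by
  obtain ⟨e, h1, h2, h3⟩ := exists_completion_ringEquiv_adicLimit
    (fun I : Λ => I.1.toIdeal) (toAdicLimits Λ) (toAdicLimits_isInducing hc)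
    (toAdicLimits_denseRange Λ)
  exact ⟨e, h1, h2, fun a => h3 (Topologized.mk Λ a)⟩

end Completion

end FreeLoc

open FreeLoc in
theorem theorem3p11 {K : Type u} [Field K] (n : ℕ) (hn : 2 ≤ n) :
    -- Flat bimorphisms are the rings of right quotients for the Gabriel topologies given by sets of
    -- maximal two-sided ideals of finite codimension.
    (∀ (Q : Type u) [Ring Q] (φ : FreeAlgebra K (Fin n) →+* Q),
      IsFlatBimorphism φ ↔ ∃ Λ : Set (MaxFinIdeal K (FreeAlgebra K (Fin n))),
        IsRingOfRightQuotients (openRightIdeals Λ) φ) ∧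
    (∀ Λ : Set (MaxFinIdeal K (FreeAlgebra K (Fin n))), IsGabrielTopology (openRightIdeals Λ)) ∧
    -- The factor rings are matrix rings over division rings of finite dimension.
    (∀ I : MaxFinIdeal K (FreeAlgebra K (Fin n)),
      ∃ (m : ℕ) (D : Type u) (_ : DivisionRing D) (_ : Algebra K D), 1 ≤ m ∧ FiniteDimensional K D ∧
        Nonempty ((FreeAlgebra K (Fin n) ⧸ I.toIdeal) ≃ₐ[K] Matrix (Fin m) (Fin m) D)) ∧
    -- The module type.
    (∀ (Q : Type u) [Ring Q] (φ : FreeAlgebra K (Fin n) →+* Q)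
      (Λ : Set (MaxFinIdeal K (FreeAlgebra K (Fin n)))),
      Λ.Nonempty → IsRingOfRightQuotients (openRightIdeals Λ) φ →
      ∀ (m l : Λ → ℕ) (D : Λ → Type u) [∀ i, DivisionRing (D i)] [∀ i, Algebra K (D i)],
      (∀ i : Λ, Nonempty ((FreeAlgebra K (Fin n) ⧸ i.1.toIdeal) ≃ₐ[K]
        Matrix (Fin (m i)) (Fin (m i)) (D i))) →
      (∀ i : Λ, Module.finrank K (D i) = l i) →
      -- `d` is the greatest common divisor of the (possibly infinite) family `l i * m i`
      ∀ d : ℕ, (∀ c : ℕ, c ∣ d ↔ ∀ i : Λ, c ∣ l i * m i) →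
      HasModuleType Q 1 (d * (n - 1) + 1)) ∧
    -- The completion in the commuting case.
    (∀ Λ : Set (MaxFinIdeal K (FreeAlgebra K (Fin n))),
      (∀ I ∈ Λ, ∀ J ∈ Λ, I.toIdeal * J.toIdeal = J.toIdeal * I.toIdeal) →
      ∃ e : UniformSpace.Completion (Topologized Λ) ≃+* (∀ I : Λ, AdicLimit I.1.toIdeal),
        Continuous e ∧ Continuous e.symm ∧
        ∀ a : FreeAlgebra K (Fin n),
          e (Topologized.mk Λ a : UniformSpace.Completion (Topologized Λ)) =
            fun I : Λ => AdicLimit.of I.1.toIdeal a) := by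
  have : Nonempty (Fin n) := ⟨⟨0, by omega⟩⟩
  refine ⟨fun Q _ φ => isFlatBimorphism_iff, isGabrielTopology_openRightIdeals,
    fun I => I.exists_algEquiv_matrix, fun Q _ φ Λ hΛ h m l D _ _ e hl d hd => ?_,
    fun Λ hc => exists_completion_topologized_ringEquiv hc⟩
  exact h.hasModuleType hΛ e hl hd (by rw [Fintype.card_fin]; omega) (by omega)
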